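/- **Setting.** Let $G$ be a locally compact, second countable, Hausdorff abelian group, and let $P\subset G$ be a closed subsemigroup containing $0$ such that $P-P=G$ and $\operatorname{Int}(P)$ is dense in $P$. Assume that $P$ has an order unit, i.e. there is $a_0\in \operatorname{Int}(P)$ such that for every $s\in G$ there is an integer $n\ge 1$ with $na_0-s\in \operatorname{Int}(P)$. Let $c:G\to\mathbb R$ be a continuous homomorphism. *Isometric representations.* An isometric representation of $P$ on a separable complex Hilbert space $H$ is a strongly continuous semigroup $V=\{V_a\}_{a\in P}$ of isometries on $H$. It is pure if $\bigcap_{a\in P}\operatorname{Ran}(V_a)=\{0\}$, and it has commuting range projections if the projections $V_aV_a^*$, $a\in P$, commute with one another. Put $\mathcal D_V=\bigcup_{a\in P}\ker V_a^*$ and let $\mathcal L_V$ be the space of linear functionals on $\mathcal D_V$ whose restriction to $\ker V_a^*$ is bounded for every $a\in P$. For $a\in P$ let $T_a:\mathcal L_V\to\mathcal L_V$ be given by $T_a\phi(\xi)=\phi(V_a\xi)$. For $\beta\in\mathbb R$ let $\mathcal A_\beta(V)=\{\phi\in\mathcal L_V: T_a\phi=e^{-\beta c(a)/2}\phi\ \text{for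 all } a\in P\}$, and call $V$ $e^{-\beta c/2}$-conformal if $\mathcal A_\beta(V)\ne\{0\}$. *The space $Y_u$.* Let $Y_u$ be the set of all closed sets $A\subset G$ with $A\neq\emptyset$, $A\ne G$ and $-P+A\subset A$, with the Fell topology and its Borel $\sigma$-algebra, on which $G$ acts by translations $(A,s)\mapsto A+s$. Let $X_u=\{A\in Y_u: 0\in A\}$. A measure $\mu$ on $Y_u$ is $e^{-\beta c}$-conformal if $\mu(E+s)=e^{-\beta c(s)}\mu(E)$ for all Borel $E\subset Y_u$ and all $s\in G$; it is ergodic if every $G$-invariant Borel set is null or co-null. For an $e^{-\beta c}$-conformal $\mu$ let $V^\mu$ be the semigroup of isometries on $L^2(X_u,\mu)$, viewed as a subspace of $L^2(Y_u,\mu)$, given by $V^\mu_af(A)=e^{\beta c(a)/2}f(A-a)$ for $a\in P$. **Theorem.** Let $\beta\neq0$ be a real number, and let $V$ be a pure isometric representation of $P$ on a separable Hilbert space $H$ with commuting range projections. Assume that $V$ is $e^{-\beta c/2}$-conformal and that $\dim\mathcal A_\beta(V)=1$. Suppose that there is a strongly continuous group of unitaries $\{U_t\}_{t\in\mathbb R}$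 on $H$ such that $U_tV_aU_t^*=e^{itc(a)}V_a$ for every $a\in P$ and $t\in\mathbb R$. Then there is a non-zero, ergodic, $e^{-\beta c}$-conformal Radon measure $\mu$ on $Y_u$ such that 1. $V^\mu$ is a direct summand of $V$, i.e. $V^\mu$ is unitarily equivalent to the restriction of $V$ to a closed subspace of $H$ that is invariant under all $V_a$ and $V_a^*$, $a\in P$; 2. the measure class $[\mu]$ contains a $G$-invariant, $\sigma$-finite measure on $Y_u$, i.e. there is such a measure $\nu$ with $\nu\ll\mu$ and $\mu\ll\nu$. -/

import Mathlib

open MeasureTheory TopologicalSpace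
open scoped ENNReal

noncomputable section

namespace ConformalIsometries

/-! ### Semigroups of isometries -/

section Isometries

variable {G : Type*} [AddCommGroup G]

/-- A semigroup of isometries on `H`, indexed by the submonoid `P` of `G`. -/
structure IsometrySemigroup (P : AddSubmonoid G) (H : Type*) [NormedAddCommGroup H]
    [InnerProductSpace ℂ H] where
  toFun : P → (H →ₗᵢ[ℂ] H)
  map_zero' : ∀ x : H, toFun 0 x = x
  map_add' : ∀ (a b : P) (x : H), toFun (a + b) x = toFun a (toFun b x)

namespace IsometrySemigroup

variable {P : AddSubmonoid G} {H : Type*} [NormedAddCommGroup H] [InnerProductSpace ℂ H]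

instance : CoeFun (IsometrySemigroup P H) (fun _ => P → (H →ₗᵢ[ℂ] H)) := ⟨toFun⟩

/-- The operator `V_a` as a bounded operator. -/
def op (V : IsometrySemigroup P H) (a : P) : H →L[ℂ] H := (V a).toContinuousLinearMap

/-- `V` is strongly continuous; a strongly continuous semigroup of isometries is called an
isometric representation of `P`. -/
def IsStronglyContinuous [TopologicalSpace G] (V : IsometrySemigroup P H) : Prop :=
  ∀ x : H, Continuous fun a : P => V a x

/-- `V` is pure: the ranges of the `V_a` have trivial intersection. -/
def IsPure (V : IsometrySemigroup P H) : Prop :=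
  ⋂ a : P, Set.range (V a) = {0}

variable [CompleteSpace H]

/-- The adjoint `V_a^*`. -/
def adj (V : IsometrySemigroup P H) (a : P) : H →L[ℂ] H := ContinuousLinearMap.adjoint (V.op a)

/-- The range projection `E_a = V_a V_a^*`. -/
def rangeProj (V : IsometrySemigroup P H) (a : P) : H →L[ℂ] H := V.op a ∘L V.adj a

/-- The range projections of `V` commute with one another. -/
def HasCommutingRangeProjections (V : IsometrySemigroup P H) : Prop :=
  ∀ a b : P, Commute (V.rangeProj a) (V.rangeProj b)

theorem adj_add (V : IsometrySemigroup P H) (a b : P) (x : H) :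
    V.adj (a + b) x = V.adj b (V.adj a x) := by
  have h : V.op (a + b) = V.op a ∘L V.op b := by
    ext y
    exact V.map_add' a b y
  simp only [adj]
  rw [h, ContinuousLinearMap.adjoint_comp]
  rfl

theorem adj_apply (V : IsometrySemigroup P H) (a : P) (x : H) : V.adj a (V a x) = x := by
  refine ext_inner_left ℂ fun y => ?_
  rw [adj, ContinuousLinearMap.adjoint_inner_right]
  exact (V a).inner_map_map y x

/-- The subspace `D_V`, the union over `a` in `P` of `Ker V_a^*`. -/
def kerUnion (V : IsometrySemigroup P H) : Submodule ℂ H where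
  carrier := {x | ∃ a : P, V.adj a x = 0}
  zero_mem' := ⟨0, map_zero _⟩
  add_mem' := by
    rintro x y ⟨a, ha⟩ ⟨b, hb⟩
    refine ⟨a + b, ?_⟩
    rw [map_add, adj_add, ha, map_zero, add_comm a b, adj_add, hb, map_zero, add_zero]
  smul_mem' := by
    rintro r x ⟨a, ha⟩
    exact ⟨a, by rw [map_smul, ha, smul_zero]⟩

theorem adj_eq_zero_of_adj_eq_zero (V : IsometrySemigroup P H) (a b : P) {x : H}
    (hx : V.adj b x = 0) : V.adj (a + b) (V a x) = 0 := by
  rw [adj_add, adj_apply, hx]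

/-- The restriction of `V_a` to `D_V`. -/
def onKerUnion (V : IsometrySemigroup P H) (a : P) : V.kerUnion →ₗ[ℂ] V.kerUnion :=
  (V a).toLinearMap.restrict fun _ hx =>
    hx.elim fun b hb => ⟨a + b, V.adj_eq_zero_of_adj_eq_zero a b hb⟩

/-- The space `L_V` of linear functionals on `D_V` whose restriction to each `Ker V_a^*` is
bounded. -/
def locallyBoundedDual (V : IsometrySemigroup P H) : Submodule ℂ (V.kerUnion →ₗ[ℂ] ℂ) where
  carrier := {φ | ∀ a : P, ∃ C : ℝ, ∀ x : V.kerUnion, V.adj a x = 0 → ‖φ x‖ ≤ C * ‖(x : H)‖}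
  zero_mem' := fun _ => ⟨0, fun x _ => by simp⟩
  add_mem' := by
    intro φ ψ hφ hψ a
    obtain ⟨C, hC⟩ := hφ a
    obtain ⟨D, hD⟩ := hψ a
    refine ⟨C + D, fun x hx => ?_⟩
    calc ‖(φ + ψ) x‖ ≤ ‖φ x‖ + ‖ψ x‖ := norm_add_le _ _
      _ ≤ C * ‖(x : H)‖ + D * ‖(x : H)‖ := add_le_add (hC x hx) (hD x hx)
      _ = (C + D) * ‖(x : H)‖ := by ring
  smul_mem' := by
    intro r φ hφ a
    obtain ⟨C, hC⟩ := hφ a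
    refine ⟨‖r‖ * C, fun x hx => ?_⟩
    calc ‖(r • φ) x‖ = ‖r‖ * ‖φ x‖ := norm_smul r (φ x)
      _ ≤ ‖r‖ * (C * ‖(x : H)‖) := mul_le_mul_of_nonneg_left (hC x hx) (norm_nonneg r)
      _ = ‖r‖ * C * ‖(x : H)‖ := by ring

/-- The operator `T_a` on `L_V`, given by `(T_a φ)(x) = φ (V_a x)`. -/
def shift (V : IsometrySemigroup P H) (a : P) :
    V.locallyBoundedDual →ₗ[ℂ] V.locallyBoundedDual where
  toFun φ := ⟨(φ : V.kerUnion →ₗ[ℂ] ℂ) ∘ₗ V.onKerUnion a, fun b => by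
    obtain ⟨C, hC⟩ := φ.2 (a + b)
    refine ⟨C, fun x hx => ?_⟩
    have h := hC (V.onKerUnion a x) (V.adj_eq_zero_of_adj_eq_zero a b hx)
    have hn : ‖((V.onKerUnion a x : V.kerUnion) : H)‖ = ‖(x : H)‖ := (V a).norm_map x
    rwa [hn] at h⟩
  map_add' _ _ := rfl
  map_smul' _ _ := rfl

/-- The space `A_β(V)` of all `φ` in `L_V` with `T_a φ = e^{-β c(a)/2} φ` for every `a`. -/
def eigenspace (V : IsometrySemigroup P H) (c : G →+ ℝ) (β : ℝ) :
    Submodule ℂ V.locallyBoundedDual where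
  carrier := {φ | ∀ a : P, V.shift a φ = (Real.exp (-(β * c a) / 2) : ℂ) • φ}
  zero_mem' := fun a => by rw [map_zero, smul_zero]
  add_mem' := fun {φ ψ} hφ hψ a => by rw [map_add, hφ a, hψ a, smul_add]
  smul_mem' := fun r φ hφ a => by rw [map_smul, hφ a, smul_comm]

/-- `V` is `e^{-βc/2}`-conformal. -/
def IsConformal (V : IsometrySemigroup P H) (c : G →+ ℝ) (β : ℝ) : Prop :=
  ∃ φ : V.locallyBoundedDual, φ ≠ 0 ∧
    ∀ a : P, V.shift a φ = (Real.exp (-(β * c a) / 2) : ℂ) • φ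

/-- `W` is a direct summand of `V`: it is unitarily equivalent to the restriction of `V` to a
closed subspace which is invariant under all `V_a` and all `V_a^*`. -/
def IsDirectSummand {K : Type*} [NormedAddCommGroup K] [InnerProductSpace ℂ K]
    (W : IsometrySemigroup P K) (V : IsometrySemigroup P H) : Prop :=
  ∃ H₀ : Submodule ℂ H, IsClosed (H₀ : Set H) ∧
    (∀ a : P, ∀ x ∈ H₀, V a x ∈ H₀) ∧ (∀ a : P, ∀ x ∈ H₀, V.adj a x ∈ H₀) ∧
    ∃ Φ : K ≃ₗᵢ[ℂ] H₀, ∀ (a : P) (x : K), ((Φ (W a x) : H₀) : H) = V a (Φ x : H₀)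

end IsometrySemigroup

end Isometries

/-! ### The space `Y_u` -/

/-- The Fell topology on the set of closed subsets of `X`: it is generated by the sets
`{A | A ∩ U ≠ ∅}` with `U` open and `{A | A ∩ K = ∅}` with `K` compact. -/
@[reducible] def fellTopology (X : Type*) [TopologicalSpace X] : TopologicalSpace (Closeds X) :=
  generateFrom ({S | ∃ U : Set X, IsOpen U ∧ S = {A : Closeds X | ((A : Set X) ∩ U).Nonempty}} ∪
    {S | ∃ K : Set X, IsCompact K ∧ S = {A : Closeds X | (A : Set X) ∩ K = ∅}})

section Space

variable {G : Type*} [AddCommGroup G] [TopologicalSpace G]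

/-- The space `Y_u` of all non-empty proper closed subsets `A` of `G` with `-P + A ⊆ A`. -/
def Yu (P : AddSubmonoid G) : Type _ :=
  {A : Closeds G // (∀ p ∈ P, ∀ x ∈ A, -p + x ∈ A) ∧ (A : Set G) ≠ ∅ ∧ (A : Set G) ≠ Set.univ}

namespace Yu

variable {P : AddSubmonoid G}

/-- The closed subset of `G` that a point of `Y_u` is. -/
def toSet (A : Yu P) : Set G := (A.1 : Set G)

/-- The topology of `Y_u`, induced by the Fell topology. -/
instance : TopologicalSpace (Yu P) := (fellTopology G).induced Subtype.val

/-- The Borel `σ`-algebra of `Y_u`. -/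
instance : MeasurableSpace (Yu P) := borel (Yu P)

instance : BorelSpace (Yu P) := ⟨rfl⟩

theorem ext {A B : Yu P} (h : ∀ x, x ∈ A.toSet ↔ x ∈ B.toSet) : A = B :=
  Subtype.ext (Closeds.ext (Set.ext h))

theorem isOpen_hit {U : Set G} (hU : IsOpen U) :
    IsOpen {A : Yu P | (A.toSet ∩ U).Nonempty} :=
  ⟨{A : Closeds G | ((A : Set G) ∩ U).Nonempty},
    GenerateOpen.basic _ (Or.inl ⟨U, hU, rfl⟩), rfl⟩

theorem isOpen_miss {K : Set G} (hK : IsCompact K) : IsOpen {A : Yu P | A.toSet ∩ K = ∅} :=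
  ⟨{A : Closeds G | (A : Set G) ∩ K = ∅}, GenerateOpen.basic _ (Or.inr ⟨K, hK, rfl⟩), rfl⟩

variable [IsTopologicalAddGroup G]

/-- The translate `A + s = {x | x - s ∈ A}` of a point `A` of `Y_u` by `s` in `G`. -/
def translate (s : G) (A : Yu P) : Yu P :=
  ⟨⟨{x | x - s ∈ A.toSet}, A.1.isClosed.preimage (continuous_id.sub continuous_const)⟩, by
    obtain ⟨A, hA, h0, h1⟩ := A
    refine ⟨fun p hp x hx => ?_, ?_, ?_⟩
    · have := hA p hp _ hx
      rwa [← add_sub_assoc] at this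
    · obtain ⟨x, hx⟩ := Set.nonempty_iff_ne_empty.2 h0
      refine Set.nonempty_iff_ne_empty.1 ⟨x + s, ?_⟩
      change x + s - s ∈ (A : Set G)
      rwa [add_sub_cancel_right]
    · obtain ⟨x, hx⟩ := (Set.ne_univ_iff_exists_notMem _).1 h1
      refine (Set.ne_univ_iff_exists_notMem _).2 ⟨x + s, fun h => hx ?_⟩
      change x + s - s ∈ (A : Set G) at h
      rwa [add_sub_cancel_right] at h⟩

theorem mem_translate {s x : G} {A : Yu P} : x ∈ (translate s A).toSet ↔ x - s ∈ A.toSet :=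
  Iff.rfl

theorem translate_translate (s t : G) (A : Yu P) :
    translate s (translate t A) = translate (s + t) A :=
  ext fun x => by simp only [mem_translate, sub_sub]

theorem translate_zero (A : Yu P) : translate 0 A = A :=
  ext fun x => by simp only [mem_translate, sub_zero]

theorem translate_neg_translate (s : G) (A : Yu P) : translate (-s) (translate s A) = A := by
  rw [translate_translate, neg_add_cancel, translate_zero]

theorem translate_translate_neg (s : G) (A : Yu P) : translate s (translate (-s) A) = A := by
  rw [translate_translate, add_neg_cancel, translate_zero]

theorem preimage_translate_neg (s : G) (E : Set (Yu P)) :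
    translate (-s) ⁻¹' E = translate s '' E := by
  ext A
  constructor
  · exact fun h => ⟨_, h, translate_translate_neg s A⟩
  · rintro ⟨B, hB, rfl⟩
    rwa [Set.mem_preimage, translate_neg_translate]

theorem continuous_translate (s : G) : Continuous (translate s : Yu P → Yu P) := by
  refine continuous_induced_rng.2 (continuous_generateFrom_iff.2 ?_)
  rintro S (⟨U, hU, rfl⟩ | ⟨K, hK, rfl⟩)
  · convert isOpen_hit (P := P) (hU.preimage (continuous_id.add (continuous_const (y := s))))
      using 1
    ext A
    constructor
    · rintro ⟨x, hx, hxU⟩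
      refine ⟨x - s, hx, ?_⟩
      change x - s + s ∈ U
      rwa [sub_add_cancel]
    · rintro ⟨x, hx, hxU⟩
      refine ⟨x + s, ?_, hxU⟩
      change x + s - s ∈ A.toSet
      rwa [add_sub_cancel_right]
  · convert isOpen_miss (P := P) (hK.image (continuous_id.sub (continuous_const (y := s))))
      using 1
    ext A
    change (translate s A).toSet ∩ K = ∅ ↔ A.toSet ∩ _ = ∅
    simp only [Set.eq_empty_iff_forall_notMem]
    constructor
    · rintro h _ ⟨hx, x, hxK, rfl⟩
      exact h x ⟨hx, hxK⟩
    · rintro h x ⟨hx, hxK⟩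
      exact h (x - s) ⟨hx, x, hxK, rfl⟩

theorem measurable_translate (s : G) : Measurable (translate s : Yu P → Yu P) :=
  (continuous_translate s).measurable

end Yu

/-- The subset `X_u` of `Y_u` of all `A` that contain `0`. -/
def Xu (P : AddSubmonoid G) : Set (Yu P) := {A | (0 : G) ∈ A.toSet}

variable [IsTopologicalAddGroup G] {P : AddSubmonoid G}

theorem translate_mem_Xu_of_neg {a : G} (ha : a ∈ P) {A : Yu P}
    (h : Yu.translate (-a) A ∈ Xu P) : A ∈ Xu P := by
  have h1 : (0 : G) - -a ∈ A.toSet := h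
  have h2 := A.2.1 a ha _ h1
  have h3 : -a + (0 - -a) = (0 : G) := by abel
  rw [h3] at h2
  exact h2

/-! ### Conformal measures on `Y_u` -/

/-- `μ` is `e^{-βc}`-conformal: `μ (E + s) = e^{-β c(s)} μ E`. -/
def IsConformalMeasure (c : G →+ ℝ) (β : ℝ) (μ : Measure (Yu P)) : Prop :=
  ∀ (s : G) (E : Set (Yu P)), MeasurableSet E →
    μ (Yu.translate s '' E) = ENNReal.ofReal (Real.exp (-(β * c s))) * μ E

/-- `μ` is invariant under the translation action of `G`. -/
def IsInvariantMeasure (μ : Measure (Yu P)) : Prop :=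
  ∀ (s : G) (E : Set (Yu P)), MeasurableSet E → μ (Yu.translate s '' E) = μ E

/-- `μ` is ergodic for the translation action of `G`: every `G`-invariant Borel set is null or
co-null. -/
def IsErgodicMeasure (μ : Measure (Yu P)) : Prop :=
  ∀ E : Set (Yu P), MeasurableSet E → (∀ s : G, Yu.translate s '' E = E) → μ E = 0 ∨ μ Eᶜ = 0

/-! ### The isometric representation of a conformal measure -/

section Koopman

variable {c : G →+ ℝ} {β : ℝ} {μ : Measure (Yu P)}

theorem IsConformalMeasure.measurePreserving (h : IsConformalMeasure c β μ) (s : G) :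
    MeasurePreserving (Yu.translate (-s)) μ (ENNReal.ofReal (Real.exp (-(β * c s))) • μ) := by
  refine ⟨Yu.measurable_translate _, Measure.ext fun E hE => ?_⟩
  rw [Measure.map_apply (Yu.measurable_translate _) hE, Yu.preimage_translate_neg, h s E hE]
  rfl

theorem IsConformalMeasure.quasiMeasurePreserving (h : IsConformalMeasure c β μ) (s : G) :
    Measure.QuasiMeasurePreserving (Yu.translate (-s)) μ μ :=
  (h.measurePreserving s).quasiMeasurePreserving.mono_right Measure.smul_absolutelyContinuous

/-- The function `A ↦ e^{β c(s)/2} f (A - s)`. -/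
def koopmanFun (c : G →+ ℝ) (β : ℝ) (s : G) (f : Yu P → ℂ) (A : Yu P) : ℂ :=
  (Real.exp (β * c s / 2) : ℂ) * f (Yu.translate (-s) A)

theorem IsConformalMeasure.koopmanFun_congr (h : IsConformalMeasure c β μ) (s : G)
    {f g : Yu P → ℂ} (hfg : f =ᵐ[μ] g) : koopmanFun c β s f =ᵐ[μ] koopmanFun c β s g := by
  filter_upwards [(h.quasiMeasurePreserving s).ae_eq_comp hfg] with A hA
  have hA' : f (Yu.translate (-s) A) = g (Yu.translate (-s) A) := hA
  simp only [koopmanFun, hA']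

theorem IsConformalMeasure.eLpNorm_koopmanFun (h : IsConformalMeasure c β μ) (s : G)
    {f : Yu P → ℂ} (hf : AEStronglyMeasurable f μ) :
    eLpNorm (koopmanFun c β s f) 2 μ = eLpNorm f 2 μ := by
  have h1 : koopmanFun c β s f
      = (Real.exp (β * c s / 2) : ℂ) • (f ∘ Yu.translate (-s)) := rfl
  have h2 : AEStronglyMeasurable f (ENNReal.ofReal (Real.exp (-(β * c s))) • μ) :=
    hf.mono_ac Measure.smul_absolutelyContinuous
  rw [h1, eLpNorm_const_smul, eLpNorm_comp_measurePreserving h2 (h.measurePreserving s),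
    eLpNorm_smul_measure_of_ne_top (by norm_num)]
  have h3 : ‖(Real.exp (β * c s / 2) : ℂ)‖ₑ = ENNReal.ofReal (Real.exp (β * c s / 2)) := by
    rw [← ofReal_norm, Complex.norm_real, Real.norm_of_nonneg (Real.exp_pos _).le]
  have h4 : ENNReal.ofReal (Real.exp (-(β * c s))) ^ (1 / (2 : ℝ≥0∞)).toReal
      = ENNReal.ofReal (Real.exp (-(β * c s) / 2)) := by
    rw [ENNReal.ofReal_rpow_of_pos (Real.exp_pos _), ← Real.exp_mul]
    norm_num
    ring_nf
  rw [h3, h4, smul_eq_mul, ← mul_assoc, ← ENNReal.ofReal_mul (Real.exp_pos _).le, ← Real.exp_add]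
  ring_nf
  simp

theorem IsConformalMeasure.memLp_koopmanFun (h : IsConformalMeasure c β μ) (s : G)
    (f : Lp ℂ 2 μ) : MemLp (koopmanFun c β s f) 2 μ := by
  refine ⟨?_, ?_⟩
  · exact ((Lp.aestronglyMeasurable f).comp_quasiMeasurePreserving
      (h.quasiMeasurePreserving s)).const_mul _
  · rw [h.eLpNorm_koopmanFun s (Lp.aestronglyMeasurable f)]
    exact Lp.eLpNorm_lt_top f

/-- The Koopman operator `U_s` on `L²(Y_u, μ)`, given by `(U_s f)(A) = e^{β c(s)/2} f (A - s)`. -/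
def koopman (h : IsConformalMeasure c β μ) (s : G) : Lp ℂ 2 μ →ₗᵢ[ℂ] Lp ℂ 2 μ where
  toFun f := (h.memLp_koopmanFun s f).toLp _
  map_add' f g := by
    refine Lp.ext ?_
    filter_upwards [(h.memLp_koopmanFun s (f + g)).coeFn_toLp,
      (h.memLp_koopmanFun s f).coeFn_toLp, (h.memLp_koopmanFun s g).coeFn_toLp,
      Lp.coeFn_add ((h.memLp_koopmanFun s f).toLp _) ((h.memLp_koopmanFun s g).toLp _),
      h.koopmanFun_congr s (Lp.coeFn_add f g)] with A h1 h2 h3 h4 h5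
    rw [h1, h4, Pi.add_apply, h2, h3, h5]
    simp only [koopmanFun, Pi.add_apply, mul_add]
  map_smul' r f := by
    refine Lp.ext ?_
    filter_upwards [(h.memLp_koopmanFun s (r • f)).coeFn_toLp,
      (h.memLp_koopmanFun s f).coeFn_toLp,
      Lp.coeFn_smul r ((h.memLp_koopmanFun s f).toLp _),
      h.koopmanFun_congr s (Lp.coeFn_smul r f)] with A h1 h2 h3 h4
    rw [h1, RingHom.id_apply, h3, Pi.smul_apply, h2, h4]
    simp only [koopmanFun, Pi.smul_apply, smul_eq_mul]
    ring
  norm_map' f := by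
    change ‖(h.memLp_koopmanFun s f).toLp _‖ = ‖f‖
    rw [Lp.norm_toLp, h.eLpNorm_koopmanFun s (Lp.aestronglyMeasurable f), Lp.norm_def]

theorem koopman_coeFn (h : IsConformalMeasure c β μ) (s : G) (f : Lp ℂ 2 μ) :
    koopman h s f =ᵐ[μ] koopmanFun c β s f :=
  (h.memLp_koopmanFun s f).coeFn_toLp

theorem koopman_zero (h : IsConformalMeasure c β μ) (f : Lp ℂ 2 μ) : koopman h 0 f = f := by
  refine Lp.ext ?_
  filter_upwards [koopman_coeFn h 0 f] with A hA
  rw [hA]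
  simp [koopmanFun, Yu.translate_zero]

theorem koopman_add (h : IsConformalMeasure c β μ) (s t : G) (f : Lp ℂ 2 μ) :
    koopman h (s + t) f = koopman h s (koopman h t f) := by
  refine Lp.ext ?_
  filter_upwards [koopman_coeFn h (s + t) f, koopman_coeFn h s (koopman h t f),
    h.koopmanFun_congr s (koopman_coeFn h t f)] with A h1 h2 h3
  rw [h1, h2, h3]
  have h4 : -t + -s = -(s + t) := by abel
  simp only [koopmanFun, Yu.translate_translate, h4]
  rw [← mul_assoc, ← Complex.ofReal_mul, ← Real.exp_add, map_add]
  ring_nf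

/-- `L²(X_u, μ)`, viewed as the subspace of `L²(Y_u, μ)` of all functions that vanish almost
everywhere outside `X_u`. -/
def L2Xu (μ : Measure (Yu P)) : Submodule ℂ (Lp ℂ 2 μ) where
  carrier := {f | ∀ᵐ A ∂μ, A ∉ Xu P → f A = 0}
  zero_mem' := by
    filter_upwards [Lp.coeFn_zero ℂ 2 μ] with A hA _
    rw [hA, Pi.zero_apply]
  add_mem' := by
    intro f g hf hg
    filter_upwards [hf, hg, Lp.coeFn_add f g] with A h1 h2 h3 hA
    rw [h3, Pi.add_apply, h1 hA, h2 hA, add_zero]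
  smul_mem' := by
    intro r f hf
    filter_upwards [hf, Lp.coeFn_smul r f] with A h1 h2 hA
    rw [h2, Pi.smul_apply, h1 hA, smul_zero]

theorem koopman_mem_L2Xu (h : IsConformalMeasure c β μ) {a : G} (ha : a ∈ P) {f : Lp ℂ 2 μ}
    (hf : f ∈ L2Xu μ) : koopman h a f ∈ L2Xu μ := by
  filter_upwards [koopman_coeFn h a f, (h.quasiMeasurePreserving a).ae hf] with A h1 h2 hA
  rw [h1, koopmanFun, h2 fun hA' => hA (translate_mem_Xu_of_neg ha hA'), mul_zero]

/-- The semigroup of isometries `V^μ` on `L²(X_u, μ)`: the operator `V^μ_a` is the restriction of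
the Koopman operator `U_a`. -/
def conformalRep (h : IsConformalMeasure c β μ) : IsometrySemigroup P (L2Xu μ) where
  toFun a :=
    { toLinearMap := (koopman h (a : G)).toLinearMap.restrict
        fun _ hf => koopman_mem_L2Xu h a.2 hf
      norm_map' := fun f => (koopman h (a : G)).norm_map f }
  map_zero' f := Subtype.ext (koopman_zero h f)
  map_add' a b f := Subtype.ext (koopman_add h a b f)

end Koopman

end Space

end ConformalIsometries

end

open ConformalIsometries

/-! The representation is diagonalized over `Y_u`. For `x = a - b` with `a`, `b` in `P`, the
operator `V_b^* V_a V_a^* V_b` depends only on `x`, and since the range projections commute these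
operators form a commuting family of projections `E_x`, decreasing in `x` along `P`. At a joint
spectral point the set of `x` at which `E_x` takes the value 1 is invariant under `-P`; purity makes
it a proper subset almost surely, and strong continuity allows it to be replaced by its closure.
This gives a spectral measure `𝓔` on `Y_u`, supported on `X_u`, with `𝓔(S + p) V_p = V_p 𝓔(S)`
(`exists_isCovariant`).

A nonzero functional in `A_β(V)` is represented on each `ker V_a^*` by a vector `s_a`. The measures
`‖𝓔(S) s_b‖²` for `S` inside the window of `b` fit together to one conformal measure `μ`
(`IsConformalFamily.measure_eq_dist`, `IsConformalFamily.isConformalMeasure`), and `1_S ↦ 𝓔(S) s_b`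
embeds `L²(X_u, μ)` in `H` as a reducing subspace on which `V` acts as `V^μ`
(`IsConformalFamily.isDirectSummand`). Since `A_β(V)` is a line, every operator in the commutant of
`V` has all the `s_b` as eigenvectors with one common eigenvalue (`exists_isConformalFamily`).
Applied to `𝓔(E)` with `E` invariant, this yields ergodicity.

Because `U_t V_a U_t^* = e^{itc(a)} V_a`, the group `U` commutes with `𝓔`. Conjugating the
projection onto the summand by `U_t` gives another projection in the commutant, with eigenvalue 0 or
1 at the `s_b`; continuity forces 1 for small `t`, so the summand is invariant under `U`. There
`U_t` should be multiplication by some `e^{itg}`, and the covariance relation then reads `g(A + a) =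
g(A) + c(a)`. The function `g` is extracted from the resolvent at `z = 1`, which is multiplication
by `h = 1/(1 - ig)` (`exists_equivariant_of_local`). It extends equivariantly from `X_u` to `Y_u`,
and the density `e^{βg}` turns `μ` into an equivalent invariant measure. -/

namespace ConformalIsometries
open WeakDual Set
open scoped InnerProductSpace

/-! ### Joint distributions of commuting projections via Gelfand duality -/

section Gelfand

universe u

variable {H : Type u} [NormedAddCommGroup H] [InnerProductSpace ℂ H] [CompleteSpace H]

/-- By Gelfand duality, `f ↦ Re ⟪ξ, ρ(f) ξ⟫` is a positive functional on the real continuous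
functions on the character space, and Riesz–Markov turns it into a measure. An element whose
transform is the indicator of `S` then computes the measure of `S`. -/
theorem exists_measure_characterSpace {A : Type*} [CommCStarAlgebra A]
    [MeasurableSpace (characterSpace ℂ A)] [BorelSpace (characterSpace ℂ A)]
    (ρ : A →⋆ₐ[ℂ] (H →L[ℂ] H)) (ξ : H) :
    ∃ m : Measure (characterSpace ℂ A), ∀ (a : A) (S : Set (characterSpace ℂ A)),
      MeasurableSet S → (∀ χ ∈ S, χ a = 1) → (∀ χ ∉ S, χ a = 0) →
      m S = ENNReal.ofReal (⟪ξ, ρ a ξ⟫_ℂ).re := by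
  let g := gelfandStarTransform A
  let toC : C(characterSpace ℂ A, ℝ) → C(characterSpace ℂ A, ℂ) := fun f =>
    ⟨fun χ => (f χ : ℂ), Complex.continuous_ofReal.comp f.continuous⟩
  have toC_add : ∀ f f', toC (f + f') = toC f + toC f' := fun f f' => by
    ext χ; simp [toC]
  have toC_smul : ∀ (r : ℝ) f, toC (r • f) = (r : ℂ) • toC f := fun r f => by
    ext χ; simp [toC]
  let F : C(characterSpace ℂ A, ℝ) → ℝ := fun f => (⟪ξ, ρ (g.symm (toC f)) ξ⟫_ℂ).re
  have F_add : ∀ f f', F (f + f') = F f + F f' := fun f f' => by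
    simp [F, toC_add]
  have F_nonneg : ∀ f : C(characterSpace ℂ A, ℝ), (∀ χ, 0 ≤ f χ) → 0 ≤ F f := by
    intro f hf
    -- Positivity: `f` is the square of `√f`, so `ρ(f) = T^* T` with `T = ρ(√f)`.
    let r : C(characterSpace ℂ A, ℝ) := ⟨fun χ => √(f χ), f.continuous.sqrt⟩
    have h1 : toC f = star (toC r) * toC r := by
      ext χ
      have : ((f χ : ℝ) : ℂ) = ((√(f χ) * √(f χ) : ℝ) : ℂ) := by rw [Real.mul_self_sqrt (hf χ)]
      simp only [toC, r, ContinuousMap.coe_mk, ContinuousMap.mul_apply, ContinuousMap.star_apply]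
      rw [this]
      simp
    have h2 : ρ (g.symm (toC f))
        = ContinuousLinearMap.adjoint (ρ (g.symm (toC r))) * ρ (g.symm (toC r)) := by
      rw [h1, map_mul, map_star, map_mul, map_star]; rfl
    simp only [F, h2]
    rw [mul_apply_eq_comp, ContinuousLinearMap.adjoint_inner_right]
    exact inner_self_nonneg (𝕜 := ℂ)
  let Λ : CompactlySupportedContinuousMap (characterSpace ℂ A) ℝ →ₚ[ℝ] ℝ :=
    { toFun := fun f => F f.toContinuousMap
      map_add' := fun f f' => F_add f.toContinuousMap f'.toContinuousMap
      map_smul' := fun r f => by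
        change (⟪ξ, ρ (g.symm (toC (r • f.toContinuousMap))) ξ⟫_ℂ).re = r * F f.toContinuousMap
        rw [toC_smul, map_smul, map_smul, smul_apply, inner_smul_right,
          Complex.re_ofReal_mul]
      monotone' := fun f f' hff' => by
        have h1 : F (f'.toContinuousMap - f.toContinuousMap) + F f.toContinuousMap
            = F f'.toContinuousMap := by rw [← F_add, sub_add_cancel]
        have h2 := F_nonneg (f'.toContinuousMap - f.toContinuousMap)
          fun χ => sub_nonneg.2 (hff' χ)
        change F f.toContinuousMap ≤ F f'.toContinuousMap
        linarith }
  refine ⟨RealRMK.rieszMeasure Λ, fun a S hS h1 h0 => ?_⟩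
  let f : C(characterSpace ℂ A, ℝ) :=
    ⟨fun χ => (χ a).re, Complex.continuous_re.comp (g a).continuous⟩
  let f' : CompactlySupportedContinuousMap (characterSpace ℂ A) ℝ :=
    ⟨f, HasCompactSupport.of_compactSpace _⟩
  have hfS : ∀ χ, f χ = S.indicator 1 χ := by
    intro χ
    by_cases hχ : χ ∈ S
    · simp [f, h1 χ hχ, hχ]
    · simp [f, h0 χ hχ, hχ]
  have hga : toC f = g a := by
    ext χ
    change (((χ a).re : ℝ) : ℂ) = χ a
    by_cases hχ : χ ∈ S
    · simp [h1 χ hχ]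
    · simp [h0 χ hχ]
  have hint := RealRMK.integral_rieszMeasure Λ f'
  have e1 : ∫ x, f' x ∂(RealRMK.rieszMeasure Λ) = (RealRMK.rieszMeasure Λ).real S := by
    rw [← integral_indicator_one hS]
    exact integral_congr_ae (Filter.Eventually.of_forall hfS)
  have e2 : Λ f' = (⟪ξ, ρ a ξ⟫_ℂ).re := by
    change F f = _
    simp only [F, hga]
    rw [StarAlgEquiv.symm_apply_apply]
  rw [← e2, ← hint, e1, Measure.real, ENNReal.ofReal_toReal (measure_ne_top _ _)]

/-- A commuting family of projections has a joint distribution in every vector. -/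
theorem exists_joint_distribution {ι : Type*} (E : ι → H →L[ℂ] H)
    (hE : ∀ i, IsStarProjection (E i)) (hc : ∀ i j, Commute (E i) (E j)) :
    ∃ (Ω : Type u) (_ : MeasurableSpace Ω) (B : ι → Set Ω) (m : H → Measure Ω),
      (∀ i, MeasurableSet (B i)) ∧
      (∀ ξ (L : List ι), m ξ {ω | ∀ i ∈ L, ω ∈ B i}
        = ENNReal.ofReal (⟪ξ, (L.map E).prod ξ⟫_ℂ).re) ∧
      (∀ i j, E i * E j = E j → B j ⊆ B i) ∧ ∀ i, E i = 1 → B i = univ := by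
  -- The bicommutant of the family. The `E i` are self-adjoint and commute, so they lie in their own
  -- commutant; hence the bicommutant lies in the commutant and is commutative.
  let Z : StarSubalgebra ℂ (H →L[ℂ] H) :=
    StarSubalgebra.centralizer ℂ (StarSubalgebra.centralizer ℂ (range E) : Set (H →L[ℂ] H))
  have hsub : range E ⊆ (StarSubalgebra.centralizer ℂ (range E) : Set (H →L[ℂ] H)) := by
    rintro _ ⟨i, rfl⟩
    rw [SetLike.mem_coe, StarSubalgebra.mem_centralizer_iff]
    rintro _ ⟨j, rfl⟩
    exact ⟨hc j i, by rw [(hE j).isSelfAdjoint.star_eq]; exact hc j i⟩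
  have hZ : ∀ x ∈ Z, x ∈ StarSubalgebra.centralizer ℂ (range E) := fun x hx =>
    StarSubalgebra.centralizer_le ℂ _ _ hsub hx
  have hcomm : ∀ x y : Z, x * y = y * x := fun x y => by
    refine Subtype.ext ?_
    exact ((StarSubalgebra.mem_centralizer_iff ℂ).1 y.2 _ (hZ x x.2)).1
  have hclosed : IsClosed (Z : Set (H →L[ℂ] H)) := by
    simp only [Z, StarSubalgebra.coe_centralizer]
    exact Set.isClosed_centralizer _
  have hEZ : ∀ i, E i ∈ Z := fun i => by
    rw [StarSubalgebra.mem_centralizer_iff]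
    intro g hg
    have := (StarSubalgebra.mem_centralizer_iff ℂ).1 hg _ (mem_range_self i)
    refine ⟨this.1.symm, ?_⟩
    have h2 := congrArg star this.2
    rwa [star_mul, star_mul, star_star] at h2
  have : IsClosed (Z : Set (H →L[ℂ] H)) := hclosed
  let _ : CStarAlgebra Z := StarSubalgebra.cstarAlgebra Z
  let _ : CommCStarAlgebra Z := { (inferInstance : CStarAlgebra Z) with mul_comm := hcomm }
  let _ : MeasurableSpace (characterSpace ℂ Z) := borel _
  have : BorelSpace (characterSpace ℂ Z) := ⟨rfl⟩
  let e : ι → Z := fun i => ⟨E i, hEZ i⟩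
  have he : ∀ i, e i * e i = e i := fun i => Subtype.ext (hE i).isIdempotentElem
  choose m hm using fun ξ : H => exists_measure_characterSpace (A := Z) Z.subtype ξ
  -- A character takes only the values 0 and 1 on an idempotent. The order relations among the `B i`
  -- therefore hold at every point and not merely almost everywhere.
  let B : ι → Set (characterSpace ℂ Z) := fun i => {χ | χ (e i) = 1}
  have hB : ∀ i, MeasurableSet (B i) := fun i =>
    (isClosed_singleton.preimage ((gelfandStarTransform Z (e i)).continuous) :
      IsClosed (B i)).measurableSet
  have h01 : ∀ i (χ : characterSpace ℂ Z), χ ∉ B i → χ (e i) = 0 := by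
    intro i χ hχ
    have h := congrArg χ (he i)
    rw [map_mul] at h
    by_contra h0
    exact hχ (mul_right_cancel₀ h0 (h.trans (one_mul _).symm))
  refine ⟨characterSpace ℂ Z, inferInstance, B, m, hB, fun ξ L => ?_, fun i j hij χ hχ => ?_,
    fun i hi => ?_⟩
  · have hL : ((L.map e).prod : Z).1 = (L.map E).prod := by
      have : (L.map E) = (L.map e).map Z.subtype := by
        rw [List.map_map]; rfl
      rw [this, ← map_list_prod]; rfl
    rw [← hL]
    refine hm ξ _ _ ?_ ?_ ?_
    · exact (List.finite_toSet L).measurableSet_biInter (fun i _ => hB i) |>.congr (by ext; simp)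
    · intro χ hχ
      rw [map_list_prod, List.map_map]
      refine List.prod_eq_one ?_
      simp only [List.mem_map, Function.comp]
      rintro _ ⟨i, hi, rfl⟩
      exact hχ i hi
    · intro χ hχ
      simp only [Set.mem_ofPred_eq, not_forall] at hχ
      obtain ⟨i, hi, hiB⟩ := hχ
      rw [map_list_prod, List.map_map]
      exact List.prod_eq_zero (List.mem_map.2 ⟨i, hi, h01 i χ hiB⟩)
  · have h : e i * e j = e j := Subtype.ext hij
    have h' := congrArg χ h
    rw [map_mul, show χ (e j) = 1 from hχ, mul_one] at h'
    exact h'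
  · have h : e i = 1 := Subtype.ext hi
    refine eq_univ_of_forall fun χ => ?_
    change χ (e i) = 1
    rw [h, map_one]

end Gelfand
end ConformalIsometries

namespace ConformalIsometries
open Set Filter Topology

/-! ### The Fell topology -/

section Fell

/-- The set of closed subsets of `X` with the Fell topology. -/
def FellSpace (X : Type*) [TopologicalSpace X] : Type _ := Closeds X

namespace FellSpace

variable {X : Type*} [TopologicalSpace X]

instance : TopologicalSpace (FellSpace X) := fellTopology X

/-- The underlying set. -/
def toSet (A : FellSpace X) : Set X := Closeds.carrier A

theorem isClosed_toSet (A : FellSpace X) : IsClosed A.toSet := Closeds.isClosed' A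

theorem ext {A B : FellSpace X} (h : A.toSet = B.toSet) : A = B := Closeds.ext h

theorem isOpen_hit {U : Set X} (hU : IsOpen U) : IsOpen {A : FellSpace X | (A.toSet ∩ U).Nonempty} :=
  GenerateOpen.basic _ (Or.inl ⟨U, hU, rfl⟩)

theorem isOpen_miss {K : Set X} (hK : IsCompact K) : IsOpen {A : FellSpace X | A.toSet ∩ K = ∅} :=
  GenerateOpen.basic _ (Or.inr ⟨K, hK, rfl⟩)

/-- Alexander's subbase lemma. The complement `A₀` of all open `U` whose hitting sets occur in the
cover can only be covered by the missing set of some compact `K`; then `K` is covered by finitely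
many such `U`, and every closed set either misses `K` or hits one of them. -/
instance : CompactSpace (FellSpace X) := by
  refine compactSpace_generateFrom (T := fellTopology X) rfl fun Q hQ hcover => ?_
  let hit : Set X → Set (Closeds X) := fun U => {A : Closeds X | ((A : Set X) ∩ U).Nonempty}
  let 𝒲 : Set (Set X) := {U | IsOpen U ∧ hit U ∈ Q}
  have hW : IsOpen (⋃ U ∈ 𝒲, U) := isOpen_biUnion fun U hU => hU.1
  let A₀ : Closeds X := ⟨(⋃ U ∈ 𝒲, U)ᶜ, hW.isClosed_compl⟩
  have hA₀ : A₀ ∈ ⋃₀ Q := hcover ▸ mem_univ A₀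
  obtain ⟨S, hSQ, hAS⟩ := hA₀
  rcases hQ hSQ with ⟨U, hU, rfl⟩ | ⟨K, hK, rfl⟩
  · obtain ⟨x, hx, hxU⟩ := hAS
    exact absurd (mem_biUnion (show U ∈ 𝒲 from ⟨hU, hSQ⟩) hxU) hx
  · have hKW : K ⊆ ⋃ U ∈ 𝒲, U := fun x hxK => by
      by_contra hxW
      exact (eq_empty_iff_forall_notMem.1 hAS x) ⟨hxW, hxK⟩
    obtain ⟨T, hT, hTfin, hKT⟩ := hK.elim_finite_subcover_image (fun U hU => hU.1) hKW
    refine ⟨insert _ (hit '' T), insert_subset hSQ ?_, (hTfin.image _).insert _, ?_⟩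
    · rintro _ ⟨U, hU, rfl⟩
      exact (hT hU).2
    · refine eq_univ_of_forall fun A => ?_
      by_cases hAK : (A : Set X) ∩ K = ∅
      · exact ⟨_, mem_insert _ _, hAK⟩
      · obtain ⟨x, hxA, hxK⟩ := nonempty_iff_ne_empty.2 hAK
        obtain ⟨U, hU, hxU⟩ := mem_iUnion₂.1 (hKT hxK)
        exact ⟨hit U, mem_insert_of_mem _ ⟨U, hU, rfl⟩, x, hxA, hxU⟩

variable [LocallyCompactSpace X] [T2Space X]

/-- A point of one closed set outside the other has a compact neighbourhood `K` disjoint from the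
latter; hitting the interior of `K` and missing `K` are disjoint open conditions. -/
instance : T2Space (FellSpace X) := by
  have key : ∀ (A B : FellSpace X) (x : X), x ∈ A.toSet → x ∉ B.toSet →
      ∃ u v : Set (FellSpace X), IsOpen u ∧ IsOpen v ∧ A ∈ u ∧ B ∈ v ∧ Disjoint u v := by
    intro A B x hxA hxB
    obtain ⟨K, hK, hxK, hKB⟩ := exists_compact_subset B.isClosed_toSet.isOpen_compl hxB
    refine ⟨_, _, isOpen_hit (isOpen_interior (s := K)), isOpen_miss hK, ⟨x, hxA, hxK⟩, ?_, ?_⟩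
    · exact eq_empty_iff_forall_notMem.2 fun y hy => hKB hy.2 hy.1
    · rw [Set.disjoint_left]
      rintro C ⟨y, hy, hyK⟩ hC
      exact eq_empty_iff_forall_notMem.1 hC y ⟨hy, interior_subset hyK⟩
  refine ⟨fun A B hAB => ?_⟩
  have : ¬ (A.toSet = B.toSet) := fun h => hAB (ext h)
  by_cases h : A.toSet ⊆ B.toSet
  · obtain ⟨x, hx, hx'⟩ := not_subset.1 fun h' => this (h.antisymm h')
    obtain ⟨u, v, hu, hv, h1, h2, h3⟩ := key B A x hx hx'
    exact ⟨v, u, hv, hu, h2, h1, h3.symm⟩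
  · obtain ⟨x, hx, hx'⟩ := not_subset.1 h
    exact key A B x hx hx'

variable [SecondCountableTopology X]

/-- A compact set that misses a closed set is covered by finitely many basic open sets whose
compact closures miss it. -/
theorem exists_finite_cover {A K : Set X} (hA : IsClosed A) (hK : IsCompact K) (hAK : A ∩ K = ∅) :
    ∃ F ⊆ {U ∈ countableBasis X | IsCompact (closure U)}, F.Finite ∧ K ⊆ (⋃ U ∈ F, U) ∧
      A ∩ (⋃ U ∈ F, closure U) = ∅ := by
  let 𝒲 : Set (Set X) := {U ∈ countableBasis X | IsCompact (closure U) ∧ A ∩ closure U = ∅}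
  have hcov : K ⊆ ⋃ U ∈ 𝒲, U := fun x hxK => by
    have hxA : x ∈ Aᶜ := fun hxA => eq_empty_iff_forall_notMem.1 hAK x ⟨hxA, hxK⟩
    obtain ⟨C, hC, hxC, hCA⟩ := exists_compact_subset hA.isOpen_compl hxA
    obtain ⟨U, hU, hxU, hUC⟩ := (isBasis_countableBasis X).exists_subset_of_mem_open hxC
      isOpen_interior
    have hclos : closure U ⊆ C :=
      closure_minimal (hUC.trans interior_subset) hC.isClosed
    refine mem_biUnion (show U ∈ 𝒲 from ⟨hU, hC.of_isClosed_subset isClosed_closure hclos, ?_⟩) hxU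
    exact eq_empty_iff_forall_notMem.2 fun y hy => hCA (hclos hy.2) hy.1
  obtain ⟨F, hF, hFfin, hKF⟩ := hK.elim_finite_subcover_image
    (fun U hU => isOpen_of_mem_countableBasis hU.1) hcov
  refine ⟨F, fun U hU => ⟨(hF hU).1, (hF hU).2.1⟩, hFfin, hKF, ?_⟩
  refine eq_empty_iff_forall_notMem.2 fun y ⟨hyA, hy⟩ => ?_
  obtain ⟨U, hU, hyU⟩ := mem_iUnion₂.1 hy
  exact eq_empty_iff_forall_notMem.1 (hF hU).2.2 y ⟨hyA, hyU⟩

/-- It suffices to hit members of a countable basis and to miss finite unions of their compact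
closures. -/
instance : SecondCountableTopology (FellSpace X) := by
  let C : Set (Set X) := {U ∈ countableBasis X | IsCompact (closure U)}
  have hC : C.Countable := (countable_countableBasis X).mono fun U hU => hU.1
  let miss : Set (Set X) → Set (FellSpace X) := fun F => {A | A.toSet ∩ (⋃ U ∈ F, closure U) = ∅}
  let hit : Set X → Set (FellSpace X) := fun U => {A | (A.toSet ∩ U).Nonempty}
  let T : Set (Set (FellSpace X)) :=
    hit '' (countableBasis X) ∪ miss '' {F | F.Finite ∧ F ⊆ C}
  have hT : T.Countable := ((countable_countableBasis X).image _).union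
    ((countable_ofPred_finite_subset hC).image _)
  refine ⟨T, hT, le_antisymm (le_generateFrom ?_) ?_⟩
  · rintro _ (⟨U, hU, rfl⟩ | ⟨F, ⟨hF, hFC⟩, rfl⟩)
    · exact isOpen_hit (isOpen_of_mem_countableBasis hU)
    · exact isOpen_miss (hF.isCompact_biUnion fun U hU => (hFC hU).2)
  · change generateFrom T ≤ generateFrom _
    refine le_generateFrom ?_
    rintro _ (⟨U, hU, rfl⟩ | ⟨K, hK, rfl⟩)
    · have : {A : Closeds X | ((A : Set X) ∩ U).Nonempty}
          = ⋃ W ∈ {W ∈ countableBasis X | W ⊆ U}, hit W := by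
        refine Subset.antisymm ?_ ?_
        · rintro A ⟨x, hxA, hxU⟩
          obtain ⟨W, hW, hxW, hWU⟩ := (isBasis_countableBasis X).exists_subset_of_mem_open hxU hU
          exact mem_iUnion₂.2 ⟨W, ⟨hW, hWU⟩, x, hxA, hxW⟩
        · intro A hA
          obtain ⟨W, ⟨hW, hWU⟩, x, hxA, hxW⟩ := mem_iUnion₂.1 hA
          exact ⟨x, hxA, hWU hxW⟩
      rw [this]
      exact @isOpen_biUnion _ _ (generateFrom T) _ _ fun W hW =>
        GenerateOpen.basic _ (Or.inl ⟨W, hW.1, rfl⟩)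
    · have : {A : Closeds X | (A : Set X) ∩ K = ∅}
          = ⋃ F ∈ {F | (F.Finite ∧ F ⊆ C) ∧ K ⊆ ⋃ U ∈ F, U}, miss F := by
        refine Subset.antisymm ?_ ?_
        · intro A hA
          obtain ⟨F, hFC, hF, hKF, hAF⟩ := exists_finite_cover (Closeds.isClosed A) hK hA
          exact mem_iUnion₂.2 ⟨F, ⟨⟨hF, hFC⟩, hKF⟩, hAF⟩
        · intro A hA
          obtain ⟨F, ⟨_, hKF⟩, hAF⟩ := mem_iUnion₂.1 hA
          refine eq_empty_iff_forall_notMem.2 fun x ⟨hxA, hxK⟩ => ?_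
          obtain ⟨U, hU, hxU⟩ := mem_iUnion₂.1 (hKF hxK)
          exact eq_empty_iff_forall_notMem.1 hAF x
            ⟨hxA, mem_biUnion hU (subset_closure hxU)⟩
      rw [this]
      exact @isOpen_biUnion _ _ (generateFrom T) _ _ fun F hF =>
        GenerateOpen.basic _ (Or.inr ⟨F, hF.1, rfl⟩)

end FellSpace

end Fell

/-! ### Topology and Borel structure of `Y_u` -/

section YuTopology

variable {G : Type*} [AddCommGroup G] [TopologicalSpace G] {P : AddSubmonoid G}

namespace Yu

/-- The inclusion of `Y_u` in the space of closed subsets. -/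
def toFell (A : Yu P) : FellSpace G := A.1

theorem isEmbedding_toFell : IsEmbedding (toFell : Yu P → FellSpace G) :=
  ⟨⟨rfl⟩, Subtype.val_injective⟩

theorem isClosed_toSet (A : Yu P) : IsClosed A.toSet := A.1.isClosed

theorem sub_mem (A : Yu P) {x p : G} (hx : x ∈ A.toSet) (hp : p ∈ P) : x - p ∈ A.toSet := by
  rw [sub_eq_neg_add]
  exact A.2.1 p hp x hx

theorem mem_of_sub_mem (A : Yu P) {x y : G} (hx : x ∈ A.toSet) (h : x - y ∈ P) : y ∈ A.toSet := by
  simpa using A.sub_mem hx h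

theorem isClosed_setOf_mem (x : G) : IsClosed {A : Yu P | x ∈ A.toSet} := by
  have h := isOpen_miss (P := P) (isCompact_singleton (x := x))
  rw [← isOpen_compl_iff]
  convert h using 1
  ext A
  simp [Set.inter_singleton_eq_empty]

theorem measurableSet_setOf_mem (x : G) : MeasurableSet {A : Yu P | x ∈ A.toSet} :=
  (isClosed_setOf_mem x).measurableSet

theorem measurableSet_setOf_list (L : List G) :
    MeasurableSet {A : Yu P | ∀ x ∈ L, x ∈ A.toSet} :=
  (List.finite_toSet L).measurableSet_biInter (fun x _ => measurableSet_setOf_mem (P := P) x)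
    |>.congr (by ext; simp)

theorem measurableSet_Xu : MeasurableSet (Xu P) := measurableSet_setOf_mem 0

variable [IsTopologicalAddGroup G]

/-- Close to every point of `A`, there is a non-empty open set inside `A`. -/
theorem exists_isOpen_subset (hP : (P : Set G) ⊆ closure (interior (P : Set G))) (A : Yu P)
    {x : G} (hx : x ∈ A.toSet) {U : Set G} (hU : IsOpen U) (hxU : x ∈ U) :
    ∃ W : Set G, IsOpen W ∧ W.Nonempty ∧ W ⊆ U ∧ W ⊆ A.toSet ∧
      ∀ y ∈ W, x - y ∈ interior (P : Set G) := by
  have hc : Continuous fun p : G => x - p := continuous_const.sub continuous_id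
  refine ⟨U ∩ {y | x - y ∈ interior (P : Set G)}, hU.inter (isOpen_interior.preimage hc), ?_,
    inter_subset_left, fun y hy => A.mem_of_sub_mem hx (interior_subset hy.2), fun y hy => hy.2⟩
  obtain ⟨p, hpU, hp⟩ := mem_closure_iff.1 (hP P.zero_mem) _ (hU.preimage hc)
    (by simpa using hxU)
  exact ⟨x - p, hpU, by simpa using hp⟩

variable [LocallyCompactSpace G] [T2Space G] [SecondCountableTopology G]

instance : SecondCountableTopology (Yu P) :=
  isEmbedding_toFell.isInducing.secondCountableTopology

instance : MetrizableSpace (Yu P) :=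
  have := metrizableSpace_of_t3_secondCountable (FellSpace G)
  isEmbedding_toFell.metrizableSpace

/-- Each `A` contains nonempty open sets arbitrarily close to any of its points, so hitting an open
set is a countable union of conditions `d ∈ A`, with `d` in a countable dense set. Missing a compact
set is in turn a countable union, over finite basic covers, of conditions not to hit the members of
the cover. -/
theorem measurableSpace_eq (hP : (P : Set G) ⊆ closure (interior (P : Set G))) :
    borel (Yu P) = MeasurableSpace.generateFrom (range fun x : G => {A : Yu P | x ∈ A.toSet}) := by
  refine le_antisymm ?_ (MeasurableSpace.generateFrom_le ?_)
  · let m := MeasurableSpace.generateFrom (range fun x : G => {A : Yu P | x ∈ A.toSet})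
    have hit : ∀ U : Set G, IsOpen U → MeasurableSet[m] {A : Yu P | (A.toSet ∩ U).Nonempty} := by
      intro U hU
      obtain ⟨D, hDc, hD⟩ := exists_countable_dense G
      have : {A : Yu P | (A.toSet ∩ U).Nonempty} = ⋃ d ∈ D ∩ U, {A : Yu P | d ∈ A.toSet} := by
        refine Subset.antisymm ?_ ?_
        · rintro A ⟨x, hxA, hxU⟩
          obtain ⟨W, hW, hWne, hWU, hWA, _⟩ := A.exists_isOpen_subset hP hxA hU hxU
          obtain ⟨d, hdW, hdD⟩ := hD.inter_open_nonempty W hW hWne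
          exact mem_iUnion₂.2 ⟨d, ⟨hdD, hWU hdW⟩, hWA hdW⟩
        · intro A hA
          obtain ⟨d, hd, hdA⟩ := mem_iUnion₂.1 hA
          exact ⟨d, hdA, hd.2⟩
      rw [this]
      exact @MeasurableSet.biUnion _ _ m _ _ (hDc.mono inter_subset_left) fun d _ =>
        MeasurableSpace.measurableSet_generateFrom ⟨d, rfl⟩
    have miss : ∀ K : Set G, IsCompact K → MeasurableSet[m] {A : Yu P | A.toSet ∩ K = ∅} := by
      intro K hK
      let C : Set (Set G) := {U ∈ countableBasis G | IsCompact (closure U)}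
      have hC : C.Countable := (countable_countableBasis G).mono fun U hU => hU.1
      have : {A : Yu P | A.toSet ∩ K = ∅}
          = ⋃ F ∈ {F | (F.Finite ∧ F ⊆ C) ∧ K ⊆ ⋃ U ∈ F, U},
            ⋂ U ∈ F, {A : Yu P | (A.toSet ∩ U).Nonempty}ᶜ := by
        refine Subset.antisymm ?_ ?_
        · intro A hA
          obtain ⟨F, hFC, hF, hKF, hAF⟩ := FellSpace.exists_finite_cover A.isClosed_toSet hK hA
          refine mem_iUnion₂.2 ⟨F, ⟨⟨hF, hFC⟩, hKF⟩, mem_iInter₂.2 fun U hU => ?_⟩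
          rintro ⟨x, hxA, hxU⟩
          exact eq_empty_iff_forall_notMem.1 hAF x
            ⟨hxA, mem_biUnion hU (subset_closure hxU)⟩
        · intro A hA
          obtain ⟨F, ⟨_, hKF⟩, hAF⟩ := mem_iUnion₂.1 hA
          refine eq_empty_iff_forall_notMem.2 fun x ⟨hxA, hxK⟩ => ?_
          obtain ⟨U, hU, hxU⟩ := mem_iUnion₂.1 (hKF hxK)
          exact mem_iInter₂.1 hAF U hU ⟨x, hxA, hxU⟩
      rw [this]
      refine @MeasurableSet.biUnion _ _ m _ _
        ((countable_ofPred_finite_subset hC).mono fun F hF => hF.1) fun F hF => ?_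
      exact @Set.Finite.measurableSet_biInter _ _ m _ _ hF.1.1 fun U hU =>
        @MeasurableSet.compl _ _ m (hit U (isOpen_of_mem_countableBasis (hF.1.2 hU).1))
    have hT : (inferInstance : TopologicalSpace (Yu P)) = generateFrom _ :=
      induced_generateFrom_eq
    rw [borel_eq_generateFrom_of_subbasis hT]
    refine MeasurableSpace.generateFrom_le ?_
    rintro _ ⟨_, ⟨U, hU, rfl⟩ | ⟨K, hK, rfl⟩, rfl⟩
    · exact hit U hU
    · exact miss K hK
  · rintro _ ⟨x, rfl⟩
    exact measurableSet_setOf_mem x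

omit [LocallyCompactSpace G] [T2Space G] [SecondCountableTopology G] [IsTopologicalAddGroup G] in
theorem isPiSystem_setOf_list :
    IsPiSystem (range fun L : List G => {A : Yu P | ∀ x ∈ L, x ∈ A.toSet}) := by
  rintro _ ⟨L, rfl⟩ _ ⟨M, rfl⟩ _
  refine ⟨L ++ M, ?_⟩
  ext A
  simp [or_imp, forall_and]

theorem measurableSpace_eq_list (hP : (P : Set G) ⊆ closure (interior (P : Set G))) :
    borel (Yu P) = MeasurableSpace.generateFrom
      (range fun L : List G => {A : Yu P | ∀ x ∈ L, x ∈ A.toSet}) := by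
  refine le_antisymm ?_ (MeasurableSpace.generateFrom_le ?_)
  · rw [measurableSpace_eq hP]
    refine MeasurableSpace.generateFrom_mono ?_
    rintro _ ⟨x, rfl⟩
    exact ⟨[x], by simp⟩
  · rintro _ ⟨L, rfl⟩
    exact measurableSet_setOf_list L

omit [T2Space G] [SecondCountableTopology G] in
/-- The set of all `A` that contain `x` and do not meet `y + Int P` is compact. -/
theorem isCompact_window (hP : (P : Set G) ⊆ closure (interior (P : Set G))) (x y : G) :
    IsCompact {A : Yu P | x ∈ A.toSet ∧ A.toSet ∩ {z | z - y ∈ interior (P : Set G)} = ∅} := by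
  have hc : ∀ p : G, Continuous fun z : G => z - p := fun p => continuous_id.sub continuous_const
  obtain ⟨p₀, hp₀⟩ : (interior (P : Set G)).Nonempty :=
    closure_nonempty_iff.1 ⟨0, hP P.zero_mem⟩
  have h1 : IsClosed {B : FellSpace G | x ∈ B.toSet} := by
    have h := FellSpace.isOpen_miss (isCompact_singleton (x := x))
    rw [← isOpen_compl_iff]
    convert h using 1
    ext A
    simp [Set.inter_singleton_eq_empty]
  have h2 : IsClosed {B : FellSpace G | B.toSet ∩ {z | z - y ∈ interior (P : Set G)} = ∅} := by
    have h := FellSpace.isOpen_hit (isOpen_interior.preimage (hc y) :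
      IsOpen {z | z - y ∈ interior (P : Set G)})
    rw [← isOpen_compl_iff]
    convert h using 1
    ext A
    simp only [Set.nonempty_iff_ne_empty]
    rfl
  have h3 : IsClosed {B : FellSpace G | ∀ p ∈ P, ∀ x ∈ B.toSet, x - p ∈ B.toSet} := by
    have : {B : FellSpace G | ∀ p ∈ P, ∀ x ∈ B.toSet, x - p ∈ B.toSet}
        = ⋂ p ∈ P, {B : FellSpace G | ∀ x ∈ B.toSet, x - p ∈ B.toSet} := by
      ext B; simp
    rw [this]
    refine isClosed_biInter fun p _ => ?_
    rw [← isOpen_compl_iff, isOpen_iff_forall_mem_open]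
    -- Failure of invariance is an open condition: if `z ∈ B` and `z - p ∉ B`, choose a compact
    -- neighbourhood `K` of `z - p` missing `B`; the closed sets which hit `p + int K` and miss `K`
    -- also fail.
    intro B hB
    have hB' : ∃ x ∈ B.toSet, x - p ∉ B.toSet := by
      by_contra hcon
      push Not at hcon
      exact hB hcon
    obtain ⟨z, hz, hzp⟩ := hB'
    obtain ⟨K, hK, hzK, hKB⟩ := exists_compact_subset B.isClosed_toSet.isOpen_compl hzp
    refine ⟨_, ?_, (FellSpace.isOpen_hit ((isOpen_interior (s := K)).preimage (hc p))).inter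
      (FellSpace.isOpen_miss hK), ⟨z, hz, hzK⟩,
      eq_empty_iff_forall_notMem.2 fun y hy => hKB hy.2 hy.1⟩
    rintro C ⟨⟨w, hw, hwK⟩, hC⟩ hC'
    exact eq_empty_iff_forall_notMem.1 hC (w - p) ⟨hC' w hw, interior_subset hwK⟩
  rw [isEmbedding_toFell.isInducing.isCompact_iff]
  convert ((h1.inter h2).inter h3).isCompact using 1
  refine Subset.antisymm ?_ ?_
  · rintro _ ⟨A, hA, rfl⟩
    exact ⟨hA, fun p hp x hx => A.sub_mem hx hp⟩
  · rintro B ⟨⟨hBx, hBy⟩, hBP⟩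
    -- The two window conditions prevent limits from leaving `Y_u`: the point `x` keeps them
    -- nonempty, and avoiding the nonempty set `y + Int P` keeps them proper.
    refine ⟨⟨B, fun p hp z hz => ?_, ?_, ?_⟩, ⟨hBx, hBy⟩, rfl⟩
    · have hz' := hBP p hp z hz
      rwa [sub_eq_neg_add] at hz'
    · exact nonempty_iff_ne_empty.1 ⟨x, hBx⟩
    · intro hB
      refine eq_empty_iff_forall_notMem.1 hBy (p₀ + y) ⟨?_, by simpa using hp₀⟩
      have hB' : B.toSet = univ := hB
      rw [hB']
      trivial

end Yu

/-! ### Order units -/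

section OrderUnit

variable {G : Type*} [AddCommGroup G] [TopologicalSpace G] {P : AddSubmonoid G}

/-- `a₀` is an order unit of `P`. -/
def IsOrderUnit (P : AddSubmonoid G) (a₀ : G) : Prop :=
  a₀ ∈ interior (P : Set G) ∧ ∀ s : G, ∃ n : ℕ, 0 < n ∧ n • a₀ - s ∈ interior (P : Set G)

namespace IsOrderUnit

variable {a₀ : G}

theorem mem (h : IsOrderUnit P a₀) : a₀ ∈ P := interior_subset h.1

theorem nsmul_mem (h : IsOrderUnit P a₀) (n : ℕ) : n • a₀ ∈ P := P.nsmul_mem h.mem n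

theorem exists_forall_sub_mem (h : IsOrderUnit P a₀) (s : G) :
    ∃ n : ℕ, ∀ m ≥ n, m • a₀ - s ∈ P := by
  obtain ⟨n, _, hn⟩ := h.2 s
  refine ⟨n, fun m hm => ?_⟩
  obtain ⟨k, rfl⟩ := Nat.exists_eq_add_of_le hm
  rw [add_comm, add_nsmul, add_sub_assoc]
  exact P.add_mem (h.nsmul_mem k) (interior_subset hn)

/-- Every point of `Y_u` contains `-n a₀` for large `n`. -/
theorem exists_forall_neg_mem (h : IsOrderUnit P a₀) (A : Yu P) :
    ∃ n : ℕ, ∀ m ≥ n, -(m • a₀) ∈ A.toSet := by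
  obtain ⟨x, hx⟩ := nonempty_iff_ne_empty.2 A.2.2.1
  obtain ⟨n, hn⟩ := h.exists_forall_sub_mem (-x)
  exact ⟨n, fun m hm => A.mem_of_sub_mem hx (by simpa [add_comm] using hn m hm)⟩

/-- No point of `Y_u` contains `n a₀` for large `n`. -/
theorem exists_forall_notMem (h : IsOrderUnit P a₀) (A : Yu P) :
    ∃ n : ℕ, ∀ m ≥ n, m • a₀ ∉ A.toSet := by
  obtain ⟨x, hx⟩ := (ne_univ_iff_exists_notMem _).1 A.2.2.2
  obtain ⟨n, hn⟩ := h.exists_forall_sub_mem x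
  exact ⟨n, fun m hm hmem => hx (A.mem_of_sub_mem hmem (hn m hm))⟩

end IsOrderUnit

/-- For large `n`, a given `A` contains `-n a₀` but not `n a₀`, so countably many compact windows
exhaust `Y_u`. -/
theorem Yu.sigmaCompactSpace [LocallyCompactSpace G] [T2Space G] [SecondCountableTopology G]
    [IsTopologicalAddGroup G] (hP : (P : Set G) ⊆ closure (interior (P : Set G))) {a₀ : G}
    (h : IsOrderUnit P a₀) : SigmaCompactSpace (Yu P) := by
  refine ⟨⟨fun n => {A : Yu P | -(n • a₀) ∈ A.toSet ∧
    A.toSet ∩ {z | z - n • a₀ ∈ interior (P : Set G)} = ∅}, fun n => isCompact_window hP _ _, ?_⟩⟩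
  refine eq_univ_of_forall fun A => ?_
  obtain ⟨n, hn⟩ := h.exists_forall_neg_mem A
  obtain ⟨m, hm⟩ := h.exists_forall_notMem A
  refine mem_iUnion.2 ⟨max n m, hn _ (le_max_left _ _), ?_⟩
  refine eq_empty_iff_forall_notMem.2 fun z hz => hm _ (le_max_right n m) ?_
  exact A.mem_of_sub_mem hz.1 (interior_subset hz.2)

end OrderUnit

end YuTopology
end ConformalIsometries

namespace ConformalIsometries
open Set Filter Topology
open scoped InnerProductSpace

/-! ### Projections -/

section Projections

variable {H : Type*} [NormedAddCommGroup H] [InnerProductSpace ℂ H] [CompleteSpace H]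

theorem _root_.IsStarProjection.inner_apply_apply {p : H →L[ℂ] H} (hp : IsStarProjection p) (x y : H) :
    ⟪p x, p y⟫_ℂ = ⟪x, p y⟫_ℂ := by
  have h : ContinuousLinearMap.adjoint p = p := hp.isSelfAdjoint.star_eq
  have h' : p (p y) = p y := DFunLike.congr_fun hp.isIdempotentElem.eq y
  rw [← ContinuousLinearMap.adjoint_inner_right, h, h']

theorem _root_.IsStarProjection.inner_apply_left {p : H →L[ℂ] H} (hp : IsStarProjection p) (x y : H) :
    ⟪p x, y⟫_ℂ = ⟪x, p y⟫_ℂ := by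
  have h : ContinuousLinearMap.adjoint p = p := hp.isSelfAdjoint.star_eq
  rw [← ContinuousLinearMap.adjoint_inner_right, h]

theorem _root_.IsStarProjection.norm_sq_apply {p : H →L[ℂ] H} (hp : IsStarProjection p) (x : H) :
    ‖p x‖ ^ 2 = (⟪x, p x⟫_ℂ).re := by
  rw [← hp.inner_apply_apply]
  exact (inner_self_eq_norm_sq (𝕜 := ℂ) (p x)).symm

theorem _root_.IsStarProjection.norm_sq_add {p : H →L[ℂ] H} (hp : IsStarProjection p) (x : H) :
    ‖p x‖ ^ 2 + ‖x - p x‖ ^ 2 = ‖x‖ ^ 2 := by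
  have h := norm_add_sq_eq_norm_sq_add_norm_sq_of_inner_eq_zero (p x) (x - p x) (𝕜 := ℂ) (by
    rw [inner_sub_right, hp.inner_apply_apply, hp.inner_apply_left, sub_self])
  rw [add_sub_cancel] at h
  linarith

theorem _root_.IsStarProjection.norm_apply_le {p : H →L[ℂ] H} (hp : IsStarProjection p) (x : H) :
    ‖p x‖ ≤ ‖x‖ := by
  have h := IsStarProjection.norm_sq_add hp x
  nlinarith [norm_nonneg (p x), norm_nonneg x, sq_nonneg ‖x - p x‖]

end Projections

/-! ### The algebra of range projections -/

namespace IsometrySemigroup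

variable {G : Type*} [AddCommGroup G] {P : AddSubmonoid G}
  {H : Type*} [NormedAddCommGroup H] [InnerProductSpace ℂ H] [CompleteSpace H]
  (V : IsometrySemigroup P H)

omit [CompleteSpace H] in
theorem op_add (a b : P) : V.op (a + b) = V.op a * V.op b :=
  ContinuousLinearMap.ext fun x => V.map_add' a b x

omit [CompleteSpace H] in
theorem op_mul_comm (a b : P) : V.op a * V.op b = V.op b * V.op a := by
  rw [← op_add, add_comm, op_add]

theorem adj_add_eq (a b : P) : V.adj (a + b) = V.adj a * V.adj b := by
  rw [add_comm]
  exact ContinuousLinearMap.ext fun x => V.adj_add b a x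

theorem adj_mul_comm (a b : P) : V.adj a * V.adj b = V.adj b * V.adj a := by
  rw [← adj_add_eq, add_comm, adj_add_eq]

theorem adj_mul_op (a : P) : V.adj a * V.op a = 1 :=
  ContinuousLinearMap.ext fun x => V.adj_apply a x

theorem adj_mul_op_mul (a : P) (T : H →L[ℂ] H) : V.adj a * (V.op a * T) = T := by
  rw [← mul_assoc, adj_mul_op, one_mul]

omit [CompleteSpace H] in
theorem op_zero : V.op 0 = 1 := ContinuousLinearMap.ext fun x => V.map_zero' x

theorem star_op (a : P) : star (V.op a) = V.adj a := rfl

theorem star_adj (a : P) : star (V.adj a) = V.op a := by rw [← star_op, star_star]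

theorem adj_zero : V.adj 0 = 1 := by rw [← star_op, op_zero, star_one]

theorem rangeProj_eq (a : P) : V.rangeProj a = V.op a * V.adj a := rfl

theorem rangeProj_mul_op (a : P) : V.rangeProj a * V.op a = V.op a := by
  rw [rangeProj_eq, mul_assoc, adj_mul_op, mul_one]

theorem adj_mul_rangeProj (a : P) : V.adj a * V.rangeProj a = V.adj a := by
  rw [rangeProj_eq, adj_mul_op_mul]

theorem rangeProj_add (a b : P) : V.rangeProj (a + b) = V.op b * V.rangeProj a * V.adj b := by
  rw [rangeProj_eq, add_comm, op_add, adj_add_eq, adj_mul_comm, rangeProj_eq]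
  simp only [mul_assoc]

theorem isStarProjection_rangeProj (a : P) : IsStarProjection (V.rangeProj a) := by
  refine ⟨?_, ?_⟩
  · change V.rangeProj a * V.rangeProj a = _
    rw [rangeProj_eq, mul_assoc, adj_mul_op_mul]
  · change star (V.rangeProj a) = _
    rw [rangeProj_eq, star_mul, star_adj, star_op]

theorem rangeProj_mul_rangeProj_add (a b : P) :
    V.rangeProj a * V.rangeProj (a + b) = V.rangeProj (a + b) := by
  rw [add_comm, rangeProj_add, ← mul_assoc, ← mul_assoc, rangeProj_mul_op]

/-- The projection `V_b^* E_a V_b`, which only depends on `a - b`. -/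
noncomputable def pairProj (a b : P) : H →L[ℂ] H := V.adj b * V.rangeProj a * V.op b

theorem pairProj_add (a b d : P) : V.pairProj (a + d) (b + d) = V.pairProj a b := by
  rw [pairProj, rangeProj_add, op_add, adj_add_eq, V.op_mul_comm b d]
  simp only [mul_assoc, adj_mul_op_mul]
  rfl

theorem pairProj_congr {a b a' b' : P} (h : (a : G) - b = a' - b') :
    V.pairProj a b = V.pairProj a' b' := by
  rw [← V.pairProj_add a b b', ← V.pairProj_add a' b' b, add_comm b' b]
  congr 1
  refine Subtype.ext ?_
  exact sub_eq_sub_iff_add_eq_add.1 h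

theorem pairProj_zero (a : P) : V.pairProj a 0 = V.rangeProj a := by
  rw [pairProj, op_zero, adj_zero, one_mul, mul_one]

section Comm

variable {V} (hcomm : V.HasCommutingRangeProjections)
include hcomm

/-- The inner factor `V_b V_b^* = E_b` is moved past `E_a` and absorbed by `V_b^*`. This is where
commutation of the range projections makes the compressions `V_b^* E_a V_b` multiplicative, hence
commuting projections. -/
theorem pairProj_mul_pairProj (a a' b : P) :
    V.pairProj a b * V.pairProj a' b = V.adj b * (V.rangeProj a * V.rangeProj a') * V.op b := by
  have h : V.pairProj a b * V.pairProj a' b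
      = V.adj b * (V.rangeProj a * V.rangeProj b) * V.rangeProj a' * V.op b := by
    simp only [pairProj, rangeProj_eq V b, mul_assoc]
  rw [h, (hcomm a b).eq, ← mul_assoc, adj_mul_rangeProj]
  simp only [mul_assoc]

theorem isStarProjection_pairProj (a b : P) : IsStarProjection (V.pairProj a b) := by
  refine ⟨?_, ?_⟩
  · change V.pairProj a b * V.pairProj a b = _
    rw [pairProj_mul_pairProj hcomm, (V.isStarProjection_rangeProj a).isIdempotentElem.eq]
    rfl
  · change star (V.pairProj a b) = _
    rw [pairProj, star_mul, star_mul, star_adj, star_op,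
      (V.isStarProjection_rangeProj a).isSelfAdjoint.star_eq, mul_assoc]

theorem pairProj_mul_op (a b p : P) :
    V.pairProj (a + p) b * V.op p = V.op p * V.pairProj a b := by
  have h1 : V.rangeProj (b + p) * (V.op b * V.op p) = V.op b * V.op p := by
    rw [← op_add, rangeProj_mul_op]
  calc V.pairProj (a + p) b * V.op p
      = V.adj b * (V.rangeProj (a + p) * V.rangeProj (b + p)) * (V.op b * V.op p) := by
        simp only [pairProj, mul_assoc, h1]
    _ = V.adj b * (V.rangeProj (b + p) * V.rangeProj (a + p)) * (V.op b * V.op p) := by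
        rw [(hcomm _ _).eq]
    _ = V.op p * V.pairProj a b := by
        rw [add_comm b p, V.rangeProj_add p b, V.rangeProj_add a p, V.op_mul_comm b p,
          V.rangeProj_eq p, pairProj]
        simp only [mul_assoc, adj_mul_op_mul]
        rw [← mul_assoc (V.adj p) (V.adj b), V.adj_mul_comm p b, mul_assoc, adj_mul_op_mul]

end Comm

/-! ### The projections indexed by the whole group -/

section Cutoff

/-- The projection `E_x = V_b^* V_a V_a^* V_b`, where `x = a - b` with `a`, `b` in `P`. -/
noncomputable def cutoff (hgen : ∀ s : G, ∃ a ∈ P, ∃ b ∈ P, s = a - b) (x : G) : H →L[ℂ] H :=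
  V.pairProj ⟨(hgen x).choose, (hgen x).choose_spec.1⟩
    ⟨(hgen x).choose_spec.2.choose, (hgen x).choose_spec.2.choose_spec.1⟩

variable {V} (hgen : ∀ s : G, ∃ a ∈ P, ∃ b ∈ P, s = a - b)

theorem cutoff_eq {x : G} {a b : P} (h : x = a - b) : V.cutoff hgen x = V.pairProj a b :=
  V.pairProj_congr ((hgen x).choose_spec.2.choose_spec.2.symm.trans h)

include hgen in
theorem exists_common (x y : G) : ∃ a a' b : P, x = a - b ∧ y = a' - b := by
  obtain ⟨a, ha, b, hb, rfl⟩ := hgen x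
  obtain ⟨a', ha', b', hb', rfl⟩ := hgen y
  refine ⟨⟨a, ha⟩ + ⟨b', hb'⟩, ⟨a', ha'⟩ + ⟨b, hb⟩, ⟨b, hb⟩ + ⟨b', hb'⟩, ?_, ?_⟩
  · simp
  · simp [add_comm b b']

theorem cutoff_coe (a : P) : V.cutoff hgen (a : G) = V.rangeProj a := by
  rw [cutoff_eq hgen (a := a) (b := 0) (by simp), pairProj_zero]

theorem cutoff_zero : V.cutoff hgen 0 = 1 := by
  have h := cutoff_coe (V := V) hgen 0
  rw [AddSubmonoid.coe_zero] at h
  rw [h, rangeProj_eq, op_zero, adj_zero, one_mul]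

variable (hcomm : V.HasCommutingRangeProjections)
include hcomm

theorem isStarProjection_cutoff (x : G) : IsStarProjection (V.cutoff hgen x) :=
  isStarProjection_pairProj hcomm _ _

theorem commute_cutoff (x y : G) : Commute (V.cutoff hgen x) (V.cutoff hgen y) := by
  obtain ⟨a, a', b, hx, hy⟩ := exists_common hgen x y
  rw [cutoff_eq hgen hx, cutoff_eq hgen hy]
  change _ * _ = _ * _
  rw [pairProj_mul_pairProj hcomm, pairProj_mul_pairProj hcomm, (hcomm _ _).eq]

theorem cutoff_mul_of_sub_mem {x y : G} (h : y - x ∈ P) :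
    V.cutoff hgen x * V.cutoff hgen y = V.cutoff hgen y := by
  obtain ⟨a, ha, b, hb, hx⟩ := hgen x
  have hy : y = ((⟨a, ha⟩ + ⟨y - x, h⟩ : P) : G) - (⟨b, hb⟩ : P) := by
    simp only [hx, AddSubmonoid.coe_add]; abel
  rw [cutoff_eq (V := V) (x := x) (a := ⟨a, ha⟩) (b := ⟨b, hb⟩) hgen hx, cutoff_eq hgen hy,
    pairProj_mul_pairProj hcomm, rangeProj_mul_rangeProj_add]
  rfl

/-- The source of the covariance of the spectral measure: on the sets `{A | x ∈ A}`, translation by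
`p` is implemented by `V_p`. -/
theorem cutoff_add_mul_op (x : G) (p : P) :
    V.cutoff hgen (x + p) * V.op p = V.op p * V.cutoff hgen x := by
  obtain ⟨a, ha, b, hb, hx⟩ := hgen x
  have hy : x + p = ((⟨a, ha⟩ + p : P) : G) - (⟨b, hb⟩ : P) := by
    simp only [AddSubmonoid.coe_add, hx]; abel
  rw [cutoff_eq (V := V) (x := x) (a := ⟨a, ha⟩) (b := ⟨b, hb⟩) hgen hx, cutoff_eq hgen hy,
    pairProj_mul_op hcomm]

end Cutoff

/-! ### Continuity and purity -/

section Topological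

variable {V} [TopologicalSpace G]

theorem tendsto_adj (hV : V.IsStronglyContinuous) {p : ℕ → P}
    (hp : Tendsto p atTop (𝓝 0)) (η : H) : Tendsto (fun k => V.adj (p k) η) atTop (𝓝 η) := by
  have h1 : Tendsto (fun k => V (p k) η) atTop (𝓝 η) := by
    have h := ((hV η).tendsto 0).comp hp
    rwa [V.map_zero'] at h
  rw [tendsto_iff_norm_sub_tendsto_zero] at h1 ⊢
  refine squeeze_zero (fun _ => norm_nonneg _) (fun k => ?_) h1
  have h2 : V.adj (p k) η - η = V.adj (p k) (η - V (p k) η) := by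
    rw [map_sub, adj_apply]
  have h3 : ‖V.adj (p k)‖ ≤ 1 := by
    rw [adj, LinearIsometryEquiv.norm_map]
    exact (V (p k)).norm_toContinuousLinearMap_le
  rw [h2, norm_sub_rev _ η]
  exact (V.adj (p k)).le_of_opNorm_le h3 _ |>.trans (one_mul _).le

/-- If `p + a' = a`, then `V_p E_{a'} = V_a V_{a'}^*`. The product of `V_p^* η` and `E_{a'} η` is
therefore that of `V_{a'} (V_a^* η)` and `η`, where the strong continuity of `V` applies; replacing
`V_p^* η` by `η` costs only an error tending to 0. -/
theorem tendsto_inner_rangeProj (hV : V.IsStronglyContinuous) {p a' : ℕ → P} {a : P}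
    (hp : Tendsto p atTop (𝓝 0)) (ha' : Tendsto a' atTop (𝓝 a)) (h : ∀ k, p k + a' k = a) (η : H) :
    Tendsto (fun k => ⟪η, V.rangeProj (a' k) η⟫_ℂ) atTop (𝓝 ⟪η, V.rangeProj a η⟫_ℂ) := by
  have e1 : ∀ k, ⟪V.adj (p k) η, V.rangeProj (a' k) η⟫_ℂ = ⟪V (a' k) (V.adj a η), η⟫_ℂ := by
    intro k
    have : V.op (p k) (V.rangeProj (a' k) η) = V.op a (V.adj (a' k) η) := by
      rw [← h k, op_add]; rfl
    rw [adj, ContinuousLinearMap.adjoint_inner_left, this, adj, adj,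
      ← ContinuousLinearMap.adjoint_inner_left, ContinuousLinearMap.adjoint_inner_right]
    rfl
  have t1 : Tendsto (fun k => ⟪V.adj (p k) η, V.rangeProj (a' k) η⟫_ℂ) atTop
      (𝓝 ⟪η, V.rangeProj a η⟫_ℂ) := by
    simp only [e1]
    have h2 : ⟪η, V.rangeProj a η⟫_ℂ = ⟪V a (V.adj a η), η⟫_ℂ := by
      rw [← IsStarProjection.inner_apply_left (V.isStarProjection_rangeProj a)]; rfl
    rw [h2]
    exact (((hV _).tendsto a).comp ha').inner tendsto_const_nhds
  have t2 : Tendsto (fun k => ⟪η - V.adj (p k) η, V.rangeProj (a' k) η⟫_ℂ) atTop (𝓝 0) := by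
    have h3 : Tendsto (fun k => ‖η - V.adj (p k) η‖ * ‖η‖) atTop (𝓝 0) := by
      have h4 := ((tendsto_const_nhds (x := η)).sub (tendsto_adj hV hp η)).norm.mul_const ‖η‖
      simpa using h4
    refine squeeze_zero_norm (fun k => ?_) h3
    exact (norm_inner_le_norm _ _).trans (mul_le_mul_of_nonneg_left
      (IsStarProjection.norm_apply_le (V.isStarProjection_rangeProj _) η) (norm_nonneg _))
  have t3 := t2.add t1
  simp only [← inner_add_left, sub_add_cancel, zero_add] at t3
  exact t3

theorem tendsto_inner_cutoff [IsTopologicalAddGroup G]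
    (hgen : ∀ s : G, ∃ a ∈ P, ∃ b ∈ P, s = a - b) (hV : V.IsStronglyContinuous)
    (hint : (interior (P : Set G)).Nonempty) {p : ℕ → G}
    (hpP : ∀ k, p k ∈ P) (hp : Tendsto p atTop (𝓝 0)) (x : G) (ξ : H) :
    Tendsto (fun k => ⟪ξ, V.cutoff hgen (x - p k) ξ⟫_ℂ) atTop (𝓝 ⟪ξ, V.cutoff hgen x ξ⟫_ℂ) := by
  obtain ⟨a₁, ha₁, b₁, hb₁, hx⟩ := hgen x
  -- Adding `d` to numerator and denominator moves the numerator into the interior of `P`, so that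
  -- it still lies in `P` after subtraction of a small `p k`.
  obtain ⟨d, hd⟩ := hint
  have hdP : d ∈ P := interior_subset hd
  have haint : a₁ + d ∈ interior (P : Set G) := by
    have : IsOpen ((fun y => y - a₁) ⁻¹' interior (P : Set G)) :=
      isOpen_interior.preimage (continuous_id.sub continuous_const)
    refine mem_interior.2 ⟨_, ?_, this, by simpa using hd⟩
    intro y hy
    have := P.add_mem ha₁ (interior_subset hy : y - a₁ ∈ P)
    simpa using this
  have ht : Tendsto (fun k => a₁ + d - p k) atTop (𝓝 (a₁ + d)) := by
    simpa using (tendsto_const_nhds (x := a₁ + d)).sub hp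
  obtain ⟨N, hN⟩ := eventually_atTop.1 (ht.eventually (isOpen_interior.mem_nhds haint))
  rw [← tendsto_add_atTop_iff_nat N]
  let a' : ℕ → P := fun k => ⟨a₁ + d - p (k + N), interior_subset (hN _ (Nat.le_add_left _ _))⟩
  let a : P := ⟨a₁ + d, interior_subset haint⟩
  let b : P := ⟨b₁ + d, P.add_mem hb₁ hdP⟩
  have hxab : x = a - b := by simp [a, b, hx]
  have e1 : ∀ k, V.cutoff hgen (x - p (k + N)) = V.pairProj (a' k) b := fun k =>
    cutoff_eq hgen (by simp only [a', b, hx]; abel)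
  have e2 : ∀ a : P, ⟪ξ, V.pairProj a b ξ⟫_ℂ = ⟪V.op b ξ, V.rangeProj a (V.op b ξ)⟫_ℂ := by
    intro a
    rw [← ContinuousLinearMap.adjoint_inner_right]
    rfl
  simp only [e1, cutoff_eq hgen hxab, e2]
  refine tendsto_inner_rangeProj (p := fun k => ⟨p (k + N), hpP _⟩) hV ?_ ?_ ?_ _
  · exact tendsto_subtype_rng.2 (hp.comp (tendsto_add_atTop_nat N))
  · exact tendsto_subtype_rng.2 (ht.comp (tendsto_add_atTop_nat N))
  · intro k
    exact Subtype.ext (by simp [a', a])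

/-- The projections decrease along multiples of the order unit and so converge strongly. Since `n
a₀` eventually dominates every `a`, the limit lies in all ranges, and purity makes it zero. -/
theorem tendsto_rangeProj_nsmul {a₀ : P} (h₀ : IsOrderUnit P (a₀ : G)) (hpure : V.IsPure) (ξ : H) :
    Tendsto (fun n : ℕ => V.rangeProj (n • a₀) ξ) atTop (𝓝 0) := by
  have hmul : ∀ n m : ℕ, n ≤ m → V.rangeProj (m • a₀) (V.rangeProj (n • a₀) ξ)
      = V.rangeProj (m • a₀) ξ := by
    intro n m hnm
    obtain ⟨k, rfl⟩ := Nat.exists_eq_add_of_le hnm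
    have h := congrArg star (V.rangeProj_mul_rangeProj_add (n • a₀) (k • a₀))
    rw [star_mul, (V.isStarProjection_rangeProj _).isSelfAdjoint.star_eq,
      (V.isStarProjection_rangeProj _).isSelfAdjoint.star_eq, ← add_nsmul] at h
    exact DFunLike.congr_fun h ξ
  have hdiff : ∀ n m : ℕ, n ≤ m → ‖V.rangeProj (m • a₀) ξ‖ ^ 2
      + ‖V.rangeProj (n • a₀) ξ - V.rangeProj (m • a₀) ξ‖ ^ 2 = ‖V.rangeProj (n • a₀) ξ‖ ^ 2 := by
    intro n m hnm
    have h := IsStarProjection.norm_sq_add (V.isStarProjection_rangeProj (m • a₀))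
      (V.rangeProj (n • a₀) ξ)
    rwa [hmul n m hnm] at h
  have hanti : Antitone fun n : ℕ => ‖V.rangeProj (n • a₀) ξ‖ ^ 2 := fun n m hnm => by
    have := hdiff n m hnm
    have := sq_nonneg ‖V.rangeProj (n • a₀) ξ - V.rangeProj (m • a₀) ξ‖
    simp only
    linarith
  -- By Pythagoras, the squared distance of two terms is the difference of their squared norms,
  -- which form a bounded monotone sequence.
  have hcauchy : CauchySeq fun n : ℕ => V.rangeProj (n • a₀) ξ := by
    have hc := (tendsto_atTop_ciInf hanti ⟨0, by rintro _ ⟨n, rfl⟩; positivity⟩).cauchySeq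
    rw [Metric.cauchySeq_iff'] at hc ⊢
    intro ε hε
    obtain ⟨N, hN⟩ := hc (ε ^ 2) (by positivity)
    refine ⟨N, fun n hn => ?_⟩
    have h1 := hN n hn
    have h2 := hdiff N n hn
    rw [Real.dist_eq, abs_sub_comm] at h1
    have h3 := (le_abs_self _).trans_lt h1
    rw [dist_eq_norm, norm_sub_rev]
    refine lt_of_pow_lt_pow_left₀ 2 hε.le ?_
    linarith
  obtain ⟨y, hy⟩ := cauchySeq_tendsto_of_complete hcauchy
  have hy0 : y ∈ ⋂ a : P, Set.range (V a) := by
    refine mem_iInter.2 fun a => ?_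
    obtain ⟨N, hN⟩ := h₀.exists_forall_sub_mem (a : G)
    refine (V a).isometry.isClosedEmbedding.isClosed_range.mem_of_tendsto hy ?_
    filter_upwards [eventually_ge_atTop N] with n hn
    have hna : n • a₀ = a + ⟨n • (a₀ : G) - a, hN n hn⟩ := Subtype.ext (by simp)
    rw [hna, rangeProj_eq, op_add]
    exact ⟨_, rfl⟩
  rw [hpure] at hy0
  rwa [mem_singleton_iff.1 hy0] at hy

end Topological

end IsometrySemigroup
end ConformalIsometries

namespace ConformalIsometries
open Set Filter Topology
open scoped InnerProductSpace

/-! ### Transporting the joint distribution to `Y_u` -/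

namespace IsometrySemigroup

variable {G : Type*} [AddCommGroup G] [TopologicalSpace G] [IsTopologicalAddGroup G]
  [LocallyCompactSpace G] [T2Space G] [SecondCountableTopology G] {P : AddSubmonoid G}
  {H : Type*} [NormedAddCommGroup H] [InnerProductSpace ℂ H] [CompleteSpace H]
  {V : IsometrySemigroup P H}

/-- The joint distribution of the projections `V.cutoff x`, realized on `Y_u`. -/
theorem exists_joint_distribution_Yu [Nonempty (Yu P)]
    (hP : (P : Set G) ⊆ closure (interior (P : Set G)))
    (hgen : ∀ s : G, ∃ a ∈ P, ∃ b ∈ P, s = a - b) {a₀ : P} (h₀ : IsOrderUnit P (a₀ : G))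
    (hV : V.IsStronglyContinuous) (hpure : V.IsPure) (hcomm : V.HasCommutingRangeProjections) :
    ∃ m : H → Measure (Yu P), ∀ ξ (L : List G), m ξ {A : Yu P | ∀ x ∈ L, x ∈ A.toSet}
      = ENNReal.ofReal (⟪ξ, (L.map (V.cutoff hgen)).prod ξ⟫_ℂ).re := by
  obtain ⟨Ω, _, B, m, hBm, hmB, hBmono, hBone⟩ := exists_joint_distribution (V.cutoff hgen)
    (isStarProjection_cutoff hgen hcomm) (commute_cutoff hgen hcomm)
  have hmB1 : ∀ ξ x, m ξ (B x) = ENNReal.ofReal (⟪ξ, V.cutoff hgen x ξ⟫_ℂ).re := fun ξ x => by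
    simpa using hmB ξ [x]
  have hfin : ∀ ξ, IsFiniteMeasure (m ξ) := fun ξ => ⟨by
    have h := hmB ξ []
    simp only [List.not_mem_nil, false_implies, implies_true, Set.ofPred_true] at h
    rw [h]
    exact ENNReal.ofReal_lt_top⟩
  have hmono : ∀ {x y : G}, y - x ∈ P → B y ⊆ B x := fun h =>
    hBmono _ _ (cutoff_mul_of_sub_mem hgen hcomm h)
  have hB0 : B 0 = univ := hBone _ (cutoff_zero hgen)
  obtain ⟨p, hp, hp0⟩ := mem_closure_iff_seq_limit.1 (hP P.zero_mem)
  have hpP : ∀ k, p k ∈ P := fun k => interior_subset (hp k)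
  -- The point of `Y_u` attached to `ω`: the closure of the set of cutoffs at which `ω` takes the
  -- value 1.
  let C : Ω → Set G := fun ω => closure {x | ω ∈ B x}
  have hC_sub : ∀ {ω x q}, q ∈ interior (P : Set G) → x ∈ C ω → ω ∈ B (x - q) := by
    intro ω x q hq hx
    obtain ⟨y, hy, hyB⟩ := mem_closure_iff.1 hx {y | y - (x - q) ∈ interior (P : Set G)}
      (isOpen_interior.preimage (continuous_id.sub continuous_const)) (by simpa using hq)
    exact hmono (interior_subset hy) hyB
  -- Membership in the closure is tested along one sequence in `Int P` tending to 0, hence by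
  -- countably many measurable conditions.
  have hC : ∀ ω x, x ∈ C ω ↔ ∀ k, ω ∈ B (x - p k) := fun ω x =>
    ⟨fun hx k => hC_sub (hp k) hx, fun h => mem_closure_of_tendsto
      (by simpa using (tendsto_const_nhds (x := x)).sub hp0) (Eventually.of_forall h)⟩
  -- The exceptional set on which the closure is not proper. It is the intersection of the sets `B
  -- (n a₀)`, hence null by purity.
  let N : Set Ω := {ω | C ω = univ}
  have hN : N = ⋂ n : ℕ, B (n • (a₀ : G)) := by
    ext ω
    simp only [mem_iInter]
    constructor
    · intro hω n
      have h := hC_sub (ω := ω) (x := (n + 1) • (a₀ : G)) h₀.1 (by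
        rw [show C ω = univ from hω]; trivial)
      rwa [add_nsmul, one_nsmul, add_sub_cancel_right] at h
    · intro h
      refine eq_univ_of_forall fun x => subset_closure ?_
      obtain ⟨n, hn⟩ := h₀.exists_forall_sub_mem x
      exact hmono (hn n le_rfl) (h n)
  have hNm : MeasurableSet N := hN ▸ MeasurableSet.iInter fun n => hBm _
  have hN0 : ∀ ξ, m ξ N = 0 := by
    intro ξ
    have h1 : Tendsto (fun n : ℕ => m ξ (B (n • (a₀ : G)))) atTop (𝓝 0) := by
      have h2 := ((tendsto_const_nhds (x := ξ)).inner
        (tendsto_rangeProj_nsmul h₀ hpure ξ) (𝕜 := ℂ))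
      have h3 := ENNReal.tendsto_ofReal ((Complex.continuous_re.tendsto _).comp h2)
      simp only [inner_zero_right, Complex.zero_re, ENNReal.ofReal_zero] at h3
      refine h3.congr fun n => ?_
      rw [hmB1, show n • (a₀ : G) = ((n • a₀ : P) : G) from rfl, cutoff_coe]
      rfl
    refine le_antisymm (ge_of_tendsto' h1 fun n => measure_mono ?_) zero_le
    rw [hN]
    exact iInter_subset _ n
  classical
  let mk : ∀ ω ∉ N, Yu P := fun ω h => ⟨⟨C ω, isClosed_closure⟩, by
      refine ⟨fun q hq x hx => ?_, ?_, h⟩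
      · refine (hC _ _).2 fun k => hmono ?_ ((hC _ _).1 hx k)
        have : x - p k - (-q + x - p k) = q := by abel
        rwa [this]
      · refine nonempty_iff_ne_empty.1 ⟨0, subset_closure ?_⟩
        change ω ∈ B 0
        rw [hB0]; trivial⟩
  -- The value on `N` is arbitrary, since `N` is null for every `m ξ`.
  let pi : Ω → Yu P := fun ω => if h : ω ∈ N then Classical.arbitrary _ else mk ω h
  have hpi : ∀ ω ∉ N, ∀ x, x ∈ (pi ω).toSet ↔ ∀ k, ω ∈ B (x - p k) := by
    intro ω hω x
    have h : pi ω = mk ω hω := dif_neg hω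
    rw [← hC, h]
    rfl
  have hpim : Measurable pi := by
    change Measurable[_, borel (Yu P)] pi
    rw [Yu.measurableSpace_eq hP]
    refine measurable_generateFrom ?_
    rintro _ ⟨x, rfl⟩
    have : pi ⁻¹' {A | x ∈ A.toSet} = (N ∩ {ω | x ∈ (Classical.arbitrary (Yu P)).toSet})
        ∪ (Nᶜ ∩ ⋂ k, B (x - p k)) := by
      ext ω
      by_cases hω : ω ∈ N
      · have : pi ω = Classical.arbitrary _ := dif_pos hω
        simp [hω, this]
      · simp [hω, hpi ω hω x]
    rw [this]
    exact (hNm.inter (MeasurableSet.const _)).union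
      (hNm.compl.inter (MeasurableSet.iInter fun k => hBm _))
  have hae : ∀ ξ x, ∀ᵐ ω ∂(m ξ), (x ∈ (pi ω).toSet ↔ ω ∈ B x) := by
    intro ξ x
    -- Passing to the closure adds only a null set at each `x`: the excess is at most `m (B (x - p
    -- k)) - m (B x)`, which tends to 0 by one-sided continuity of the cutoffs.
    have h1 : m ξ ((⋂ k, B (x - p k)) \ B x) = 0 := by
      have h2 := tendsto_inner_cutoff hgen hV ⟨_, h₀.1⟩ hpP hp0 x ξ
      have h3 := ENNReal.tendsto_ofReal ((Complex.continuous_re.tendsto _).comp h2)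
      have h4 := ENNReal.Tendsto.sub h3 (tendsto_const_nhds (x := m ξ (B x)))
        (Or.inl ENNReal.ofReal_ne_top)
      rw [← hmB1, tsub_self] at h4
      refine le_antisymm (ge_of_tendsto' h4 fun k => ?_) zero_le
      rw [Function.comp, ← hmB1, ← measure_sdiff (hmono (by simpa using hpP k))
        (hBm _).nullMeasurableSet (measure_ne_top _ _)]
      exact measure_mono (sdiff_subset_sdiff_left (iInter_subset _ k))
    have h2 : ∀ᵐ ω ∂(m ξ), ω ∉ N := measure_eq_zero_iff_ae_notMem.1 (hN0 ξ)
    have h3 : ∀ᵐ ω ∂(m ξ), ω ∉ (⋂ k, B (x - p k)) \ B x :=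
      measure_eq_zero_iff_ae_notMem.1 h1
    filter_upwards [h2, h3] with ω hω hω'
    rw [hpi ω hω]
    constructor
    · intro h
      by_contra hx
      exact hω' ⟨mem_iInter.2 h, hx⟩
    · exact fun h k => hmono (by simpa using hpP k) h
  refine ⟨fun ξ => (m ξ).map pi, fun ξ L => ?_⟩
  rw [Measure.map_apply hpim (Yu.measurableSet_setOf_list L), ← hmB]
  refine measure_congr ?_
  have h : ∀ᵐ ω ∂(m ξ), ∀ x ∈ L, (x ∈ (pi ω).toSet ↔ ω ∈ B x) :=
    (ae_ball_iff (List.finite_toSet L).countable).2 fun x _ => hae ξ x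
  filter_upwards [h] with ω hω
  exact propext (forall₂_congr hω)

end IsometrySemigroup
end ConformalIsometries

namespace ConformalIsometries
open Set Filter Topology
open scoped InnerProductSpace

/-! ### Projection-valued measures -/

section SpectralMeasure

variable {H : Type*} [NormedAddCommGroup H] [InnerProductSpace ℂ H] [CompleteSpace H]

/-- A monotone sequence of projections converges strongly to a projection. -/
theorem exists_tendsto_of_monotone_projections {p : ℕ → H →L[ℂ] H}
    (hp : ∀ n, IsStarProjection (p n)) (hmono : ∀ n m, n ≤ m → p m * p n = p n) :
    ∃ T : H →L[ℂ] H, IsStarProjection T ∧ ∀ ξ, Tendsto (fun n => p n ξ) atTop (𝓝 (T ξ)) := by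
  have hmono' : ∀ n m, n ≤ m → p n * p m = p n := fun n m h => by
    have h1 := congrArg star (hmono n m h)
    rwa [star_mul, (hp n).isSelfAdjoint.star_eq, (hp m).isSelfAdjoint.star_eq] at h1
  have hdiff : ∀ ξ n m, n ≤ m → ‖p n ξ‖ ^ 2 + ‖p m ξ - p n ξ‖ ^ 2 = ‖p m ξ‖ ^ 2 := by
    intro ξ n m hnm
    have h := (hp n).norm_sq_add (p m ξ)
    rwa [show p n (p m ξ) = p n ξ from DFunLike.congr_fun (hmono' n m hnm) ξ] at h
  have hlim : ∀ ξ, ∃ y, Tendsto (fun n => p n ξ) atTop (𝓝 y) := by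
    intro ξ
    have hmon : Monotone fun n : ℕ => ‖p n ξ‖ ^ 2 := fun n m hnm => by
      have := hdiff ξ n m hnm
      have := sq_nonneg ‖p m ξ - p n ξ‖
      simp only
      linarith
    have hbdd : BddAbove (range fun n : ℕ => ‖p n ξ‖ ^ 2) := by
      refine ⟨‖ξ‖ ^ 2, ?_⟩
      rintro _ ⟨n, rfl⟩
      exact pow_le_pow_left₀ (norm_nonneg _) ((hp n).norm_apply_le ξ) 2
    have hc := (tendsto_atTop_ciSup hmon hbdd).cauchySeq
    refine cauchySeq_tendsto_of_complete ?_
    rw [Metric.cauchySeq_iff'] at hc ⊢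
    intro ε hε
    obtain ⟨N, hN⟩ := hc (ε ^ 2) (by positivity)
    refine ⟨N, fun n hn => ?_⟩
    have h1 := hN n hn
    have h2 := hdiff ξ N n hn
    rw [Real.dist_eq] at h1
    have h3 := (le_abs_self _).trans_lt h1
    rw [dist_eq_norm]
    refine lt_of_pow_lt_pow_left₀ 2 hε.le ?_
    linarith
  choose f hf using hlim
  let T : H →L[ℂ] H := continuousLinearMapOfTendsto p (tendsto_pi_nhds.2 hf)
  have hT : ∀ ξ, Tendsto (fun n => p n ξ) atTop (𝓝 (T ξ)) := hf
  refine ⟨T, ⟨?_, ?_⟩, hT⟩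
  · refine ContinuousLinearMap.ext fun ξ => ?_
    have h1 : ∀ n, T (p n ξ) = p n ξ := fun n => by
      refine tendsto_nhds_unique (hT (p n ξ)) (tendsto_const_nhds.congr' ?_)
      filter_upwards [eventually_ge_atTop n] with m hm
      exact (DFunLike.congr_fun (hmono n m hm) ξ).symm
    refine tendsto_nhds_unique ((T.continuous.tendsto _).comp (hT ξ)) ?_
    exact (hT ξ).congr fun n => (h1 n).symm
  · rw [ContinuousLinearMap.isSelfAdjoint_iff_isSymmetric]
    intro x y
    refine tendsto_nhds_unique ((hT x).inner tendsto_const_nhds)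
      ((tendsto_const_nhds.inner (hT y)).congr fun n => ?_)
    exact ((hp n).inner_apply_left x y).symm

theorem isStarProjection_list_prod {l : List (H →L[ℂ] H)} (hl : ∀ p ∈ l, IsStarProjection p)
    (hc : ∀ p ∈ l, ∀ q ∈ l, Commute p q) : IsStarProjection l.prod := by
  induction l with
  | nil => exact .one _
  | cons p l ih =>
    rw [List.prod_cons]
    refine (hl p List.mem_cons_self).mul
      (ih (fun q hq => hl q (List.mem_cons_of_mem _ hq))
        fun q hq r hr => hc q (List.mem_cons_of_mem _ hq) r (List.mem_cons_of_mem _ hr)) ?_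
    exact Commute.list_prod_right _ _ fun q hq => hc p List.mem_cons_self q
      (List.mem_cons_of_mem _ hq)

/-- A projection-valued measure on `Y`, together with its distributions. -/
structure SpectralMeasure (Y : Type*) [MeasurableSpace Y] (H : Type*) [NormedAddCommGroup H]
    [InnerProductSpace ℂ H] [CompleteSpace H] where
  /-- The projection of a measurable set. -/
  proj : Set Y → H →L[ℂ] H
  /-- The distribution in a vector. -/
  dist : H → Measure Y
  isStarProjection' : ∀ S, MeasurableSet S → IsStarProjection (proj S)
  dist_apply' : ∀ ξ S, MeasurableSet S → dist ξ S = ENNReal.ofReal (‖proj S ξ‖ ^ 2)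
  proj_univ' : proj univ = 1

/-- A Dynkin-system argument: the sets `S` for which one projection `T` satisfies `m_ξ(S) = ‖T ξ‖²`
for all `ξ` contain the generating π-system and are closed under complements and disjoint unions.
Polarization makes `T` unique, which identifies it with the list product on generators. -/
theorem exists_spectralMeasure {Y : Type*} [mY : MeasurableSpace Y] {ι : Type*} (B : ι → Set Y)
    (hB : mY = MeasurableSpace.generateFrom (range fun L : List ι => {y | ∀ i ∈ L, y ∈ B i}))
    (E : ι → H →L[ℂ] H) (hE : ∀ i, IsStarProjection (E i)) (hc : ∀ i j, Commute (E i) (E j))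
    (m : H → Measure Y) (hm : ∀ ξ (L : List ι), m ξ {y | ∀ i ∈ L, y ∈ B i}
      = ENNReal.ofReal (⟪ξ, (L.map E).prod ξ⟫_ℂ).re) :
    ∃ 𝓔 : SpectralMeasure Y H, ∀ L : List ι, 𝓔.proj {y | ∀ i ∈ L, y ∈ B i} = (L.map E).prod := by
  have hprod : ∀ L : List ι, IsStarProjection (L.map E).prod := fun L =>
    isStarProjection_list_prod (by
      simp only [List.mem_map]; rintro _ ⟨i, _, rfl⟩; exact hE i) (by
      simp only [List.mem_map]; rintro _ ⟨i, _, rfl⟩ _ ⟨j, _, rfl⟩; exact hc i j)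
  have huniv : ∀ ξ, m ξ univ = ENNReal.ofReal (‖ξ‖ ^ 2) := fun ξ => by
    have h := hm ξ []
    rw [← (hprod []).norm_sq_apply] at h
    simpa using h
  have hfin : ∀ ξ, IsFiniteMeasure (m ξ) := fun ξ => ⟨by
    rw [huniv]; exact ENNReal.ofReal_lt_top⟩
  have hpi : IsPiSystem (range fun L : List ι => {y | ∀ i ∈ L, y ∈ B i}) := by
    rintro _ ⟨L, rfl⟩ _ ⟨M, rfl⟩ _
    refine ⟨L ++ M, ?_⟩
    ext A
    simp [or_imp, forall_and]
  have key : ∀ S, MeasurableSet S → ∃ T : H →L[ℂ] H, IsStarProjection T ∧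
      ∀ ξ, m ξ S = ENNReal.ofReal (‖T ξ‖ ^ 2) := by
    intro S hS
    induction S, hS using MeasurableSpace.induction_on_inter hB hpi with
    | empty => exact ⟨0, .zero _, fun ξ => by simp⟩
    | basic S hS =>
      obtain ⟨L, rfl⟩ := hS
      exact ⟨_, hprod L, fun ξ => by rw [hm, (hprod L).norm_sq_apply]⟩
    | compl S hS ih =>
      obtain ⟨T, hT, hTm⟩ := ih
      refine ⟨1 - T, hT.one_sub, fun ξ => ?_⟩
      rw [measure_compl hS (measure_ne_top _ _), huniv, hTm,
        ← ENNReal.ofReal_sub _ (sq_nonneg _), ← hT.norm_sq_add ξ, add_sub_cancel_left]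
      rfl
    | iUnion f hd hf ih =>
      choose T hT hTm using ih
      -- In the vector `T j ξ`, the set `f j` already carries the full mass `‖T j ξ‖²`, so the
      -- disjoint set `f i` has mass 0.
      have horth : ∀ i j, i ≠ j → T i * T j = 0 := by
        intro i j hij
        refine ContinuousLinearMap.ext fun ξ => ?_
        have h1 : m (T j ξ) (f i) + m (T j ξ) (f j) ≤ m (T j ξ) univ := by
          rw [← measure_union (hd hij) (hf j)]
          exact measure_mono (subset_univ _)
        rw [hTm, hTm, huniv, ← ENNReal.ofReal_add (sq_nonneg _) (sq_nonneg _),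
          ENNReal.ofReal_le_ofReal_iff (sq_nonneg _),
          show T j (T j ξ) = T j ξ from DFunLike.congr_fun (hT j).isIdempotentElem ξ] at h1
        have h2 : ‖T i (T j ξ)‖ ^ 2 ≤ 0 := by linarith
        change T i (T j ξ) = 0
        exact norm_eq_zero.1 (pow_eq_zero_iff two_ne_zero |>.1 (le_antisymm h2 (sq_nonneg _)))
      let A : ℕ → H →L[ℂ] H := fun n => ∑ i ∈ Finset.range n, T i
      have hAT : ∀ n i, i < n → A n * T i = T i := fun n i hi => by
        simp only [A, Finset.sum_mul]
        rw [Finset.sum_eq_single_of_mem i (Finset.mem_range.2 hi) fun j _ hj => horth j i hj]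
        exact (hT i).isIdempotentElem
      have hAT0 : ∀ n i, n ≤ i → A n * T i = 0 := fun n i hi => by
        simp only [A, Finset.sum_mul]
        exact Finset.sum_eq_zero fun j hj =>
          horth j i (ne_of_lt ((Finset.mem_range.1 hj).trans_le hi))
      have hAsucc : ∀ n, A (n + 1) = A n + T n := fun n => Finset.sum_range_succ _ _
      have hA : ∀ n, IsStarProjection (A n) := by
        intro n
        induction n with
        | zero => exact .zero _
        | succ n ih =>
          rw [hAsucc]
          exact ih.add (hT n) (hAT0 n n le_rfl)
      have hAmono : ∀ n k, n ≤ k → A k * A n = A n := by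
        intro n k hnk
        conv_lhs => rw [show A n = ∑ i ∈ Finset.range n, T i from rfl]
        rw [Finset.mul_sum]
        exact Finset.sum_congr rfl fun i hi => hAT k i ((Finset.mem_range.1 hi).trans_le hnk)
      obtain ⟨R, hR, hRlim⟩ := exists_tendsto_of_monotone_projections hA hAmono
      refine ⟨R, hR, fun ξ => ?_⟩
      have hsum : ∀ n, ∑ i ∈ Finset.range n, m ξ (f i) = ENNReal.ofReal (‖A n ξ‖ ^ 2) := by
        intro n
        induction n with
        | zero => simp [A]
        | succ n ih =>
          rw [Finset.sum_range_succ, ih, hTm, ← ENNReal.ofReal_add (sq_nonneg _) (sq_nonneg _)]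
          congr 1
          rw [(hA n).norm_sq_apply, (hT n).norm_sq_apply, (hA (n + 1)).norm_sq_apply, hAsucc,
            add_apply, inner_add_right, Complex.add_re]
      rw [measure_iUnion (fun i j hij => hd hij) hf]
      refine tendsto_nhds_unique (ENNReal.summable.hasSum.tendsto_sum_nat) ?_
      simp only [hsum]
      exact ENNReal.tendsto_ofReal ((hRlim ξ).norm.pow 2)
  choose! T hT hTm using key
  have huniq : ∀ S, MeasurableSet S → ∀ R : H →L[ℂ] H, IsStarProjection R →
      (∀ ξ, m ξ S = ENNReal.ofReal (‖R ξ‖ ^ 2)) → T S = R := by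
    intro S hS R hR h
    refine ContinuousLinearMap.coe_injective ((ext_inner_map _ _).1 fun ξ => ?_)
    have h1 : ‖T S ξ‖ ^ 2 = ‖R ξ‖ ^ 2 := by
      have h2 := (hTm S hS ξ).symm.trans (h ξ)
      rwa [ENNReal.ofReal_eq_ofReal_iff (sq_nonneg _) (sq_nonneg _)] at h2
    change ⟪T S ξ, ξ⟫_ℂ = ⟪R ξ, ξ⟫_ℂ
    rw [(hT S hS).inner_apply_left, hR.inner_apply_left, ← (hT S hS).inner_apply_apply,
      ← hR.inner_apply_apply, inner_self_eq_norm_sq_to_K, inner_self_eq_norm_sq_to_K]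
    exact_mod_cast h1
  have hL : ∀ L : List ι, MeasurableSet {y | ∀ i ∈ L, y ∈ B i} := fun L => by
    rw [hB]; exact MeasurableSpace.measurableSet_generateFrom ⟨L, rfl⟩
  refine ⟨⟨T, m, hT, fun ξ S hS => hTm S hS ξ, huniq _ .univ 1 (.one _) fun ξ => by
    rw [huniv]; rfl⟩, fun L => huniq _ (hL L) _ (hprod L) fun ξ => ?_⟩
  rw [hm, (hprod L).norm_sq_apply]

namespace SpectralMeasure

variable {Y : Type*} [MeasurableSpace Y] (𝓔 : SpectralMeasure Y H) {S T : Set Y}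

theorem isStarProjection (hS : MeasurableSet S) : IsStarProjection (𝓔.proj S) :=
  𝓔.isStarProjection' S hS

theorem dist_apply (ξ : H) (hS : MeasurableSet S) :
    𝓔.dist ξ S = ENNReal.ofReal (‖𝓔.proj S ξ‖ ^ 2) := 𝓔.dist_apply' ξ S hS

theorem proj_univ : 𝓔.proj univ = 1 := 𝓔.proj_univ'

theorem dist_univ (ξ : H) : 𝓔.dist ξ univ = ENNReal.ofReal (‖ξ‖ ^ 2) := by
  rw [𝓔.dist_apply ξ .univ, proj_univ]; rfl

instance (ξ : H) : IsFiniteMeasure (𝓔.dist ξ) := ⟨by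
  rw [dist_univ]; exact ENNReal.ofReal_lt_top⟩

theorem inner_proj_self (ξ : H) (hS : MeasurableSet S) :
    ⟪ξ, 𝓔.proj S ξ⟫_ℂ = ((𝓔.dist ξ S).toReal : ℂ) := by
  rw [𝓔.dist_apply ξ hS, ENNReal.toReal_ofReal (sq_nonneg _),
    ← (𝓔.isStarProjection hS).inner_apply_apply, inner_self_eq_norm_sq_to_K]
  push_cast; rfl

theorem proj_union (hS : MeasurableSet S) (hT : MeasurableSet T) (h : Disjoint S T) :
    𝓔.proj (S ∪ T) = 𝓔.proj S + 𝓔.proj T := by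
  refine ContinuousLinearMap.coe_injective ((ext_inner_map _ _).1 fun ξ => ?_)
  change ⟪𝓔.proj (S ∪ T) ξ, ξ⟫_ℂ = ⟪𝓔.proj S ξ + 𝓔.proj T ξ, ξ⟫_ℂ
  rw [inner_add_left, (𝓔.isStarProjection (hS.union hT)).inner_apply_left,
    (𝓔.isStarProjection hS).inner_apply_left, (𝓔.isStarProjection hT).inner_apply_left,
    inner_proj_self _ _ (hS.union hT), inner_proj_self _ _ hS, inner_proj_self _ _ hT,
    measure_union h hT, ENNReal.toReal_add (measure_ne_top _ _) (measure_ne_top _ _)]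
  push_cast; rfl

theorem proj_compl (hS : MeasurableSet S) : 𝓔.proj Sᶜ = 1 - 𝓔.proj S := by
  rw [eq_sub_iff_add_eq, ← 𝓔.proj_union hS.compl hS disjoint_compl_left, compl_union_self,
    proj_univ]

theorem proj_empty : 𝓔.proj ∅ = 0 := by
  have h := 𝓔.proj_compl (.univ : MeasurableSet (univ : Set Y))
  rwa [compl_univ, proj_univ, sub_self] at h

theorem proj_mul_of_disjoint (hS : MeasurableSet S) (hT : MeasurableSet T) (h : Disjoint S T) :
    𝓔.proj S * 𝓔.proj T = 0 := by
  refine ContinuousLinearMap.ext fun ξ => ?_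
  have h1 : 𝓔.dist (𝓔.proj T ξ) S + 𝓔.dist (𝓔.proj T ξ) T ≤ 𝓔.dist (𝓔.proj T ξ) univ := by
    rw [← measure_union h hT]
    exact measure_mono (subset_univ _)
  rw [𝓔.dist_apply _ hS, 𝓔.dist_apply _ hT, dist_univ,
    ← ENNReal.ofReal_add (sq_nonneg _) (sq_nonneg _),
    ENNReal.ofReal_le_ofReal_iff (sq_nonneg _), show 𝓔.proj T (𝓔.proj T ξ) = 𝓔.proj T ξ from
      DFunLike.congr_fun (𝓔.isStarProjection hT).isIdempotentElem ξ] at h1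
  have h2 : ‖𝓔.proj S (𝓔.proj T ξ)‖ ^ 2 ≤ 0 := by linarith
  change 𝓔.proj S (𝓔.proj T ξ) = 0
  exact norm_eq_zero.1 (pow_eq_zero_iff two_ne_zero |>.1 (le_antisymm h2 (sq_nonneg _)))

theorem proj_inter (hS : MeasurableSet S) (hT : MeasurableSet T) :
    𝓔.proj (S ∩ T) = 𝓔.proj S * 𝓔.proj T := by
  have h1 : 𝓔.proj S = 𝓔.proj (S ∩ T) + 𝓔.proj (S \ T) := by
    rw [← 𝓔.proj_union (hS.inter hT) (hS.diff hT)
      (disjoint_sdiff_right.mono_left inter_subset_right), inter_union_sdiff]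
  have h2 : 𝓔.proj (S ∩ T) * 𝓔.proj T = 𝓔.proj (S ∩ T) := by
    have h3 := 𝓔.proj_mul_of_disjoint (hS.inter hT) hT.compl
      (disjoint_compl_right.mono_left inter_subset_right)
    rw [𝓔.proj_compl hT, mul_sub, mul_one, sub_eq_zero] at h3
    exact h3.symm
  rw [h1, add_mul, h2, 𝓔.proj_mul_of_disjoint (hS.diff hT) hT disjoint_sdiff_left, add_zero]

theorem proj_mul_of_subset (hS : MeasurableSet S) (hT : MeasurableSet T) (h : S ⊆ T) :
    𝓔.proj S * 𝓔.proj T = 𝓔.proj S := by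
  rw [← 𝓔.proj_inter hS hT, inter_eq_self_of_subset_left h]

theorem inner_proj_proj (hS : MeasurableSet S) (hT : MeasurableSet T) (ξ η : H) :
    ⟪𝓔.proj S ξ, 𝓔.proj T η⟫_ℂ = ⟪ξ, 𝓔.proj (S ∩ T) η⟫_ℂ := by
  rw [(𝓔.isStarProjection hS).inner_apply_left, 𝓔.proj_inter hS hT]; rfl

/-- Countable additivity of the scalar measures gives the diagonal case; polarization gives the
off-diagonal one. -/
theorem hasSum_inner_proj {f : ℕ → Set Y} (hf : ∀ n, MeasurableSet (f n))
    (hd : Pairwise (Function.onFun Disjoint f)) (η ξ : H) :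
    HasSum (fun n => ⟪η, 𝓔.proj (f n) ξ⟫_ℂ) ⟪η, 𝓔.proj (⋃ n, f n) ξ⟫_ℂ := by
  have hU : MeasurableSet (⋃ n, f n) := .iUnion hf
  have hq : ∀ ζ, HasSum (fun n => ⟪(𝓔.proj (f n) : H →ₗ[ℂ] H) ζ, ζ⟫_ℂ)
      ⟪(𝓔.proj (⋃ n, f n) : H →ₗ[ℂ] H) ζ, ζ⟫_ℂ := by
    intro ζ
    have h1 : ∀ n, ⟪(𝓔.proj (f n) : H →ₗ[ℂ] H) ζ, ζ⟫_ℂ = ((𝓔.dist ζ (f n)).toReal : ℂ) :=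
      fun n => ((𝓔.isStarProjection (hf n)).inner_apply_left ζ ζ).trans
        (𝓔.inner_proj_self ζ (hf n))
    have h2 : ⟪(𝓔.proj (⋃ n, f n) : H →ₗ[ℂ] H) ζ, ζ⟫_ℂ
        = ((𝓔.dist ζ (⋃ n, f n)).toReal : ℂ) :=
      ((𝓔.isStarProjection hU).inner_apply_left ζ ζ).trans (𝓔.inner_proj_self ζ hU)
    simp only [h1, h2]
    have h3 := measure_iUnion (μ := 𝓔.dist ζ) (fun i j hij => hd hij) hf
    have h4 := ENNReal.hasSum_toReal (f := fun n => 𝓔.dist ζ (f n))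
      (by rw [← h3]; exact measure_ne_top _ _)
    rw [h3, ENNReal.tsum_toReal_eq fun n => measure_ne_top _ _]
    exact Complex.hasSum_ofReal.2 h4
  have hp : ∀ S, MeasurableSet S → ⟪η, 𝓔.proj S ξ⟫_ℂ = ⟪(𝓔.proj S : H →ₗ[ℂ] H) η, ξ⟫_ℂ :=
    fun S hS => ((𝓔.isStarProjection hS).inner_apply_left η ξ).symm
  simp only [hp _ hU, fun n => hp _ (hf n), inner_map_polarization _ ξ η]
  exact ((((hq _).sub (hq _)).add ((hq _).mul_left _)).sub ((hq _).mul_left _)).div_const _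

/-- An intertwining relation which holds on a generating `π`-system holds everywhere. -/
theorem proj_mul_eq_of_generateFrom {C : Set (Set Y)}
    (hC : (inferInstance : MeasurableSpace Y) = MeasurableSpace.generateFrom C)
    (hpi : IsPiSystem C) {τ : Y → Y} (hτ : Measurable τ) {B : H →L[ℂ] H}
    (h : ∀ S ∈ C, 𝓔.proj S * B = B * 𝓔.proj (τ ⁻¹' S)) (hS : MeasurableSet S) :
    𝓔.proj S * B = B * 𝓔.proj (τ ⁻¹' S) := by
  induction S, hS using MeasurableSpace.induction_on_inter hC hpi with
  | empty => rw [preimage_empty, proj_empty, zero_mul, mul_zero]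
  | basic S hS => exact h S hS
  | compl S hS ih =>
    rw [preimage_compl, 𝓔.proj_compl hS, 𝓔.proj_compl (hτ hS), sub_mul, mul_sub, ih, one_mul,
      mul_one]
  | iUnion f hd hf ih =>
    refine ContinuousLinearMap.ext fun ξ => ext_inner_left ℂ fun η => ?_
    have h1 := 𝓔.hasSum_inner_proj hf hd η (B ξ)
    have h2 := 𝓔.hasSum_inner_proj (fun n => hτ (hf n))
      (fun i j hij => (hd hij).preimage τ) (ContinuousLinearMap.adjoint B η) ξ
    rw [← preimage_iUnion] at h2
    refine h1.unique ?_
    simp only [ContinuousLinearMap.adjoint_inner_left] at h2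
    have h3 : ∀ n, 𝓔.proj (f n) (B ξ) = B (𝓔.proj (τ ⁻¹' f n) ξ) := fun n =>
      DFunLike.congr_fun (ih n) ξ
    simp only [h3]
    exact h2

end SpectralMeasure

end SpectralMeasure
end ConformalIsometries

namespace ConformalIsometries
open Set Filter Topology
open scoped InnerProductSpace

variable {G : Type*} [AddCommGroup G] [TopologicalSpace G] {P : AddSubmonoid G}

/-! ### Windows -/

/-- The set of all `A` in `X_u` that do not contain `b`. -/
def window (P : AddSubmonoid G) (b : G) : Set (Yu P) := {A | (0 : G) ∈ A.toSet ∧ b ∉ A.toSet}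

/-- The set of all `A` with `n a₀ ∈ A` and `(n + 1) a₀ ∉ A`. -/
def slab (P : AddSubmonoid G) (a₀ : G) (n : ℤ) : Set (Yu P) :=
  {A | n • a₀ ∈ A.toSet ∧ (n + 1) • a₀ ∉ A.toSet}

theorem window_subset_Xu (b : G) : window P b ⊆ Xu P := fun _ hA => hA.1

theorem slab_zero (a₀ : G) : slab P a₀ 0 = window P a₀ := by
  simp [slab, window]

theorem zsmul_mem_of_le {a₀ : G} (ha₀ : a₀ ∈ P) {A : Yu P} {n m : ℤ} (hnm : n ≤ m)
    (h : m • a₀ ∈ A.toSet) : n • a₀ ∈ A.toSet := by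
  refine A.mem_of_sub_mem h ?_
  obtain ⟨k, rfl⟩ := Int.le.dest hnm
  rw [add_zsmul, add_sub_cancel_left, natCast_zsmul]
  exact P.nsmul_mem ha₀ k

theorem disjoint_slab {a₀ : G} (ha₀ : a₀ ∈ P) : Pairwise (Function.onFun Disjoint (slab P a₀)) := by
  have key : ∀ n m : ℤ, n < m → Disjoint (slab P a₀ n) (slab P a₀ m) := fun n m h =>
    Set.disjoint_left.2 fun A hA hA' => hA.2 (zsmul_mem_of_le ha₀ h hA'.1)
  intro n m hnm
  rcases lt_or_gt_of_ne hnm with h | h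
  · exact key n m h
  · exact (key m n h).symm

/-- The integers `n` with `n a₀ ∈ A` are downward closed, nonempty and bounded above, so a largest
one exists. Together with disjointness, this makes slab 0 a fundamental domain for translation by
`a₀`. -/
theorem iUnion_slab {a₀ : G} (h₀ : IsOrderUnit P a₀) : ⋃ n, slab P a₀ n = univ := by
  refine eq_univ_of_forall fun A => ?_
  obtain ⟨k, hk⟩ := h₀.exists_forall_neg_mem A
  obtain ⟨m, hm⟩ := h₀.exists_forall_notMem A
  have hk' : (-(k : ℤ)) • a₀ ∈ A.toSet := by
    rw [neg_zsmul, natCast_zsmul]; exact hk k le_rfl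
  have hbdd : ∀ z : ℤ, z • a₀ ∈ A.toSet → z ≤ m := fun z hz => by
    by_contra h
    refine hm m le_rfl ?_
    rw [← natCast_zsmul]
    exact zsmul_mem_of_le h₀.mem (not_le.1 h).le hz
  obtain ⟨n, hn, hmax⟩ := Int.exists_greatest_of_bdd ⟨m, hbdd⟩ ⟨_, hk'⟩
  refine mem_iUnion.2 ⟨n, hn, fun h => ?_⟩
  have := hmax _ h
  omega

theorem measurableSet_window (b : G) : MeasurableSet (window P b) :=
  (Yu.measurableSet_setOf_mem 0).inter (Yu.measurableSet_setOf_mem b).compl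

theorem measurableSet_slab (a₀ : G) (n : ℤ) : MeasurableSet (slab P a₀ n) :=
  (Yu.measurableSet_setOf_mem _).inter (Yu.measurableSet_setOf_mem _).compl

variable [IsTopologicalAddGroup G]

theorem translate_preimage_preimage (s t : G) (S : Set (Yu P)) :
    Yu.translate s ⁻¹' (Yu.translate t ⁻¹' S) = Yu.translate (t + s) ⁻¹' S := by
  ext A
  simp only [mem_preimage, Yu.translate_translate]

theorem translate_zero_preimage (S : Set (Yu P)) : Yu.translate 0 ⁻¹' S = S := by
  ext A
  simp only [mem_preimage, Yu.translate_zero]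

theorem translate_preimage_slab (a₀ : G) (k n : ℤ) :
    Yu.translate (k • a₀) ⁻¹' slab P a₀ n = slab P a₀ (n - k) := by
  ext A
  simp only [slab, mem_preimage, Set.mem_ofPred_eq, Yu.mem_translate, ← sub_smul]
  rw [show n + 1 - k = n - k + 1 by ring]

/-! ### Covariant spectral measures -/

variable {H : Type*} [NormedAddCommGroup H] [InnerProductSpace ℂ H] [CompleteSpace H]

/-- A spectral measure on `Y_u` that is covariant with respect to `V`. -/
structure IsCovariant (V : IsometrySemigroup P H) (𝓔 : SpectralMeasure (Yu P) H) : Prop where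
  proj_setOf_mem : ∀ a : P, 𝓔.proj {A | (a : G) ∈ A.toSet} = V.rangeProj a
  proj_mul_op : ∀ (p : P) (S : Set (Yu P)), MeasurableSet S →
    𝓔.proj S * V.op p = V.op p * 𝓔.proj (Yu.translate (p : G) ⁻¹' S)
  -- This clause later makes the unitary group commute with `𝓔`, because its phases cancel in `V_b^*
  -- V_a V_a^* V_b`.
  commute_of_forall : ∀ B : H →L[ℂ] H, (∀ a b : P, Commute B (V.pairProj a b)) →
    ∀ S, MeasurableSet S → Commute B (𝓔.proj S)

/-- The relations hold for finite products of cutoffs, that is, on the π-system of finite membership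
conditions; that system generates the Borel sets, so they propagate. -/
theorem exists_isCovariant [LocallyCompactSpace G] [T2Space G] [SecondCountableTopology G]
    [Nonempty (Yu P)]
    (hP : (P : Set G) ⊆ closure (interior (P : Set G)))
    (hgen : ∀ s : G, ∃ a ∈ P, ∃ b ∈ P, s = a - b) {a₀ : P} (h₀ : IsOrderUnit P (a₀ : G))
    {V : IsometrySemigroup P H}
    (hV : V.IsStronglyContinuous) (hpure : V.IsPure) (hcomm : V.HasCommutingRangeProjections) :
    ∃ 𝓔 : SpectralMeasure (Yu P) H, IsCovariant V 𝓔 := by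
  obtain ⟨m, hm⟩ := IsometrySemigroup.exists_joint_distribution_Yu hP hgen h₀ hV hpure hcomm
  obtain ⟨𝓔, h𝓔⟩ := exists_spectralMeasure (Y := Yu P) (fun x : G => {A | x ∈ A.toSet})
    (Yu.measurableSpace_eq_list hP) (V.cutoff hgen)
    (IsometrySemigroup.isStarProjection_cutoff hgen hcomm)
    (IsometrySemigroup.commute_cutoff hgen hcomm) m hm
  have hgenL := Yu.measurableSpace_eq_list hP
  have hpi : IsPiSystem _ := Yu.isPiSystem_setOf_list (P := P)
  refine ⟨𝓔, fun a => ?_, fun p S hS => ?_, fun B hB S hS => ?_⟩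
  · have h := h𝓔 [(a : G)]
    simp only [List.mem_singleton, forall_eq, List.map_cons, List.map_nil, List.prod_singleton,
      Set.mem_ofPred_eq, IsometrySemigroup.cutoff_coe] at h
    exact h
  · refine 𝓔.proj_mul_eq_of_generateFrom hgenL hpi (Yu.measurable_translate _) ?_ hS
    rintro _ ⟨L, rfl⟩
    have h1 : Yu.translate (p : G) ⁻¹' {A : Yu P | ∀ x ∈ L, x ∈ A.toSet}
        = {A | ∀ x ∈ L.map (fun x => x - (p : G)), x ∈ A.toSet} := by
      ext A
      simp [Yu.mem_translate]
    rw [h1]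
    have h2 := h𝓔 L
    have h3 := h𝓔 (L.map fun x => x - (p : G))
    simp only [Set.mem_ofPred_eq] at h2 h3
    rw [h2, h3]
    clear h1 h2 h3
    induction L with
    | nil => simp
    | cons x L ih =>
      simp only [List.map_cons, List.prod_cons]
      have h4 := IsometrySemigroup.cutoff_add_mul_op hgen hcomm (x - (p : G)) p
      rw [sub_add_cancel] at h4
      rw [mul_assoc, ih, ← mul_assoc, h4, mul_assoc]
  · have h1 := 𝓔.proj_mul_eq_of_generateFrom hgenL hpi measurable_id (B := B) ?_ hS
    · exact h1.symm
    · rintro _ ⟨L, rfl⟩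
      have h2 := h𝓔 L
      simp only [Set.mem_ofPred_eq] at h2
      rw [preimage_id, h2]
      refine (Commute.list_prod_right _ _ ?_ : Commute B _).eq.symm
      simp only [List.mem_map]
      rintro _ ⟨x, _, rfl⟩
      exact hB _ _

namespace IsCovariant

variable {V : IsometrySemigroup P H} {𝓔 : SpectralMeasure (Yu P) H} (h𝓔 : IsCovariant V 𝓔)
include h𝓔

theorem proj_Xu : 𝓔.proj (Xu P) = 1 := by
  have h := h𝓔.proj_setOf_mem 0
  rw [V.rangeProj_eq, V.op_zero, V.adj_zero, one_mul] at h
  exact h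

theorem proj_window (b : P) : 𝓔.proj (window P (b : G)) = 1 - V.rangeProj b := by
  have h : window P (b : G) = Xu P ∩ {A | (b : G) ∈ A.toSet}ᶜ := rfl
  rw [h, 𝓔.proj_inter Yu.measurableSet_Xu (Yu.measurableSet_setOf_mem _).compl, h𝓔.proj_Xu,
    𝓔.proj_compl (Yu.measurableSet_setOf_mem _), h𝓔.proj_setOf_mem, one_mul]

/-- For `S ⊆ X_u`, the operator `V_p` intertwines the projections of `S` and `S + p`. -/
theorem proj_translate_mul_op (p : P) {S : Set (Yu P)} (hS : MeasurableSet S) :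
    𝓔.proj (Yu.translate (-(p : G)) ⁻¹' S) * V.op p = V.op p * 𝓔.proj S := by
  rw [h𝓔.proj_mul_op p _ (Yu.measurable_translate _ hS), translate_preimage_preimage,
    neg_add_cancel, translate_zero_preimage]

/-- Every member of `S + p` contains `p`, so `𝓔(S + p)` lies under `V_p V_p^*`; the intertwining
relation then determines it. -/
theorem proj_translate_eq (p : P) {S : Set (Yu P)} (hS : MeasurableSet S) (hSX : S ⊆ Xu P) :
    𝓔.proj (Yu.translate (-(p : G)) ⁻¹' S) = V.op p * 𝓔.proj S * V.adj p := by
  have hsub : Yu.translate (-(p : G)) ⁻¹' S ⊆ {A | (p : G) ∈ A.toSet} := fun A hA => by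
    have h := hSX hA
    change (0 : G) - -(p : G) ∈ A.toSet at h
    simpa using h
  rw [← h𝓔.proj_translate_mul_op p hS, mul_assoc, ← V.rangeProj_eq, ← h𝓔.proj_setOf_mem,
    𝓔.proj_mul_of_subset (Yu.measurable_translate _ hS) (Yu.measurableSet_setOf_mem _) hsub]

end IsCovariant

/-! ### Conformal families of vectors -/

/-- A family of vectors `s a` in the kernels of the `V_a^*` that represents a functional in
`A_β(V)`. -/
structure IsConformalFamily (V : IsometrySemigroup P H) (c : G →+ ℝ) (β : ℝ) (s : P → H) :
    Prop where
  cut : ∀ a d : P, s a = s (a + d) - V.rangeProj a (s (a + d))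
  shift : ∀ a b : P, V.adj a (s (a + b)) = (Real.exp (-(β * c a) / 2) : ℂ) • s b

namespace IsConformalFamily

variable {V : IsometrySemigroup P H} {𝓔 : SpectralMeasure (Yu P) H} {c : G →+ ℝ} {β : ℝ}
  {s : P → H} (hs : IsConformalFamily V c β s) (h𝓔 : IsCovariant V 𝓔)
include hs

omit [TopologicalSpace G] [IsTopologicalAddGroup G] in
-- The cocycle form of the two axioms: `s_{a+d}` is split along `ker V_a^*` and the range of `V_a`.
-- It determines all `s_{n a₀}` from `s_{a₀}`.
theorem eq_add (a d : P) :
    s (a + d) = s a + (Real.exp (-(β * c a) / 2) : ℂ) • V a (s d) := by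
  have h1 := hs.cut a d
  have h2 : V.rangeProj a (s (a + d)) = (Real.exp (-(β * c a) / 2) : ℂ) • V a (s d) := by
    rw [← LinearIsometry.map_smul, ← hs.shift]; rfl
  rw [h1, h2, sub_add_cancel]

include h𝓔

theorem proj_window_add (a d : P) : 𝓔.proj (window P (a : G)) (s (a + d)) = s a := by
  rw [h𝓔.proj_window, hs.cut a d]; rfl

theorem proj_window_self (a : P) : 𝓔.proj (window P (a : G)) (s a) = s a := by
  have h := hs.proj_window_add h𝓔 a 0
  rwa [add_zero] at h

theorem proj_apply_add {S : Set (Yu P)} (hS : MeasurableSet S) {a : P} (hSa : S ⊆ window P (a : G))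
    (d : P) : 𝓔.proj S (s (a + d)) = 𝓔.proj S (s a) := by
  rw [← hs.proj_window_add h𝓔 a d]
  exact (DFunLike.congr_fun (𝓔.proj_mul_of_subset hS (measurableSet_window _) hSa) _).symm

theorem proj_apply_congr {S : Set (Yu P)} (hS : MeasurableSet S) {a b : P}
    (hSa : S ⊆ window P (a : G)) (hSb : S ⊆ window P (b : G)) :
    𝓔.proj S (s a) = 𝓔.proj S (s b) := by
  rw [← hs.proj_apply_add h𝓔 hS hSa b, add_comm, hs.proj_apply_add h𝓔 hS hSb]

theorem proj_translate_apply {S : Set (Yu P)} (hS : MeasurableSet S) (hSX : S ⊆ Xu P) (p b : P) :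
    𝓔.proj (Yu.translate (-(p : G)) ⁻¹' S) (s (p + b))
      = (Real.exp (-(β * c p) / 2) : ℂ) • V p (𝓔.proj S (s b)) := by
  rw [h𝓔.proj_translate_eq p hS hSX, ← LinearIsometry.map_smul, ← map_smul, ← hs.shift]
  rfl

theorem dist_translate {S : Set (Yu P)} (hS : MeasurableSet S) (hSX : S ⊆ Xu P) (p b : P) :
    𝓔.dist (s (p + b)) (Yu.translate (-(p : G)) ⁻¹' S)
      = ENNReal.ofReal (Real.exp (-(β * c p))) * 𝓔.dist (s b) S := by
  rw [𝓔.dist_apply _ hS, 𝓔.dist_apply _ (Yu.measurable_translate _ hS),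
    hs.proj_translate_apply h𝓔 hS hSX, norm_smul, LinearIsometry.norm_map, mul_pow,
    ENNReal.ofReal_mul (sq_nonneg _), Complex.norm_real, Real.norm_of_nonneg (Real.exp_pos _).le,
    ← Real.exp_nat_mul]
  congr 3
  push_cast
  ring

end IsConformalFamily

/-! ### The conformal measure -/

/-- The weight `e^{-β c(s)}`. -/
noncomputable def weight (c : G →+ ℝ) (β : ℝ) (s : G) : ℝ≥0∞ :=
  ENNReal.ofReal (Real.exp (-(β * c s)))

section weight
omit [TopologicalSpace G] [IsTopologicalAddGroup G]

theorem weight_add (c : G →+ ℝ) (β : ℝ) (s t : G) :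
    weight c β (s + t) = weight c β s * weight c β t := by
  rw [weight, weight, weight, ← ENNReal.ofReal_mul (Real.exp_pos _).le, ← Real.exp_add, map_add]
  congr 2
  ring

theorem weight_zero (c : G →+ ℝ) (β : ℝ) : weight c β 0 = 1 := by simp [weight]

theorem weight_neg_mul (c : G →+ ℝ) (β : ℝ) (s : G) : weight c β (-s) * weight c β s = 1 := by
  rw [← weight_add, neg_add_cancel, weight_zero]

end weight

/-- The measure on `Y_u` that extends the measure `m` on a fundamental domain for the translation
by `a₀`. -/
noncomputable def extendMeasure (c : G →+ ℝ) (β : ℝ) (a₀ : G) (m : Measure (Yu P)) :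
    Measure (Yu P) :=
  Measure.sum fun n : ℤ => weight c β (n • a₀) • m.map (Yu.translate (n • a₀))

section extend

variable {c : G →+ ℝ} {β : ℝ} {a₀ : G} {m : Measure (Yu P)}
theorem extendMeasure_apply {S : Set (Yu P)} (hS : MeasurableSet S) :
    extendMeasure c β a₀ m S
      = ∑' n : ℤ, weight c β (n • a₀) * m (Yu.translate (n • a₀) ⁻¹' S) := by
  rw [extendMeasure, Measure.sum_apply _ hS]
  refine tsum_congr fun n => ?_
  rw [Measure.smul_apply, Measure.map_apply (Yu.measurable_translate _) hS, smul_eq_mul]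

theorem extendMeasure_translate_zsmul {S : Set (Yu P)} (hS : MeasurableSet S) (j : ℤ) :
    extendMeasure c β a₀ m (Yu.translate (-(j • a₀)) ⁻¹' S)
      = weight c β (j • a₀) * extendMeasure c β a₀ m S := by
  rw [extendMeasure_apply hS, extendMeasure_apply (Yu.measurable_translate _ hS),
    ← ENNReal.tsum_mul_left, ← (Equiv.addLeft j).tsum_eq]
  refine tsum_congr fun n => ?_
  rw [translate_preimage_preimage, Equiv.coe_addLeft, add_zsmul, weight_add, mul_assoc,
    neg_add_cancel_left]

/-- Translating a subset of slab `n` back by `k a₀` puts it in slab `n - k`, which is null for `m`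
unless `k = n`; one term of the series survives. -/
theorem extendMeasure_of_subset_slab (ha₀ : a₀ ∈ P) (hm : m (slab P a₀ 0)ᶜ = 0)
    {S : Set (Yu P)} (hS : MeasurableSet S) {n : ℤ} (hSn : S ⊆ slab P a₀ n) :
    extendMeasure c β a₀ m S = weight c β (n • a₀) * m (Yu.translate (n • a₀) ⁻¹' S) := by
  rw [extendMeasure_apply hS]
  refine tsum_eq_single n fun k hk => ?_
  have h1 : m (Yu.translate (k • a₀) ⁻¹' S) = 0 := by
    refine measure_mono_null ?_ hm
    refine (preimage_mono hSn).trans ?_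
    rw [translate_preimage_slab]
    refine (disjoint_slab ha₀ ?_).subset_compl_right
    exact fun h => hk (sub_eq_zero.1 h).symm
  rw [h1, mul_zero]

end extend

namespace IsConformalFamily

variable {V : IsometrySemigroup P H} {𝓔 : SpectralMeasure (Yu P) H} {c : G →+ ℝ} {β : ℝ}
  {s : P → H} (hs : IsConformalFamily V c β s) (h𝓔 : IsCovariant V 𝓔)
  {a₀ : P} (h₀ : IsOrderUnit P (a₀ : G))

variable (𝓔 c β s a₀) in
/-- The conformal measure of a conformal family of vectors. -/
noncomputable def measure : Measure (Yu P) := extendMeasure c β (a₀ : G) (𝓔.dist (s a₀))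

include hs h𝓔 h₀

omit h₀ in
theorem dist_compl_slab : 𝓔.dist (s a₀) (slab P (a₀ : G) 0)ᶜ = 0 := by
  rw [slab_zero, 𝓔.dist_apply _ (measurableSet_window _).compl,
    𝓔.proj_compl (measurableSet_window _)]
  rw [sub_apply, hs.proj_window_self h𝓔]
  simp

/-- The construction does not depend on the window. Cut `S` into slabs; those with negative index
miss `X_u`. On the slab of index `k ≥ 0`, `s_b` may be exchanged for `s_{k a₀ + a₀}`, whose
distribution translates back to that of `s_{a₀}` on slab 0 with exactly the weight used in the
extension. -/
theorem measure_eq_dist {S : Set (Yu P)} (hS : MeasurableSet S) {b : P}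
    (hSb : S ⊆ window P (b : G)) : measure 𝓔 c β s a₀ S = 𝓔.dist (s b) S := by
  have hslab : ∀ n : ℤ, MeasurableSet (S ∩ slab P (a₀ : G) n) := fun n =>
    hS.inter (measurableSet_slab _ _)
  have hdec : S = ⋃ n : ℤ, S ∩ slab P (a₀ : G) n := by
    rw [← inter_iUnion, iUnion_slab h₀, inter_univ]
  have hdisj : Pairwise (Function.onFun Disjoint fun n : ℤ => S ∩ slab P (a₀ : G) n) :=
    fun n m hnm => (disjoint_slab h₀.mem hnm).mono inter_subset_right inter_subset_right
  rw [hdec, measure_iUnion hdisj hslab, measure_iUnion hdisj hslab]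
  refine tsum_congr fun n => ?_
  rw [measure, extendMeasure_of_subset_slab h₀.mem (hs.dist_compl_slab h𝓔) (hslab n)
    inter_subset_right]
  rcases lt_or_ge n 0 with hn | hn
  · have : S ∩ slab P (a₀ : G) n = ∅ := by
      refine eq_empty_iff_forall_notMem.2 fun A hA => hA.2.2 ?_
      refine zsmul_mem_of_le h₀.mem (show n + 1 ≤ 0 by omega) ?_
      rw [zero_zsmul]
      exact (hSb hA.1).1
    simp [this]
  · obtain ⟨k, rfl⟩ := Int.eq_ofNat_of_zero_le hn
    rw [natCast_zsmul]
    have hk : k • (a₀ : G) = ((k • a₀ : P) : G) := rfl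
    have h1 : S ∩ slab P (a₀ : G) k ⊆ window P ((k • a₀ + a₀ : P) : G) := fun A hA => by
      refine ⟨(hSb hA.1).1, fun h => hA.2.2 ?_⟩
      rw [add_zsmul, one_zsmul, natCast_zsmul]
      exact h
    have h2 : 𝓔.dist (s b) (S ∩ slab P (a₀ : G) k)
        = 𝓔.dist (s (k • a₀ + a₀)) (S ∩ slab P (a₀ : G) k) := by
      rw [𝓔.dist_apply _ (hslab _), 𝓔.dist_apply _ (hslab _),
        hs.proj_apply_congr h𝓔 (hslab _) (inter_subset_left.trans hSb) h1]
    have h3 : S ∩ slab P (a₀ : G) k = Yu.translate (-((k • a₀ : P) : G)) ⁻¹'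
        (Yu.translate (k • (a₀ : G)) ⁻¹' (S ∩ slab P (a₀ : G) k)) := by
      rw [translate_preimage_preimage, ← hk, add_neg_cancel, translate_zero_preimage]
    rw [h2]
    conv_rhs => rw [h3]
    rw [hs.dist_translate h𝓔 (Yu.measurable_translate _ (hslab _)), ← hk]
    · rfl
    · intro A hA
      have h4 := hA.2.1
      rw [Yu.mem_translate, natCast_zsmul, sub_self] at h4
      exact h4

/-- Multiples of `a₀` scale the measure by construction, so each slab piece can be moved to a set
`S'` in the window of `a₀`. Then `S' + p` lies in the window of `p + a₀`, and the claim becomes the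
scaling of the vectors `s`. -/
theorem measure_translate_of_mem {S : Set (Yu P)} (hS : MeasurableSet S) (p : P) :
    measure 𝓔 c β s a₀ (Yu.translate (-(p : G)) ⁻¹' S)
      = weight c β p * measure 𝓔 c β s a₀ S := by
  have hslab : ∀ n : ℤ, MeasurableSet (S ∩ slab P (a₀ : G) n) := fun n =>
    hS.inter (measurableSet_slab _ _)
  have hdec : S = ⋃ n : ℤ, S ∩ slab P (a₀ : G) n := by
    rw [← inter_iUnion, iUnion_slab h₀, inter_univ]
  have hdisj : Pairwise (Function.onFun Disjoint fun n : ℤ => S ∩ slab P (a₀ : G) n) :=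
    fun n m hnm => (disjoint_slab h₀.mem hnm).mono inter_subset_right inter_subset_right
  rw [hdec, preimage_iUnion, measure_iUnion (fun n m hnm => (hdisj hnm).preimage _)
    (fun n => Yu.measurable_translate _ (hslab n)), measure_iUnion hdisj hslab,
    ← ENNReal.tsum_mul_left]
  refine tsum_congr fun n => ?_
  have hS' : MeasurableSet (Yu.translate (n • (a₀ : G)) ⁻¹' (S ∩ slab P (a₀ : G) n)) :=
    Yu.measurable_translate _ (hslab n)
  have hSa : Yu.translate (n • (a₀ : G)) ⁻¹' (S ∩ slab P (a₀ : G) n) ⊆ window P (a₀ : G) := by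
    refine (preimage_mono inter_subset_right).trans ?_
    rw [translate_preimage_slab, sub_self, slab_zero]
  have h1 : S ∩ slab P (a₀ : G) n = Yu.translate (-(n • (a₀ : G))) ⁻¹'
      (Yu.translate (n • (a₀ : G)) ⁻¹' (S ∩ slab P (a₀ : G) n)) := by
    rw [translate_preimage_preimage, add_neg_cancel, translate_zero_preimage]
  change measure 𝓔 c β s a₀ (Yu.translate (-(p : G)) ⁻¹' (S ∩ slab P (a₀ : G) n))
    = weight c β p * measure 𝓔 c β s a₀ (S ∩ slab P (a₀ : G) n)
  rw [h1]
  generalize Yu.translate (n • (a₀ : G)) ⁻¹' (S ∩ slab P (a₀ : G) n) = S' at hS' hSa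
  have h2 : Yu.translate (-(p : G)) ⁻¹' (Yu.translate (-(n • (a₀ : G))) ⁻¹' S')
      = Yu.translate (-(n • (a₀ : G))) ⁻¹' (Yu.translate (-(p : G)) ⁻¹' S') := by
    rw [translate_preimage_preimage, translate_preimage_preimage, add_comm]
  have hpS : Yu.translate (-(p : G)) ⁻¹' S' ⊆ window P ((p + a₀ : P) : G) := fun A hA => by
    have h3 := hSa hA
    refine ⟨translate_mem_Xu_of_neg p.2 h3.1, fun h => h3.2 ?_⟩
    rw [Yu.mem_translate, sub_neg_eq_add, add_comm]
    exact h
  rw [h2]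
  have h4 := hs.measure_eq_dist h𝓔 h₀ (Yu.measurable_translate _ hS') hpS
  have h5 := hs.measure_eq_dist h𝓔 h₀ hS' hSa
  have h6 := extendMeasure_translate_zsmul (c := c) (β := β) (a₀ := (a₀ : G))
    (m := 𝓔.dist (s a₀)) (Yu.measurable_translate (-(p : G)) hS') n
  have h7 := extendMeasure_translate_zsmul (c := c) (β := β) (a₀ := (a₀ : G))
    (m := 𝓔.dist (s a₀)) hS' n
  rw [measure] at h4 h5 ⊢
  rw [h6, h7, h4, h5, hs.dist_translate h𝓔 hS' (hSa.trans (window_subset_Xu _)), ← weight,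
    mul_left_comm]

theorem isConformalMeasure (hgen : ∀ s : G, ∃ a ∈ P, ∃ b ∈ P, s = a - b) :
    IsConformalMeasure c β (measure 𝓔 c β s a₀) := by
  intro t E hE
  obtain ⟨p, hp, q, hq, rfl⟩ := hgen t
  have h1 := hs.measure_translate_of_mem h𝓔 h₀ (Yu.measurable_translate q hE) ⟨p, hp⟩
  have h2 := hs.measure_translate_of_mem h𝓔 h₀ (Yu.measurable_translate q hE) ⟨q, hq⟩
  rw [translate_preimage_preimage, ← sub_eq_add_neg] at h1 h2
  simp only [sub_self, translate_zero_preimage] at h2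
  rw [← Yu.preimage_translate_neg, neg_sub, h1, h2, ← weight, sub_eq_add_neg, weight_add,
    mul_assoc, ← mul_assoc (weight c β (-q)), weight_neg_mul, one_mul]

theorem measure_window (b : P) :
    measure 𝓔 c β s a₀ (window P (b : G)) = ENNReal.ofReal (‖s b‖ ^ 2) := by
  rw [hs.measure_eq_dist h𝓔 h₀ (measurableSet_window _) subset_rfl,
    𝓔.dist_apply _ (measurableSet_window _), hs.proj_window_self h𝓔]

theorem isLocallyFiniteMeasure (hgen : ∀ s : G, ∃ a ∈ P, ∃ b ∈ P, s = a - b) :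
    IsLocallyFiniteMeasure (measure 𝓔 c β s a₀) := by
  refine ⟨fun A => ?_⟩
  obtain ⟨x, hx⟩ := nonempty_iff_ne_empty.2 A.2.2.1
  obtain ⟨n, _, hn⟩ := h₀.2 (-x)
  obtain ⟨m, hm⟩ := h₀.exists_forall_notMem A
  -- Containing `-n a₀` is a closed condition; hitting an open set of points `z` with `n a₀ + z ∈
  -- Int P` is open and implies it. Thus `O` lies in a translate of a window, which has finite mass.
  let O : Set (Yu P) := {B | (B.toSet ∩ {z | n • (a₀ : G) - -z ∈ interior (P : Set G)}).Nonempty} ∩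
    {B | B.toSet ∩ {m • (a₀ : G)} = ∅}
  have hO : IsOpen O := (Yu.isOpen_hit (isOpen_interior.preimage
    (continuous_const.sub continuous_neg))).inter (Yu.isOpen_miss isCompact_singleton)
  have hAO : A ∈ O := ⟨⟨x, hx, hn⟩, by
    simpa [Set.inter_singleton_eq_empty] using hm m le_rfl⟩
  refine ⟨O, hO.mem_nhds hAO, ?_⟩
  have hsub : O ⊆ Yu.translate (n • (a₀ : G)) ⁻¹' window P (((n + m) • a₀ : P) : G) := by
    rintro B ⟨⟨z, hz, hzn⟩, hB⟩
    refine ⟨?_, ?_⟩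
    · rw [Yu.mem_translate]
      refine B.mem_of_sub_mem hz ?_
      have h : n • (a₀ : G) - -z ∈ P := interior_subset hzn
      rwa [show z - (0 - n • (a₀ : G)) = n • (a₀ : G) - -z by abel]
    · rw [Yu.mem_translate]
      intro h
      have h' : ((n + m) • a₀ : P).1 - n • (a₀ : G) = m • (a₀ : G) := by
        change (n + m) • (a₀ : G) - _ = _
        rw [add_nsmul, add_sub_cancel_left]
      rw [h'] at h
      exact eq_empty_iff_forall_notMem.1 hB _ ⟨h, rfl⟩
  refine (measure_mono hsub).trans_lt ?_
  have h1 := hs.isConformalMeasure h𝓔 h₀ hgen (-(n • (a₀ : G))) _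
    (measurableSet_window (P := P) (((n + m) • a₀ : P) : G))
  rw [← Yu.preimage_translate_neg, neg_neg] at h1
  rw [h1, hs.measure_window h𝓔 h₀]
  exact ENNReal.mul_lt_top ENNReal.ofReal_lt_top ENNReal.ofReal_lt_top

theorem regular [LocallyCompactSpace G] [T2Space G] [SecondCountableTopology G]
    (hgen : ∀ s : G, ∃ a ∈ P, ∃ b ∈ P, s = a - b)
    (hP : (P : Set G) ⊆ closure (interior (P : Set G))) : (measure 𝓔 c β s a₀).Regular := by
  have := hs.isLocallyFiniteMeasure h𝓔 h₀ hgen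
  have := Yu.sigmaCompactSpace hP h₀
  infer_instance

theorem sigmaFinite [LocallyCompactSpace G] [T2Space G] [SecondCountableTopology G]
    (hgen : ∀ s : G, ∃ a ∈ P, ∃ b ∈ P, s = a - b) :
    SigmaFinite (measure 𝓔 c β s a₀) := by
  have := hs.isLocallyFiniteMeasure h𝓔 h₀ hgen
  infer_instance

theorem measure_ne_zero (h : s a₀ ≠ 0) : measure 𝓔 c β s a₀ ≠ 0 := by
  intro h0
  have h1 := hs.measure_window h𝓔 h₀ a₀
  rw [h0] at h1
  have h2 := ENNReal.ofReal_eq_zero.1 h1.symm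
  have h3 : 0 < ‖s a₀‖ ^ 2 := by positivity
  linarith

end IsConformalFamily
end ConformalIsometries

namespace ConformalIsometries
open Set Filter Topology
open scoped InnerProductSpace

/-! ### Isometries from Gram matrices -/

/-- Equal Gram matrices give equal norms of corresponding linear combinations; the resulting map is
extended by continuity from the dense span. -/
theorem exists_linearIsometry_of_inner_eq {K H : Type*} [NormedAddCommGroup K]
    [InnerProductSpace ℂ K] [NormedAddCommGroup H] [InnerProductSpace ℂ H] [CompleteSpace H]
    {ι : Type*} (v : ι → K) (w : ι → H) (h : ∀ i j, ⟪v i, v j⟫_ℂ = ⟪w i, w j⟫_ℂ)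
    (hv : Dense (Submodule.span ℂ (range v) : Set K)) :
    ∃ Φ : K →ₗᵢ[ℂ] H, ∀ i, Φ (v i) = w i := by
  let e : (ι →₀ ℂ) →ₗ[ℂ] K := Finsupp.linearCombination ℂ v
  let f : (ι →₀ ℂ) →ₗ[ℂ] H := Finsupp.linearCombination ℂ w
  have he : DenseRange e := by
    have h1 : range e = Submodule.span ℂ (range v) := by
      rw [← Finsupp.range_linearCombination]; rfl
    rw [DenseRange, h1]
    exact hv
  have hnorm : ∀ x, ‖f x‖ = ‖e x‖ := by
    intro x
    have h1 : ⟪f x, f x⟫_ℂ = ⟪e x, e x⟫_ℂ := by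
      simp only [f, e, Finsupp.linearCombination_apply, Finsupp.sum, sum_inner, inner_sum,
        inner_smul_left, inner_smul_right, h]
    rw [inner_self_eq_norm_sq_to_K, inner_self_eq_norm_sq_to_K] at h1
    have h2 : ‖f x‖ ^ 2 = ‖e x‖ ^ 2 := by exact_mod_cast h1
    exact (pow_left_inj₀ (norm_nonneg _) (norm_nonneg _) two_ne_zero).1 h2
  have hext : ∀ x, f.extendOfNorm e (e x) = f x :=
    LinearMap.extendOfNorm_eq he ⟨1, fun x => by rw [one_mul, hnorm]⟩
  refine ⟨⟨(f.extendOfNorm e : K →ₗ[ℂ] H), fun x => ?_⟩, fun i => ?_⟩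
  · refine he.induction_on x (isClosed_eq (by fun_prop) (by fun_prop)) fun y => ?_
    change ‖f.extendOfNorm e (e y)‖ = ‖e y‖
    rw [hext, hnorm]
  · have h1 := hext (Finsupp.single i 1)
    simpa [e, f] using h1

/-! ### The space `L²(X_u, μ)` and its indicator functions -/

section L2

variable {G : Type*} [AddCommGroup G] [TopologicalSpace G] {P : AddSubmonoid G}
  [IsTopologicalAddGroup G] {μ : Measure (Yu P)}

omit [IsTopologicalAddGroup G] in
theorem isClosed_L2Xu : IsClosed (L2Xu μ : Set (Lp ℂ 2 μ)) := by
  refine IsSeqClosed.isClosed fun f g hf hfg => ?_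
  obtain ⟨ns, _, hns⟩ := (tendstoInMeasure_of_tendsto_Lp hfg).exists_seq_tendsto_ae
  have h : ∀ᵐ A ∂μ, ∀ n, A ∉ Xu P → f n A = 0 := ae_all_iff.2 fun n => hf n
  filter_upwards [hns, h] with A hA hA' hAX
  exact tendsto_nhds_unique hA (tendsto_const_nhds.congr fun n => (hA' (ns n) hAX).symm)

instance : CompleteSpace (L2Xu μ) := isClosed_L2Xu.completeSpace_coe

/-- The indicator function of a subset of `X_u`, as a point of `L²(X_u, μ)`. -/
noncomputable def L2Xu.indicator {S : Set (Yu P)} (hS : MeasurableSet S) (hSX : S ⊆ Xu P)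
    (hμS : μ S ≠ ∞) : L2Xu μ :=
  ⟨indicatorConstLp 2 hS hμS (1 : ℂ), by
    filter_upwards [indicatorConstLp_coeFn (p := 2) (hs := hS) (hμs := hμS) (c := (1 : ℂ))]
      with A hA hAX
    rw [hA, indicator_of_notMem fun h => hAX (hSX h)]⟩

omit [IsTopologicalAddGroup G] in
theorem L2Xu.indicator_coeFn {S : Set (Yu P)} (hS : MeasurableSet S) (hSX : S ⊆ Xu P)
    (hμS : μ S ≠ ∞) :
    ((L2Xu.indicator hS hSX hμS : L2Xu μ) : Lp ℂ 2 μ) =ᵐ[μ] S.indicator fun _ => (1 : ℂ) :=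
  indicatorConstLp_coeFn (p := 2) (hs := hS) (hμs := hμS) (c := (1 : ℂ))

omit [IsTopologicalAddGroup G] in
/-- Two points of `L²(X_u, μ)` are equal if their integrals over all subsets of windows are. -/
theorem ae_eq_zero_of_forall_setIntegral_window {a₀ : P} (h₀ : IsOrderUnit P (a₀ : G))
    (hμ : ∀ b : P, μ (window P (b : G)) ≠ ∞) (f : Lp ℂ 2 μ)
    (hint : ∀ (S : Set (Yu P)) (b : P), MeasurableSet S → S ⊆ window P (b : G) →
      ∫ A in S, f A ∂μ = 0) :
    ∀ᵐ A ∂μ, A ∈ Xu P → f A = 0 := by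
  have h1 : ∀ b : P, ∀ᵐ A ∂μ, A ∈ window P (b : G) → f A = 0 := by
    intro b
    have hfin : IsFiniteMeasure (μ.restrict (window P (b : G))) :=
      ⟨by rw [Measure.restrict_apply_univ]; exact (hμ b).lt_top⟩
    have hfi : Integrable f (μ.restrict (window P (b : G))) :=
      ((Lp.memLp f).restrict _).integrable one_le_two
    rw [← ae_restrict_iff' (measurableSet_window _)]
    refine ae_eq_zero_of_forall_setIntegral_eq_of_sigmaFinite (fun S _ _ => hfi.integrableOn)
      fun S hS _ => ?_
    rw [Measure.restrict_restrict hS]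
    exact hint _ b (hS.inter (measurableSet_window _)) inter_subset_right
  have h2 : ∀ᵐ A ∂μ, ∀ n : ℕ, A ∈ window P ((n • a₀ : P) : G) → f A = 0 :=
    ae_all_iff.2 fun n => h1 _
  filter_upwards [h2] with A hA hAX
  obtain ⟨n, hn⟩ := h₀.exists_forall_notMem A
  exact hA n ⟨hAX, hn n le_rfl⟩

omit [IsTopologicalAddGroup G] in
/-- The indicator functions of subsets of windows span a dense subspace. -/
theorem L2Xu.dense_span {a₀ : P} (h₀ : IsOrderUnit P (a₀ : G))
    (hμ : ∀ b : P, μ (window P (b : G)) ≠ ∞) :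
    Dense (Submodule.span ℂ {f : L2Xu μ | ∃ (S : Set (Yu P)) (b : P) (hS : MeasurableSet S)
      (hSb : S ⊆ window P (b : G)), f = L2Xu.indicator hS (hSb.trans (window_subset_Xu _))
        (measure_ne_top_of_subset hSb (hμ b))} : Set (L2Xu μ)) := by
  rw [Submodule.dense_iff_topologicalClosure_eq_top, Submodule.topologicalClosure_eq_top_iff,
    Submodule.eq_bot_iff]
  intro f hf
  rw [Submodule.mem_orthogonal] at hf
  have h1 : ∀ᵐ A ∂μ, A ∈ Xu P → (f : Lp ℂ 2 μ) A = 0 := by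
    refine ae_eq_zero_of_forall_setIntegral_window h₀ hμ _ fun S b hS hSb => ?_
    have h2 := hf _ (Submodule.subset_span ⟨S, b, hS, hSb, rfl⟩)
    rw [Submodule.coe_inner] at h2
    rw [← h2]
    exact (L2.inner_indicatorConstLp_one hS (measure_ne_top_of_subset hSb (hμ b)) _).symm
  refine Subtype.ext (Lp.ext ?_)
  filter_upwards [h1, f.2, Lp.coeFn_zero ℂ 2 μ] with A hA hA' hA0
  rw [Submodule.coe_zero, hA0]
  by_cases h : A ∈ Xu P
  · exact hA h
  · exact hA' h

omit [IsTopologicalAddGroup G] in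
theorem L2Xu.induction_closed {a₀ : P} (h₀ : IsOrderUnit P (a₀ : G))
    (hμ : ∀ b : P, μ (window P (b : G)) ≠ ∞) (C : Submodule ℂ (L2Xu μ))
    (hC : IsClosed (C : Set (L2Xu μ)))
    (h : ∀ (S : Set (Yu P)) (b : P) (hS : MeasurableSet S) (hSb : S ⊆ window P (b : G)),
      L2Xu.indicator hS (hSb.trans (window_subset_Xu _)) (measure_ne_top_of_subset hSb (hμ b))
        ∈ C) (f : L2Xu μ) : f ∈ C := by
  have h1 := (L2Xu.dense_span h₀ hμ).closure_eq
  have h2 := hC.closure_subset_iff.2 (Submodule.span_le.2 (show {f : L2Xu μ |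
      ∃ (S : Set (Yu P)) (b : P) (hS : MeasurableSet S)
      (hSb : S ⊆ window P (b : G)), f = L2Xu.indicator hS (hSb.trans (window_subset_Xu _))
        (measure_ne_top_of_subset hSb (hμ b))} ⊆ C by
    rintro _ ⟨S, b, hS, hSb, rfl⟩
    exact h S b hS hSb))
  rw [h1] at h2
  exact h2 (mem_univ f)

omit [IsTopologicalAddGroup G] in
theorem L2Xu.ext_indicator {a₀ : P} (h₀ : IsOrderUnit P (a₀ : G))
    (hμ : ∀ b : P, μ (window P (b : G)) ≠ ∞) {E : Type*} [NormedAddCommGroup E]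
    [NormedSpace ℂ E] (R T : L2Xu μ →L[ℂ] E)
    (h : ∀ (S : Set (Yu P)) (b : P) (hS : MeasurableSet S) (hSb : S ⊆ window P (b : G)),
      R (L2Xu.indicator hS (hSb.trans (window_subset_Xu _)) (measure_ne_top_of_subset hSb (hμ b)))
      = T (L2Xu.indicator hS (hSb.trans (window_subset_Xu _))
        (measure_ne_top_of_subset hSb (hμ b)))) : R = T := by
  refine ContinuousLinearMap.ext fun f => ?_
  have h1 := L2Xu.induction_closed h₀ hμ (LinearMap.eqLocus (R : L2Xu μ →ₗ[ℂ] E) T)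
    (isClosed_eq R.continuous T.continuous) h f
  exact h1

theorem conformalRep_indicator {c : G →+ ℝ} {β : ℝ} (hμ : IsConformalMeasure c β μ) (p : P)
    {S : Set (Yu P)} (hS : MeasurableSet S) (hSX : S ⊆ Xu P) (hμS : μ S ≠ ∞)
    (hSX' : Yu.translate (-(p : G)) ⁻¹' S ⊆ Xu P) (hμS' : μ (Yu.translate (-(p : G)) ⁻¹' S) ≠ ∞) :
    conformalRep hμ p (L2Xu.indicator hS hSX hμS) = (Real.exp (β * c p / 2) : ℂ) •
      L2Xu.indicator (Yu.measurable_translate _ hS) hSX' hμS' := by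
  refine Subtype.ext (Lp.ext ?_)
  change koopman hμ (p : G) (L2Xu.indicator hS hSX hμS : Lp ℂ 2 μ) =ᵐ[μ] _
  filter_upwards [koopman_coeFn hμ (p : G) (L2Xu.indicator hS hSX hμS : Lp ℂ 2 μ),
    hμ.koopmanFun_congr (p : G) (L2Xu.indicator_coeFn hS hSX hμS),
    Lp.coeFn_smul (Real.exp (β * c p / 2) : ℂ)
      (L2Xu.indicator (Yu.measurable_translate _ hS) hSX' hμS' : Lp ℂ 2 μ),
    L2Xu.indicator_coeFn (Yu.measurable_translate (-(p : G)) hS) hSX' hμS'] with A h1 h2 h3 h4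
  rw [h1, h2, Submodule.coe_smul, h3, Pi.smul_apply, h4]
  rfl

end L2

/-! ### The embedding of `L²(X_u, μ)` as a reducing subspace -/

section Embedding

variable {G : Type*} [AddCommGroup G] [TopologicalSpace G] {P : AddSubmonoid G}
  [IsTopologicalAddGroup G]
  {H : Type*} [NormedAddCommGroup H] [InnerProductSpace ℂ H] [CompleteSpace H]

namespace IsConformalFamily

variable {V : IsometrySemigroup P H} {𝓔 : SpectralMeasure (Yu P) H} {c : G →+ ℝ} {β : ℝ}
  {s : P → H} (hs : IsConformalFamily V c β s) (h𝓔 : IsCovariant V 𝓔)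
  {a₀ : P} (h₀ : IsOrderUnit P (a₀ : G))
include hs h𝓔 h₀

theorem measure_window_ne_top (b : P) : measure 𝓔 c β s a₀ (window P (b : G)) ≠ ∞ := by
  rw [hs.measure_window h𝓔 h₀]
  exact ENNReal.ofReal_ne_top

/-- The isometry that sends the indicator function of `S ⊆ window b` to `𝓔(S) s_b`. -/
theorem exists_embedding : ∃ Φ : L2Xu (measure 𝓔 c β s a₀) →ₗᵢ[ℂ] H,
    ∀ (S : Set (Yu P)) (b : P) (hS : MeasurableSet S) (hSX : S ⊆ Xu P)
      (hμS : measure 𝓔 c β s a₀ S ≠ ∞), S ⊆ window P (b : G) →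
      Φ (L2Xu.indicator hS hSX hμS) = 𝓔.proj S (s b) := by
  let ι := {p : Set (Yu P) × P // MeasurableSet p.1 ∧ p.1 ⊆ window P (p.2 : G)}
  let v : ι → L2Xu (measure 𝓔 c β s a₀) := fun i => L2Xu.indicator i.2.1
    (i.2.2.trans (window_subset_Xu _))
    (measure_ne_top_of_subset i.2.2 (hs.measure_window_ne_top h𝓔 h₀ _))
  let w : ι → H := fun i => 𝓔.proj i.1.1 (s i.1.2)
  -- Both sides equal `μ(S ∩ T)`: on `S ∩ T` the vectors `s_b` and `s_d` have the same projection,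
  -- and its squared norm is the measure.
  have hvw : ∀ i j, ⟪v i, v j⟫_ℂ = ⟪w i, w j⟫_ℂ := by
    intro i j
    obtain ⟨⟨S, b⟩, hS, hSb⟩ := i
    obtain ⟨⟨T, d⟩, hT, hTd⟩ := j
    simp only at hS hSb hT hTd
    have h1 : ⟪v ⟨(S, b), hS, hSb⟩, v ⟨(T, d), hT, hTd⟩⟫_ℂ
        = ((measure 𝓔 c β s a₀).real (S ∩ T) : ℂ) :=
      L2.inner_indicatorConstLp_one_indicatorConstLp_one (𝕜 := ℂ) hS hT
        (measure_ne_top_of_subset hSb (hs.measure_window_ne_top h𝓔 h₀ b))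
        (measure_ne_top_of_subset hTd (hs.measure_window_ne_top h𝓔 h₀ d))
    rw [h1]
    change _ = ⟪𝓔.proj S (s b), 𝓔.proj T (s d)⟫_ℂ
    have h2 : (𝓔.proj (S ∩ T)) (s b) = 𝓔.proj (S ∩ T) (s d) :=
      hs.proj_apply_congr h𝓔 (hS.inter hT) (inter_subset_left.trans hSb)
        (inter_subset_right.trans hTd)
    rw [𝓔.inner_proj_proj hS hT, ← h2, 𝓔.inner_proj_self _ (hS.inter hT), Measure.real,
      hs.measure_eq_dist h𝓔 h₀ (hS.inter hT) (inter_subset_left.trans hSb)]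
  have hd : Dense (Submodule.span ℂ (range v) : Set (L2Xu (measure 𝓔 c β s a₀))) := by
    convert L2Xu.dense_span h₀ (hs.measure_window_ne_top h𝓔 h₀) using 3
    ext f
    constructor
    · rintro ⟨⟨⟨S, b⟩, hS, hSb⟩, rfl⟩
      exact ⟨S, b, hS, hSb, rfl⟩
    · rintro ⟨S, b, hS, hSb, rfl⟩
      exact ⟨⟨(S, b), hS, hSb⟩, rfl⟩
  obtain ⟨Φ, hΦ⟩ := exists_linearIsometry_of_inner_eq v w hvw hd
  exact ⟨Φ, fun S b hS hSX hμS hSb => hΦ ⟨(S, b), hS, hSb⟩⟩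

/-- On an indicator, the factor `e^{βc(p)/2}` of the Koopman operator cancels the factor
`e^{-βc(p)/2}` of the conformal family. -/
theorem embedding_conformalRep (hμ : IsConformalMeasure c β (measure 𝓔 c β s a₀))
    {Φ : L2Xu (measure 𝓔 c β s a₀) →ₗᵢ[ℂ] H}
    (hΦ : ∀ (S : Set (Yu P)) (b : P) (hS : MeasurableSet S) (hSX : S ⊆ Xu P)
      (hμS : measure 𝓔 c β s a₀ S ≠ ∞), S ⊆ window P (b : G) →
      Φ (L2Xu.indicator hS hSX hμS) = 𝓔.proj S (s b)) (p : P)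
    (f : L2Xu (measure 𝓔 c β s a₀)) : Φ (conformalRep hμ p f) = V p (Φ f) := by
  have h : (Φ.toContinuousLinearMap ∘L (conformalRep hμ p).toContinuousLinearMap)
      = (V p).toContinuousLinearMap ∘L Φ.toContinuousLinearMap := by
    refine L2Xu.ext_indicator h₀ (hs.measure_window_ne_top h𝓔 h₀) _ _ fun S b hS hSb => ?_
    have hSp : Yu.translate (-(p : G)) ⁻¹' S ⊆ window P ((p + b : P) : G) := fun A hA => by
      have h3 := hSb hA
      refine ⟨translate_mem_Xu_of_neg p.2 h3.1, fun h => h3.2 ?_⟩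
      rw [Yu.mem_translate, sub_neg_eq_add, add_comm]
      exact h
    have hfin := measure_ne_top_of_subset hSp (hs.measure_window_ne_top h𝓔 h₀ _)
    change Φ (conformalRep hμ p _) = V p (Φ _)
    rw [conformalRep_indicator hμ p hS _ _ (hSp.trans (window_subset_Xu _)) hfin, map_smul,
      hΦ _ (p + b) _ _ _ hSp, hΦ _ b _ _ _ hSb,
      hs.proj_translate_apply h𝓔 hS (hSb.trans (window_subset_Xu _)), smul_smul,
      ← Complex.ofReal_mul, ← Real.exp_add]
    ring_nf
    simp
  exact DFunLike.congr_fun h f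

theorem adj_embedding_mem_range
    {Φ : L2Xu (measure 𝓔 c β s a₀) →ₗᵢ[ℂ] H}
    (hΦ : ∀ (S : Set (Yu P)) (b : P) (hS : MeasurableSet S) (hSX : S ⊆ Xu P)
      (hμS : measure 𝓔 c β s a₀ S ≠ ∞), S ⊆ window P (b : G) →
      Φ (L2Xu.indicator hS hSX hμS) = 𝓔.proj S (s b)) (p : P)
    (f : L2Xu (measure 𝓔 c β s a₀)) : V.adj p (Φ f) ∈ LinearMap.range Φ.toLinearMap := by
  have hclosed : IsClosed (LinearMap.range Φ.toLinearMap : Set H) :=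
    Φ.isometry.isClosedEmbedding.isClosed_range
  refine L2Xu.induction_closed h₀ (hs.measure_window_ne_top h𝓔 h₀)
    ((LinearMap.range Φ.toLinearMap).comap
      (V.adj p ∘L Φ.toContinuousLinearMap : _ →L[ℂ] H).toLinearMap)
    (hclosed.preimage (V.adj p ∘L Φ.toContinuousLinearMap).continuous) (fun S b hS hSb => ?_) f
  change V.adj p (Φ _) ∈ LinearMap.range Φ.toLinearMap
  rw [hΦ _ b _ _ _ hSb]
  -- `V_p^*` sees only the part of `S` on which `p ∈ A`. That part is a translate `S' + p` with `S'`
  -- again in the window of `b`, so `V_p^*` returns a multiple of the image of an indicator.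
  let T : Set (Yu P) := S ∩ {A | (p : G) ∈ A.toSet}
  have hT : MeasurableSet T := hS.inter (Yu.measurableSet_setOf_mem _)
  let S' : Set (Yu P) := Yu.translate (p : G) ⁻¹' T
  have hS' : MeasurableSet S' := Yu.measurable_translate _ hT
  have hTS' : T = Yu.translate (-(p : G)) ⁻¹' S' := by
    rw [translate_preimage_preimage, add_neg_cancel, translate_zero_preimage]
  have hS'b : S' ⊆ window P (b : G) := by
    intro A hA
    refine ⟨?_, fun h => (hSb hA.1).2 ?_⟩
    · have h1 := hA.2
      change (p : G) - p ∈ A.toSet at h1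
      rwa [sub_self] at h1
    · rw [Yu.mem_translate]
      exact A.sub_mem h p.2
  have h1 : V.adj p (𝓔.proj S (s b)) = V.adj p (𝓔.proj T (s (p + b))) := by
    have h2 : V.adj p * 𝓔.proj S = V.adj p * 𝓔.proj T := by
      rw [← V.adj_mul_rangeProj p, ← h𝓔.proj_setOf_mem, mul_assoc, mul_assoc,
        ← 𝓔.proj_inter (Yu.measurableSet_setOf_mem _) hS,
        ← 𝓔.proj_inter (Yu.measurableSet_setOf_mem _) hT, inter_comm,
        show {A : Yu P | (p : G) ∈ A.toSet} ∩ T = S ∩ {A | (p : G) ∈ A.toSet} by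
          rw [inter_eq_self_of_subset_right inter_subset_right]]
    have h3 : 𝓔.proj T (s (p + b)) = 𝓔.proj T (s b) := by
      rw [add_comm]
      exact hs.proj_apply_add h𝓔 hT (inter_subset_left.trans hSb) p
    rw [h3]
    exact DFunLike.congr_fun h2 _
  rw [h1, hTS', hs.proj_translate_apply h𝓔 hS' (hS'b.trans (window_subset_Xu _)), map_smul,
    V.adj_apply]
  refine Submodule.smul_mem _ _ ⟨L2Xu.indicator hS' (hS'b.trans (window_subset_Xu _))
    (measure_ne_top_of_subset hS'b (hs.measure_window_ne_top h𝓔 h₀ b)), ?_⟩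
  exact hΦ _ b _ _ _ hS'b

theorem isDirectSummand (hμ : IsConformalMeasure c β (measure 𝓔 c β s a₀)) :
    (conformalRep hμ).IsDirectSummand V := by
  obtain ⟨Φ, hΦ⟩ := hs.exists_embedding h𝓔 h₀
  refine ⟨LinearMap.range Φ.toLinearMap, Φ.isometry.isClosedEmbedding.isClosed_range, ?_, ?_,
    Φ.equivRange, fun a f => hs.embedding_conformalRep h𝓔 h₀ hμ hΦ a f⟩
  · rintro a _ ⟨f, rfl⟩
    exact ⟨conformalRep hμ a f, hs.embedding_conformalRep h𝓔 h₀ hμ hΦ a f⟩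
  · rintro a _ ⟨f, rfl⟩
    exact hs.adj_embedding_mem_range h𝓔 h₀ hΦ a f

end IsConformalFamily

end Embedding
end ConformalIsometries

namespace ConformalIsometries
open Set Filter Topology
open scoped InnerProductSpace

/-! ### The vectors that represent a functional in `A_β(V)` -/

section Riesz

variable {G : Type*} [AddCommGroup G] {P : AddSubmonoid G}
  {H : Type*} [NormedAddCommGroup H] [InnerProductSpace ℂ H] [CompleteSpace H]
  {V : IsometrySemigroup P H}

namespace IsometrySemigroup

theorem exists_representative (φ : V.locallyBoundedDual) (a : P) :
    ∃ s : H, V.adj a s = 0 ∧ ∀ x : V.kerUnion, V.adj a x = 0 → φ.1 x = ⟪s, (x : H)⟫_ℂ := by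
  obtain ⟨C, hC⟩ := φ.2 a
  let K : Submodule ℂ H := (V.adj a).ker
  have hK : IsClosed (K : Set H) := (V.adj a).isClosed_ker
  have : CompleteSpace K := hK.completeSpace_coe
  let i : K →ₗ[ℂ] V.kerUnion := Submodule.inclusion fun x hx => ⟨a, hx⟩
  let f : StrongDual ℂ K := LinearMap.mkContinuous (φ.1 ∘ₗ i) C fun x => hC (i x) x.2
  refine ⟨((InnerProductSpace.toDual ℂ K).symm f : K), ((InnerProductSpace.toDual ℂ K).symm f).2,
    fun x hx => ?_⟩
  have h := InnerProductSpace.toDual_symm_apply (x := (⟨x, hx⟩ : K)) (y := f)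
  rw [Submodule.coe_inner] at h
  rw [h]
  rfl

theorem eq_of_forall_inner_eq {a : P} {x y : H} (hx : V.adj a x = 0) (hy : V.adj a y = 0)
    (h : ∀ z, V.adj a z = 0 → ⟪x, z⟫_ℂ = ⟪y, z⟫_ℂ) : x = y := by
  rw [← sub_eq_zero, ← inner_self_eq_zero (𝕜 := ℂ), inner_sub_left,
    h (x - y) (by rw [map_sub, hx, hy, sub_zero]), sub_self]

theorem inner_adj_left (a : P) (x y : H) : ⟪V.adj a x, y⟫_ℂ = ⟪x, V a y⟫_ℂ :=
  ContinuousLinearMap.adjoint_inner_left _ _ _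

/-- The Riesz vectors on nested kernels are projections of one another, and the eigenvalue equation
dualizes without conjugation because the factor is real. -/
theorem isConformalFamily_of_representative [TopologicalSpace G] {c : G →+ ℝ} {β : ℝ}
    {φ : V.locallyBoundedDual}
    (hφ : ∀ a : P, V.shift a φ = (Real.exp (-(β * c a) / 2) : ℂ) • φ) {s : P → H}
    (hs : ∀ a, V.adj a (s a) = 0)
    (hsφ : ∀ a (x : V.kerUnion), V.adj a x = 0 → φ.1 x = ⟪s a, (x : H)⟫_ℂ) :
    IsConformalFamily V c β s := by
  constructor
  · intro a d
    refine eq_of_forall_inner_eq (hs a) ?_ fun z hz => ?_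
    · have h : V.adj a (V.rangeProj a (s (a + d))) = V.adj a (s (a + d)) :=
        DFunLike.congr_fun (V.adj_mul_rangeProj a) _
      rw [map_sub, h, sub_self]
    · have hz' : V.adj (a + d) z = 0 := by rw [adj_add, hz, map_zero]
      rw [← hsφ a ⟨z, a, hz⟩ hz, hsφ (a + d) ⟨z, a, hz⟩ hz', inner_sub_left]
      have h : ⟪V.rangeProj a (s (a + d)), z⟫_ℂ = 0 := by
        rw [(V.isStarProjection_rangeProj a).inner_apply_left]
        change ⟪_, V a (V.adj a z)⟫_ℂ = 0
        rw [hz, LinearIsometry.map_zero, inner_zero_right]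
      rw [h, sub_zero]
  · intro a b
    refine eq_of_forall_inner_eq (a := b) ?_ (by rw [map_smul, hs, smul_zero]) fun z hz => ?_
    · rw [← adj_add, hs]
    · have h1 : V.adj (a + b) (V a z) = 0 := V.adj_eq_zero_of_adj_eq_zero a b hz
      have h2 := congrArg (fun ψ : V.locallyBoundedDual => ψ.1 ⟨z, b, hz⟩) (hφ a)
      have h3 := hsφ (a + b) ⟨V a z, a + b, h1⟩ h1
      have h4 := hsφ b ⟨z, b, hz⟩ hz
      rw [inner_adj_left, ← h3, inner_smul_left, Complex.conj_ofReal, ← h4]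
      exact h2

theorem adj_apply_eq_zero_of_commute {T : H →L[ℂ] H} {a : P} (hT : Commute T (V.adj a)) {x : H}
    (hx : V.adj a x = 0) : V.adj a (T x) = 0 := by
  have h : V.adj a (T x) = T (V.adj a x) := (DFunLike.congr_fun hT.eq x).symm
  rw [h, hx, map_zero]

/-- The restriction to `D_V` of an operator that commutes with all `V_a^*`. -/
noncomputable def kerUnionMap (T : H →L[ℂ] H) (hT : ∀ a, Commute T (V.adj a)) :
    V.kerUnion →ₗ[ℂ] V.kerUnion where
  toFun x := ⟨T x, x.2.imp fun a ha => adj_apply_eq_zero_of_commute (hT a) ha⟩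
  map_add' x y := Subtype.ext (map_add T (x : H) y)
  map_smul' r x := Subtype.ext (map_smul T r (x : H))

/-- The composition of `φ` with an operator that commutes with all `V_a^*`. -/
noncomputable def compCommutant (φ : V.locallyBoundedDual) (T : H →L[ℂ] H)
    (hT : ∀ a, Commute T (V.adj a)) : V.locallyBoundedDual :=
  ⟨φ.1 ∘ₗ kerUnionMap T hT, fun a => by
    obtain ⟨C, hC⟩ := φ.2 a
    refine ⟨|C| * ‖T‖, fun x hx => ?_⟩
    refine (hC (kerUnionMap T hT x) (adj_apply_eq_zero_of_commute (hT a) hx)).trans ?_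
    rw [mul_assoc]
    exact mul_le_mul (le_abs_self C) (T.le_opNorm _) (norm_nonneg _) (abs_nonneg C)⟩

theorem shift_compCommutant {φ : V.locallyBoundedDual} {T : H →L[ℂ] H}
    (hT : ∀ a, Commute T (V.adj a)) (hT' : ∀ a, Commute T (V.op a)) {a : P} {k : ℂ}
    (hφ : V.shift a φ = k • φ) :
    V.shift a (compCommutant φ T hT) = k • compCommutant φ T hT := by
  refine Subtype.ext (LinearMap.ext fun x => ?_)
  have h1 : T (V a x) = V a (T x) := DFunLike.congr_fun (hT' a).eq (x : H)
  have h2 : φ.1 (V.onKerUnion a (kerUnionMap T hT x)) = k * φ.1 (kerUnionMap T hT x) :=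
    congrArg (fun ψ : V.locallyBoundedDual => ψ.1 (kerUnionMap T hT x)) hφ
  refine Eq.trans ?_ h2
  change φ.1 (kerUnionMap T hT (V.onKerUnion a x)) = _
  exact congrArg φ.1 (Subtype.ext h1)

/-- If `A_β(V)` is one-dimensional, then the vectors that represent a non-zero element are
eigenvectors of every operator in the commutant of `V`. -/
theorem exists_isConformalFamily [TopologicalSpace G] [IsTopologicalAddGroup G]
    {c : G →+ ℝ} {β : ℝ} {a₀ : P}
    (h₀ : IsOrderUnit P (a₀ : G)) (hconf : V.IsConformal c β)
    (hdim : Module.rank ℂ (V.eigenspace c β) = 1) :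
    ∃ s : P → H, IsConformalFamily V c β s ∧ s a₀ ≠ 0 ∧ (∀ a, V.adj a (s a) = 0) ∧
      ∀ T : H →L[ℂ] H, (∀ a, Commute T (V.adj a)) → (∀ a, Commute T (V.op a)) →
        ∃ k : ℂ, ∀ b, T (s b) = k • s b := by
  obtain ⟨φ, hφ0, hφ⟩ := hconf
  choose s hs hsφ using exists_representative φ
  have hfam := isConformalFamily_of_representative hφ hs hsφ
  -- If `s_{a₀}` vanished, so would every `s_{n a₀}` by the cocycle identity; since each `ker V_a^*`
  -- lies in some `ker V_{n a₀}^*`, the functional would be zero.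
  refine ⟨s, hfam, fun h0 => hφ0 ?_, hs, fun T hT hT' => ?_⟩
  · have h1 : ∀ n : ℕ, s (n • a₀) = 0 := by
      intro n
      induction n with
      | zero =>
        have := hs 0
        rw [V.adj_zero] at this
        rw [zero_smul]
        exact this
      | succ n ih =>
        rw [succ_nsmul', hfam.eq_add, h0, ih]
        simp
    refine Subtype.ext (LinearMap.ext fun x => ?_)
    obtain ⟨x, a, ha⟩ := x
    obtain ⟨n, hn, hna⟩ := h₀.2 a
    have h2 : n • a₀ = a + ⟨n • (a₀ : G) - a, interior_subset hna⟩ :=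
      Subtype.ext (add_sub_cancel (a : G) (n • (a₀ : G))).symm
    have h3 : V.adj (n • a₀) x = 0 := by rw [h2, adj_add, ha, map_zero]
    rw [hsφ (n • a₀) ⟨x, a, ha⟩ h3, h1, inner_zero_left]
    rfl
  · have hT1 : ∀ a, Commute (star T) (V.adj a) := fun a => by
      have := (hT' a).star_star
      rwa [V.star_op] at this
    have hT1' : ∀ a, Commute (star T) (V.op a) := fun a => by
      have := (hT a).star_star
      rwa [V.star_adj] at this
    have hfin : Module.finrank ℂ (V.eigenspace c β) = 1 := Module.finrank_eq_of_rank_eq hdim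
    let φ' : V.eigenspace c β := ⟨φ, hφ⟩
    have hφ' : φ' ≠ 0 := fun h => hφ0 (congrArg Subtype.val h)
    -- The functional `φ ∘ T^*` lies in the same line as `φ` and is represented by the vectors `T
    -- s_b`. The inner product is conjugate-linear in its first argument, hence the conjugate of `k`
    -- below.
    obtain ⟨k, hk⟩ := (finrank_eq_one_iff_of_nonzero' φ' hφ').1 hfin
      ⟨compCommutant φ (star T) hT1, fun a => shift_compCommutant hT1 hT1' (hφ a)⟩
    refine ⟨(starRingEnd ℂ) k, fun b => ?_⟩
    have hTb : V.adj b (T (s b)) = 0 := by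
      have h : V.adj b (T (s b)) = T (V.adj b (s b)) := (DFunLike.congr_fun (hT b).eq (s b)).symm
      rw [h, hs, map_zero]
    refine eq_of_forall_inner_eq hTb (by rw [map_smul, hs, smul_zero]) fun z hz => ?_
    have hz' : V.adj b (star T z) = 0 := by
      have h : V.adj b (star T z) = star T (V.adj b z) := (DFunLike.congr_fun (hT1 b).eq z).symm
      rw [h, hz, map_zero]
    have h1 : k * φ.1 ⟨z, b, hz⟩ = φ.1 ⟨star T z, b, hz'⟩ :=
      congrArg (fun ψ : V.eigenspace c β => ψ.1.1 ⟨z, b, hz⟩) hk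
    rw [hsφ b ⟨z, b, hz⟩ hz, hsφ b ⟨star T z, b, hz'⟩ hz'] at h1
    rw [inner_smul_left, Complex.conj_conj, h1]
    exact (ContinuousLinearMap.adjoint_inner_right T (s b) z).symm

/-- The set `-P` is a point of `Y_u`. If it were all of `G`, then `a₀` would be invertible in `P`,
so `V_{a₀}` would be unitary and its adjoint injective. -/
theorem nonempty_Yu [TopologicalSpace G] {a₀ : P} {x : H} (hx : x ≠ 0)
    (hx' : V.adj a₀ x = 0) [IsTopologicalAddGroup G] (hP : IsClosed (P : Set G)) :
    Nonempty (Yu P) := by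
  refine ⟨⟨⟨-(P : Set G), hP.neg⟩, fun p hp y hy => ?_, ?_, fun h => hx ?_⟩⟩
  · change -(-p + y) ∈ P
    rw [neg_add, neg_neg]
    exact P.add_mem hp hy
  · exact nonempty_iff_ne_empty.1 ⟨0, by simp⟩
  · have h1 : -(a₀ : G) ∈ P := by
      have : (a₀ : G) ∈ -(P : Set G) := (show -(P : Set G) = univ from h) ▸ mem_univ _
      exact this
    have h2 : V a₀ (V ⟨_, h1⟩ x) = x := by
      rw [← V.map_add']
      have : a₀ + ⟨_, h1⟩ = 0 := Subtype.ext (add_neg_cancel (a₀ : G))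
      rw [this, V.map_zero']
    rw [← h2, V.adj_apply] at hx'
    rw [← h2, hx', LinearIsometry.map_zero]

end IsometrySemigroup

end Riesz

/-! ### Ergodicity from the one-dimensional eigenspace -/

section Ergodic

variable {G : Type*} [AddCommGroup G] [TopologicalSpace G] {P : AddSubmonoid G}
  [IsTopologicalAddGroup G]
  {H : Type*} [NormedAddCommGroup H] [InnerProductSpace ℂ H] [CompleteSpace H]
  {V : IsometrySemigroup P H} {𝓔 : SpectralMeasure (Yu P) H} {c : G →+ ℝ} {β : ℝ} {s : P → H}
  (h𝓔 : IsCovariant V 𝓔) {a₀ : P}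

theorem eq_zero_or_one_of_isStarProjection {T : H →L[ℂ] H} (hT : IsStarProjection T) {x : H}
    (hx : x ≠ 0) {k : ℂ} (hk : T x = k • x) : k = 0 ∨ k = 1 := by
  have h1 : T (T x) = T x := DFunLike.congr_fun hT.isIdempotentElem.eq x
  rw [hk, map_smul, hk, smul_smul] at h1
  exact IsIdempotentElem.iff_eq_zero_or_one.1 (smul_left_injective ℂ hx h1)

include h𝓔

/-- For invariant `E`, the projection `𝓔(E)` commutes with `V`, hence acts on `s_{a₀}` as 0 or 1. So
it or its complement kills `s_{a₀}`, and by invariance every term of the series defining the measure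
of that set vanishes. -/
theorem IsConformalFamily.isErgodicMeasure
    (hs0 : s a₀ ≠ 0)
    (hcomm : ∀ T : H →L[ℂ] H, (∀ a, Commute T (V.adj a)) → (∀ a, Commute T (V.op a)) →
      ∃ k : ℂ, ∀ b, T (s b) = k • s b) :
    IsErgodicMeasure (measure 𝓔 c β s a₀) := by
  intro E hE hinv
  have hpre : ∀ t : G, Yu.translate t ⁻¹' E = E := fun t => by
    have h := Yu.preimage_translate_neg (-t) E
    rwa [neg_neg, hinv] at h
  have hop : ∀ a, Commute (𝓔.proj E) (V.op a) := fun a => by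
    have h := h𝓔.proj_mul_op a E hE
    rwa [hpre] at h
  have hadj : ∀ a, Commute (𝓔.proj E) (V.adj a) := fun a => by
    have h := (hop a).star_star
    rwa [V.star_op, (𝓔.isStarProjection hE).isSelfAdjoint.star_eq] at h
  obtain ⟨k, hk⟩ := hcomm _ hadj hop
  have key : ∀ S, MeasurableSet S → (∀ t : G, Yu.translate t ⁻¹' S = S) →
      𝓔.proj S (s a₀) = 0 → measure 𝓔 c β s a₀ S = 0 := by
    intro S hS hSpre h0
    rw [measure, extendMeasure_apply hS]
    refine ENNReal.tsum_eq_zero.2 fun n => ?_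
    rw [hSpre, 𝓔.dist_apply _ hS, h0]
    simp
  rcases eq_zero_or_one_of_isStarProjection (𝓔.isStarProjection hE) hs0 (hk a₀) with h | h
  · exact Or.inl (key E hE hpre (by rw [hk, h, zero_smul]))
  · refine Or.inr (key _ hE.compl (fun t => by rw [preimage_compl, hpre]) ?_)
    rw [𝓔.proj_compl hE, sub_apply, hk, h, one_smul]
    exact sub_self _

end Ergodic
end ConformalIsometries

namespace ConformalIsometries
open Set Filter Topology
open scoped InnerProductSpace

/-! ### The resolvent of a unitary group -/

section Resolvent

variable {H : Type*} [NormedAddCommGroup H] [InnerProductSpace ℂ H] {U : ℝ → H ≃ₗᵢ[ℂ] H}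

theorem continuous_exp_smul_flow (hcont : ∀ x : H, Continuous fun t : ℝ => U t x) (z : ℂ) (x : H) :
    Continuous fun t : ℝ => Complex.exp (-(z * t)) • U t x := by
  have := hcont x
  fun_prop

theorem norm_exp_smul_flow (z : ℂ) (x : H) (t : ℝ) :
    ‖Complex.exp (-(z * t)) • U t x‖ = Real.exp (-z.re * t) * ‖x‖ := by
  rw [norm_smul, LinearIsometryEquiv.norm_map, Complex.norm_exp]
  simp

theorem integrableOn_exp_smul_flow (hcont : ∀ x : H, Continuous fun t : ℝ => U t x) {z : ℂ}
    (hz : 0 < z.re) (x : H) (a : ℝ) :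
    IntegrableOn (fun t : ℝ => Complex.exp (-(z * t)) • U t x) (Ioi a) := by
  have h := (exp_neg_integrableOn_Ioi a hz).mul_const ‖x‖
  refine h.mono' (continuous_exp_smul_flow hcont z x).aestronglyMeasurable.restrict
    (ae_of_all _ fun t => (norm_exp_smul_flow z x t).le)

/-- The resolvent `∫₀^∞ e^{-zt} U_t dt` of a unitary group. -/
noncomputable def flowResolvent (U : ℝ → H ≃ₗᵢ[ℂ] H) (z : ℂ) (x : H) : H :=
  ∫ t in Ioi (0 : ℝ), Complex.exp (-(z * t)) • U t x

theorem exists_flowResolvent_eq (hcont : ∀ x : H, Continuous fun t : ℝ => U t x) {z : ℂ}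
    (hz : 0 < z.re) : ∃ R : H →L[ℂ] H, ∀ x, R x = flowResolvent U z x := by
  let R : H →ₗ[ℂ] H :=
    { toFun := flowResolvent U z
      map_add' := fun x y => by
        simp only [flowResolvent, map_add, smul_add]
        exact integral_add (integrableOn_exp_smul_flow hcont hz x 0)
          (integrableOn_exp_smul_flow hcont hz y 0)
      map_smul' := fun r x => by
        simp only [flowResolvent, map_smul, RingHom.id_apply]
        rw [← integral_smul]
        refine integral_congr_ae (ae_of_all _ fun t => ?_)
        exact smul_comm _ _ _ }
  refine ⟨R.mkContinuous (∫ t in Ioi (0 : ℝ), Real.exp (-z.re * t)) fun x => ?_, fun x => rfl⟩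
  refine (norm_integral_le_integral_norm _).trans ?_
  simp only [norm_exp_smul_flow]
  rw [integral_mul_const]

variable [CompleteSpace H]

omit [CompleteSpace H] in
theorem exp_smul_flow_flowResolvent (hadd : ∀ (s t : ℝ) (x : H), U (s + t) x = U s (U t x))
    (z : ℂ) (x : H) (s : ℝ) :
    Complex.exp (-(z * s)) • U s (flowResolvent U z x)
      = ∫ t in Ioi s, Complex.exp (-(z * t)) • U t x := by
  have h1 : U s (flowResolvent U z x)
      = ∫ t in Ioi (0 : ℝ), U s (Complex.exp (-(z * t)) • U t x) :=
    ((U s : H ≃L[ℂ] H).integral_comp_comm _).symm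
  rw [h1, ← integral_smul]
  have h2 := (measurePreserving_add_left volume s).setIntegral_preimage_emb
    (measurableEmbedding_addLeft s) (fun t : ℝ => Complex.exp (-(z * t)) • U t x) (Ioi s)
  rw [← h2]
  have h3 : (fun t => s + t) ⁻¹' Ioi s = Ioi (0 : ℝ) := by
    ext t
    simp
  rw [h3]
  refine integral_congr_ae (ae_of_all _ fun t => ?_)
  simp only
  rw [map_smul, ← hadd, smul_smul, ← Complex.exp_add]
  congr 2
  push_cast
  ring

/-- The function is the tail integral from `s` to infinity, so the fundamental theorem of calculus
applies, without reference to a generator. -/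
theorem hasDerivAt_exp_smul_flow_flowResolvent
    (hadd : ∀ (s t : ℝ) (x : H), U (s + t) x = U s (U t x))
    (hcont : ∀ x : H, Continuous fun t : ℝ => U t x) {z : ℂ} (hz : 0 < z.re) (x : H) (s : ℝ) :
    HasDerivAt (fun s : ℝ => Complex.exp (-(z * s)) • U s (flowResolvent U z x))
      (-(Complex.exp (-(z * s)) • U s x)) s := by
  have hc := continuous_exp_smul_flow hcont z x
  have h1 : (fun s : ℝ => Complex.exp (-(z * s)) • U s (flowResolvent U z x))
      = fun s : ℝ => flowResolvent U z x - ∫ t in (0 : ℝ)..s, Complex.exp (-(z * t)) • U t x := by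
    funext s
    rw [exp_smul_flow_flowResolvent hadd, eq_sub_iff_add_eq', flowResolvent]
    exact intervalIntegral.integral_interval_add_Ioi
      (integrableOn_exp_smul_flow hcont hz x 0) (integrableOn_exp_smul_flow hcont hz x s)
  rw [h1]
  exact (intervalIntegral.integral_hasDerivAt_right (hc.intervalIntegrable _ _)
    (hc.stronglyMeasurableAtFilter _ _) hc.continuousAt).const_sub _

omit [CompleteSpace H] in
theorem flow_zero (hadd : ∀ (s t : ℝ) (x : H), U (s + t) x = U s (U t x)) (x : H) :
    U 0 x = x := by
  have h := hadd 0 0 x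
  rw [add_zero] at h
  exact (U 0).injective h.symm

/-- The resolvent identity is obtained by integrating the derivative of `e^{-zs} U_s R_w x` over the
half-line; the function decays at infinity and equals `R_w x` at 0. -/
theorem flowResolvent_sub (hadd : ∀ (s t : ℝ) (x : H), U (s + t) x = U s (U t x))
    (hcont : ∀ x : H, Continuous fun t : ℝ => U t x) {z w : ℂ} (hz : 0 < z.re) (hw : 0 < w.re)
    (x : H) : flowResolvent U z x - flowResolvent U w x
      = (w - z) • flowResolvent U z (flowResolvent U w x) := by
  set y := flowResolvent U w x with hy
  have hderiv : ∀ s ∈ Ici (0 : ℝ), HasDerivAt (fun s : ℝ => Complex.exp (-(z * s)) • U s y)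
      ((w - z) • (Complex.exp (-(z * s)) • U s y) - Complex.exp (-(z * s)) • U s x) s := by
    intro s _
    have h1 := hasDerivAt_exp_smul_flow_flowResolvent hadd hcont hw x s
    have h2 : HasDerivAt (fun s : ℝ => Complex.exp ((w - z) * s))
        ((w - z) * Complex.exp ((w - z) * s)) s := by
      have h3 : HasDerivAt (fun s : ℝ => (w - z) * (s : ℂ)) (w - z) s := by
        simpa using (Complex.ofRealCLM.hasDerivAt (x := s)).const_mul (w - z)
      have h4 := h3.cexp
      rwa [mul_comm] at h4
    have h5 := h2.smul h1
    have hexp : ∀ t : ℝ, Complex.exp ((w - z) * t) * Complex.exp (-(w * t))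
        = Complex.exp (-(z * t)) := fun t => by
      rw [← Complex.exp_add]
      ring_nf
    convert h5 using 1
    · funext t
      simp only [Pi.smul_apply', smul_smul, hexp]
      rfl
    · rw [← hy, smul_neg, smul_smul, smul_smul, smul_smul, hexp, mul_assoc, hexp]
      abel
  have hint1 : IntegrableOn (fun s : ℝ => (w - z) • (Complex.exp (-(z * s)) • U s y)) (Ioi 0) :=
    (integrableOn_exp_smul_flow hcont hz y 0).smul (w - z)
  have hint2 := integrableOn_exp_smul_flow hcont hz x 0
  have hlim : Tendsto (fun s : ℝ => Complex.exp (-(z * s)) • U s y) atTop (𝓝 0) := by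
    rw [tendsto_zero_iff_norm_tendsto_zero]
    simp only [norm_exp_smul_flow]
    have h6 : Tendsto (fun s : ℝ => Real.exp (-z.re * s)) atTop (𝓝 0) := by
      refine Real.tendsto_exp_atBot.comp ?_
      exact tendsto_id.const_mul_atTop_of_neg (neg_neg_of_pos hz)
    simpa using h6.mul_const ‖y‖
  have h := integral_Ioi_of_hasDerivAt_of_tendsto' hderiv (hint1.sub hint2) hlim
  rw [integral_sub hint1 hint2, integral_smul] at h
  simp only [Complex.ofReal_zero, mul_zero, neg_zero, Complex.exp_zero, one_smul,
    flow_zero hadd, zero_sub] at h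
  change (w - z) • flowResolvent U z y - flowResolvent U z x = -y at h
  rw [sub_eq_iff_eq_add] at h
  rw [h]
  abel

theorem eq_zero_of_flowResolvent_eq_zero
    (hadd : ∀ (s t : ℝ) (x : H), U (s + t) x = U s (U t x))
    (hcont : ∀ x : H, Continuous fun t : ℝ => U t x) {z : ℂ} (hz : 0 < z.re) {x : H}
    (hx : flowResolvent U z x = 0) : x = 0 := by
  have h := hasDerivAt_exp_smul_flow_flowResolvent hadd hcont hz x 0
  simp only [hx, map_zero, smul_zero] at h
  have h1 := h.unique (hasDerivAt_const 0 0)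
  simpa [flow_zero hadd] using h1

/-- An operator that intertwines the flow up to the phase `e^{-itr}` shifts the spectral parameter
by `ir`. The case `r = 0` gives commutation, and `r = c(p)` gives the covariance under `V_p`. -/
theorem map_flowResolvent (hcont : ∀ x : H, Continuous fun t : ℝ => U t x) {z : ℂ}
    (hz : 0 < z.re) (T : H →L[ℂ] H) (r : ℝ)
    (hT : ∀ t x, T (U t x) = Complex.exp (-(Complex.I * (t * r : ℝ))) • U t (T x)) (x : H) :
    T (flowResolvent U z x) = flowResolvent U (z + Complex.I * r) (T x) := by
  rw [flowResolvent, ← T.integral_comp_comm (integrableOn_exp_smul_flow hcont hz x 0),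
    flowResolvent]
  refine integral_congr_ae (ae_of_all _ fun t => ?_)
  simp only
  rw [map_smul, hT, smul_smul, ← Complex.exp_add]
  congr 2
  push_cast
  ring

end Resolvent

/-! ### Unitary groups that scale an isometric representation -/

section Flow

variable {G : Type*} [AddCommGroup G] {P : AddSubmonoid G}
  {H : Type*} [NormedAddCommGroup H] [InnerProductSpace ℂ H] [CompleteSpace H]
  {V : IsometrySemigroup P H} {U : ℝ → H ≃ₗᵢ[ℂ] H} {c : G →+ ℝ}

omit [CompleteSpace H] in
theorem flow_op (hUV : ∀ (a : P) (t : ℝ) (x : H),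
      U t (V a ((U t).symm x)) = Complex.exp (Complex.I * (t * c a : ℝ)) • V a x)
    (a : P) (t : ℝ) (x : H) :
    U t (V a x) = Complex.exp (Complex.I * (t * c a : ℝ)) • V a (U t x) := by
  rw [← hUV, LinearIsometryEquiv.symm_apply_apply]

omit [CompleteSpace H] in
theorem op_flow (hUV : ∀ (a : P) (t : ℝ) (x : H),
      U t (V a ((U t).symm x)) = Complex.exp (Complex.I * (t * c a : ℝ)) • V a x)
    (a : P) (t : ℝ) (x : H) :
    V a (U t x) = Complex.exp (-(Complex.I * (t * c a : ℝ))) • U t (V a x) := by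
  rw [flow_op hUV, smul_smul, ← Complex.exp_add, neg_add_cancel, Complex.exp_zero, one_smul]

theorem flow_adj (hUV : ∀ (a : P) (t : ℝ) (x : H),
      U t (V a ((U t).symm x)) = Complex.exp (Complex.I * (t * c a : ℝ)) • V a x)
    (a : P) (t : ℝ) (x : H) :
    U t (V.adj a x) = Complex.exp (-(Complex.I * (t * c a : ℝ))) • V.adj a (U t x) := by
  refine ext_inner_right ℂ fun y => ?_
  have h1 : V a ((U t).symm y)
      = Complex.exp (Complex.I * (t * c a : ℝ)) • (U t).symm (V a y) := by
    rw [← map_smul, ← hUV, LinearIsometryEquiv.symm_apply_apply]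
  rw [LinearIsometryEquiv.inner_map_eq_flip, IsometrySemigroup.inner_adj_left, h1,
    inner_smul_right, inner_smul_left, IsometrySemigroup.inner_adj_left,
    LinearIsometryEquiv.inner_map_eq_flip, ← Complex.exp_conj]
  congr 2
  simp

omit [CompleteSpace H] in
-- `U_t` is the `n`-fold iterate of `U_{t/n}`, and `t/n` is small for large `n`.
theorem flow_mem_of_forall_small (hadd : ∀ (s t : ℝ) (x : H), U (s + t) x = U s (U t x))
    (K : Submodule ℂ H) {δ : ℝ} (hδ : 0 < δ) (h : ∀ t, |t| < δ → ∀ x ∈ K, U t x ∈ K) (t : ℝ)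
    {x : H} (hx : x ∈ K) : U t x ∈ K := by
  obtain ⟨n, hn⟩ := exists_nat_gt (|t| / δ)
  have hn0 : (0 : ℝ) < n := lt_of_le_of_lt (by positivity) hn
  have hsmall : |t / n| < δ := by
    rw [abs_div, Nat.abs_cast, div_lt_iff₀ hn0]
    rwa [div_lt_iff₀ hδ, mul_comm] at hn
  have key : ∀ m : ℕ, U (m * (t / n)) x ∈ K := by
    intro m
    induction m with
    | zero =>
      rw [Nat.cast_zero, zero_mul, flow_zero hadd]
      exact hx
    | succ m ih =>
      rw [Nat.cast_succ, add_mul, one_mul, add_comm, hadd]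
      exact h _ hsmall _ ih
  have h1 := key n
  rwa [mul_div_cancel₀ _ hn0.ne'] at h1

end Flow
end ConformalIsometries

namespace ConformalIsometries
open Set Filter Topology
open scoped InnerProductSpace

/-! ### Local operators on `L²(X_u, μ)` -/

section Local

variable {G : Type*} [AddCommGroup G] [TopologicalSpace G] {P : AddSubmonoid G}
  [IsTopologicalAddGroup G] {μ : Measure (Yu P)}

omit [IsTopologicalAddGroup G] in
theorem L2Xu.ext_ae {f g : L2Xu μ} (h : (f : Lp ℂ 2 μ) =ᵐ[μ] (g : Lp ℂ 2 μ)) : f = g :=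
  Subtype.ext (Lp.ext h)

/-- An operator on `L²(X_u, μ)` is local if it commutes with the multiplication by indicator
functions. -/
def IsLocalOperator (R : L2Xu μ →L[ℂ] L2Xu μ) : Prop :=
  ∀ (S : Set (Yu P)), MeasurableSet S → ∀ f g : L2Xu μ,
    (g : Lp ℂ 2 μ) =ᵐ[μ] S.indicator (f : Lp ℂ 2 μ) →
      (R g : Lp ℂ 2 μ) =ᵐ[μ] S.indicator (R f : Lp ℂ 2 μ)

omit [IsTopologicalAddGroup G] in
/-- Multiplication by `h` maps `f` to `R f`, for all `f` in a closed subspace. -/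
theorem isClosed_setOf_ae_eq_mul (R : L2Xu μ →L[ℂ] L2Xu μ) (h : Yu P → ℂ) :
    IsClosed {f : L2Xu μ | ∀ᵐ A ∂μ, A ∈ Xu P → (R f : Lp ℂ 2 μ) A = h A * (f : Lp ℂ 2 μ) A} := by
  refine IsSeqClosed.isClosed fun u f hu hf => ?_
  have hf1 : Tendsto (fun n => (u n : Lp ℂ 2 μ)) atTop (𝓝 (f : Lp ℂ 2 μ)) :=
    (continuous_subtype_val.tendsto f).comp hf
  obtain ⟨ns, hns, hae⟩ := (tendstoInMeasure_of_tendsto_Lp hf1).exists_seq_tendsto_ae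
  have hf2 : Tendsto (fun n => (R (u (ns n)) : Lp ℂ 2 μ)) atTop (𝓝 (R f : Lp ℂ 2 μ)) :=
    ((continuous_subtype_val.comp R.continuous).tendsto f).comp (hf.comp hns.tendsto_atTop)
  obtain ⟨ms, hms, hae'⟩ := (tendstoInMeasure_of_tendsto_Lp hf2).exists_seq_tendsto_ae
  filter_upwards [hae, hae', ae_all_iff.2 hu] with A h1 h2 h3 hA
  refine tendsto_nhds_unique h2 ?_
  simp only [h3 _ hA]
  exact (h1.comp hms.tendsto_atTop).const_mul (h A)

omit [IsTopologicalAddGroup G] in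
theorem slab_subset_window (a₀ : P) (n : ℕ) :
    slab P (a₀ : G) n ⊆ window P (((n + 1) • a₀ : P) : G) := by
  refine fun A hA => ⟨?_, fun h => hA.2 ?_⟩
  · have h := zsmul_mem_of_le a₀.2 (Int.natCast_nonneg n) hA.1
    rwa [zero_zsmul] at h
  · have h1 : ((n : ℤ) + 1) • (a₀ : G) = (n + 1) • (a₀ : G) := by
      rw [← Nat.cast_succ, natCast_zsmul]
    rw [h1]
    exact h

omit [IsTopologicalAddGroup G] in
theorem IsOrderUnit.exists_mem_slab {a₀ : P} (h₀ : IsOrderUnit P (a₀ : G)) {A : Yu P}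
    (hA : A ∈ Xu P) : ∃ n : ℕ, A ∈ slab P (a₀ : G) n := by
  obtain ⟨n, hn⟩ := mem_iUnion.1 ((iUnion_slab h₀).symm ▸ mem_univ A)
  rcases lt_or_ge n 0 with h | h
  · refine absurd (zsmul_mem_of_le h₀.mem (show n + 1 ≤ 0 by omega) ?_) hn.2
    rw [zero_zsmul]
    exact hA
  · obtain ⟨k, rfl⟩ := Int.eq_ofNat_of_zero_le h
    exact ⟨k, hn⟩

omit [IsTopologicalAddGroup G] in
/-- A local operator is the multiplication by a function. -/
theorem IsLocalOperator.exists_multiplier {a₀ : P} (h₀ : IsOrderUnit P (a₀ : G))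
    (hμ : ∀ b : P, μ (window P (b : G)) ≠ ∞) {R : L2Xu μ →L[ℂ] L2Xu μ} (hR : IsLocalOperator R) :
    ∃ h : Yu P → ℂ, Measurable h ∧ ∀ f : L2Xu μ,
      ∀ᵐ A ∂μ, A ∈ Xu P → (R f : Lp ℂ 2 μ) A = h A * (f : Lp ℂ 2 μ) A := by
  have hsub : ∀ n : ℕ, slab P (a₀ : G) n ⊆ window P (((n + 1) • a₀ : P) : G) :=
    slab_subset_window a₀
  let e : ℕ → L2Xu μ := fun n => L2Xu.indicator (measurableSet_slab (a₀ : G) n)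
    ((hsub n).trans (window_subset_Xu _)) (measure_ne_top_of_subset (hsub n) (hμ _))
  -- The constant 1 need not be in `L²`, so the multiplier is read off slab by slab as the image of
  -- the indicator of the slab.
  obtain ⟨h, hh, hhe⟩ := exists_measurable_piecewise (fun n : ℕ => slab P (a₀ : G) n)
    (fun n => measurableSet_slab _ _) (fun n => ((R (e n) : Lp ℂ 2 μ) : Yu P → ℂ))
    (fun n => (Lp.stronglyMeasurable _).measurable) (fun n m hnm => by
      have h := (disjoint_slab h₀.mem (show (n : ℤ) ≠ m by exact_mod_cast hnm)).inter_eq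
      change EqOn _ _ (slab P (a₀ : G) n ∩ slab P (a₀ : G) m)
      rw [h]
      exact eqOn_empty _ _)
  refine ⟨h, hh, ?_⟩
  let C : Submodule ℂ (L2Xu μ) :=
    { carrier := {f | ∀ᵐ A ∂μ, A ∈ Xu P → (R f : Lp ℂ 2 μ) A = h A * (f : Lp ℂ 2 μ) A}
      zero_mem' := by
        filter_upwards [Lp.coeFn_zero ℂ 2 μ] with A hA _
        rw [map_zero, Submodule.coe_zero, hA, Pi.zero_apply, mul_zero]
      add_mem' := by
        intro f g hf hg
        filter_upwards [hf, hg, Lp.coeFn_add (f : Lp ℂ 2 μ) g,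
          Lp.coeFn_add (R f : Lp ℂ 2 μ) (R g : Lp ℂ 2 μ)] with A h1 h2 h3 h4 hA
        rw [map_add, Submodule.coe_add, Submodule.coe_add, h3, h4, Pi.add_apply, Pi.add_apply,
          h1 hA, h2 hA, mul_add]
      smul_mem' := by
        intro r f hf
        filter_upwards [hf, Lp.coeFn_smul r (f : Lp ℂ 2 μ),
          Lp.coeFn_smul r (R f : Lp ℂ 2 μ)] with A h1 h2 h3 hA
        rw [map_smul, Submodule.coe_smul, Submodule.coe_smul, h2, h3, Pi.smul_apply, Pi.smul_apply,
          h1 hA, smul_eq_mul, smul_eq_mul, mul_left_comm] }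
  have hC : IsClosed (C : Set (L2Xu μ)) := isClosed_setOf_ae_eq_mul R h
  refine fun f => L2Xu.induction_closed h₀ hμ C hC (fun S b hS hSb => ?_) f
  set v := L2Xu.indicator hS (hSb.trans (window_subset_Xu _))
    (measure_ne_top_of_subset hSb (hμ b)) with hv
  have hvS := L2Xu.indicator_coeFn hS (hSb.trans (window_subset_Xu _))
    (measure_ne_top_of_subset hSb (hμ b))
  -- Locality is applied twice to the indicator of `S ∩ slab n`, seen once as a restriction of `1_S`
  -- and once as a restriction of the indicator of the slab.
  have hloc : ∀ n : ℕ, ∀ᵐ A ∂μ, (slab P (a₀ : G) n).indicator (R v : Lp ℂ 2 μ) A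
      = S.indicator (R (e n) : Lp ℂ 2 μ) A := by
    intro n
    have hSn := hS.inter (measurableSet_slab (P := P) (a₀ : G) n)
    set w : L2Xu μ := L2Xu.indicator hSn
      ((inter_subset_left.trans hSb).trans (window_subset_Xu _))
      (measure_ne_top_of_subset (inter_subset_left.trans hSb) (hμ b)) with hw
    have hwS := L2Xu.indicator_coeFn hSn ((inter_subset_left.trans hSb).trans (window_subset_Xu _))
      (measure_ne_top_of_subset (inter_subset_left.trans hSb) (hμ b))
    have hen := L2Xu.indicator_coeFn (measurableSet_slab (a₀ : G) n)
      ((hsub n).trans (window_subset_Xu _)) (measure_ne_top_of_subset (hsub n) (hμ _))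
    have h1 := hR _ (measurableSet_slab (a₀ : G) n) v w (by
      filter_upwards [hvS, hwS] with A h2 h3
      by_cases hA : A ∈ slab P (a₀ : G) n
      · rw [h3, indicator_of_mem hA, h2]
        by_cases hA' : A ∈ S
        · rw [indicator_of_mem hA',
            indicator_of_mem (show A ∈ S ∩ slab P (a₀ : G) n from ⟨hA', hA⟩)]
        · rw [indicator_of_notMem hA', indicator_of_notMem fun h => hA' h.1]
      · rw [h3, indicator_of_notMem hA, indicator_of_notMem fun h => hA h.2])
    have h2 := hR _ hS (e n) w (by
      filter_upwards [hen, hwS] with A h2 h3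
      by_cases hA' : A ∈ S
      · rw [h3, indicator_of_mem hA', h2]
        by_cases hA : A ∈ slab P (a₀ : G) n
        · rw [indicator_of_mem hA,
            indicator_of_mem (show A ∈ S ∩ slab P (a₀ : G) n from ⟨hA', hA⟩)]
        · rw [indicator_of_notMem hA, indicator_of_notMem fun h => hA h.2]
      · rw [h3, indicator_of_notMem hA', indicator_of_notMem fun h => hA' h.1])
    exact h1.symm.trans h2
  change ∀ᵐ A ∂μ, A ∈ Xu P → (R v : Lp ℂ 2 μ) A = h A * (v : Lp ℂ 2 μ) A
  filter_upwards [ae_all_iff.2 hloc, hvS] with A h1 h2 hA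
  obtain ⟨n, hn⟩ := h₀.exists_mem_slab hA
  have h3 := h1 n
  rw [indicator_of_mem hn] at h3
  rw [h3, h2, hhe n hn]
  by_cases hA' : A ∈ S
  · rw [indicator_of_mem hA', indicator_of_mem hA', mul_one]
  · rw [indicator_of_notMem hA', indicator_of_notMem hA', mul_zero]

end Local

section Embedding

variable {G : Type*} [AddCommGroup G] [TopologicalSpace G] {P : AddSubmonoid G}
  [IsTopologicalAddGroup G]
  {H : Type*} [NormedAddCommGroup H] [InnerProductSpace ℂ H] [CompleteSpace H]

namespace IsConformalFamily

variable {V : IsometrySemigroup P H} {𝓔 : SpectralMeasure (Yu P) H} {c : G →+ ℝ} {β : ℝ}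
  {s : P → H} (hs : IsConformalFamily V c β s) (h𝓔 : IsCovariant V 𝓔)
  {a₀ : P} (h₀ : IsOrderUnit P (a₀ : G))
  {Φ : L2Xu (measure 𝓔 c β s a₀) →ₗᵢ[ℂ] H}
    (hΦ : ∀ (S : Set (Yu P)) (b : P) (hS : MeasurableSet S) (hSX : S ⊆ Xu P)
      (hμS : measure 𝓔 c β s a₀ S ≠ ∞), S ⊆ window P (b : G) →
      Φ (L2Xu.indicator hS hSX hμS) = 𝓔.proj S (s b))
include hs h𝓔 h₀ hΦ

theorem proj_embedding_mem_range {S : Set (Yu P)} (hS : MeasurableSet S)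
    (f : L2Xu (measure 𝓔 c β s a₀)) : 𝓔.proj S (Φ f) ∈ LinearMap.range Φ.toLinearMap := by
  have hclosed : IsClosed (LinearMap.range Φ.toLinearMap : Set H) :=
    Φ.isometry.isClosedEmbedding.isClosed_range
  refine L2Xu.induction_closed h₀ (hs.measure_window_ne_top h𝓔 h₀)
    ((LinearMap.range Φ.toLinearMap).comap
      (𝓔.proj S ∘L Φ.toContinuousLinearMap : _ →L[ℂ] H).toLinearMap)
    (hclosed.preimage (𝓔.proj S ∘L Φ.toContinuousLinearMap).continuous) (fun T b hT hTb => ?_) f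
  change 𝓔.proj S (Φ _) ∈ LinearMap.range Φ.toLinearMap
  have hsub : S ∩ T ⊆ window P (b : G) := inter_subset_right.trans hTb
  rw [hΦ _ b _ _ _ hTb, ← mul_apply_eq_comp, ← 𝓔.proj_inter hS hT]
  exact ⟨_, hΦ _ b (hS.inter hT) (hsub.trans (window_subset_Xu _))
    (measure_ne_top_of_subset hsub (hs.measure_window_ne_top h𝓔 h₀ b)) hsub⟩

/-- Under `Φ`, the projection `𝓔(S)` becomes multiplication by `1_S`: the two agree when paired with
indicators of subsets of windows. -/
theorem ae_eq_indicator_of_map_eq {S : Set (Yu P)} (hS : MeasurableSet S)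
    {f g : L2Xu (measure 𝓔 c β s a₀)} (hfg : Φ g = 𝓔.proj S (Φ f)) :
    (g : Lp ℂ 2 (measure 𝓔 c β s a₀)) =ᵐ[measure 𝓔 c β s a₀]
      S.indicator (f : Lp ℂ 2 (measure 𝓔 c β s a₀)) := by
  have hwin := hs.measure_window_ne_top h𝓔 h₀
  let fS : Lp ℂ 2 (measure 𝓔 c β s a₀) := ((Lp.memLp (f : Lp ℂ 2 (measure 𝓔 c β s a₀))).indicator hS).toLp _
  have hfS : fS =ᵐ[measure 𝓔 c β s a₀] S.indicator (f : Lp ℂ 2 (measure 𝓔 c β s a₀)) := MemLp.coeFn_toLp _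
  have h1 : ∀ᵐ A ∂(measure 𝓔 c β s a₀), A ∈ Xu P → ((g : Lp ℂ 2 (measure 𝓔 c β s a₀)) - fS) A = 0 := by
    refine ae_eq_zero_of_forall_setIntegral_window h₀ hwin _ fun T b hT hTb => ?_
    have hTfin := measure_ne_top_of_subset hTb (hwin b)
    have hsub : S ∩ T ⊆ window P (b : G) := inter_subset_right.trans hTb
    have hSTfin := measure_ne_top_of_subset hsub (hwin b)
    rw [← L2.inner_indicatorConstLp_one (𝕜 := ℂ) hT hTfin, inner_sub_right, sub_eq_zero]
    have h2 : ⟪(L2Xu.indicator hT (hTb.trans (window_subset_Xu _)) hTfin : L2Xu (measure 𝓔 c β s a₀)), g⟫_ℂ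
        = ⟪(L2Xu.indicator (hS.inter hT) (hsub.trans (window_subset_Xu _)) hSTfin : L2Xu (measure 𝓔 c β s a₀)),
          f⟫_ℂ := by
      rw [← Φ.inner_map_map, ← Φ.inner_map_map, hfg, hΦ _ b _ _ _ hTb, hΦ _ b _ _ _ hsub,
        𝓔.proj_inter hS hT, mul_apply_eq_comp, (𝓔.isStarProjection hS).inner_apply_left]
    rw [Submodule.coe_inner, Submodule.coe_inner] at h2
    refine h2.trans ?_
    change ⟪indicatorConstLp 2 (hS.inter hT) hSTfin (1 : ℂ), _⟫_ℂ = _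
    rw [L2.inner_indicatorConstLp_one, L2.inner_indicatorConstLp_one,
      setIntegral_congr_ae (g := S.indicator (f : Lp ℂ 2 (measure 𝓔 c β s a₀))) hT (hfS.mono fun A hA _ => hA),
      setIntegral_indicator hS, inter_comm]
  filter_upwards [h1, hfS, f.2, g.2, Lp.coeFn_sub (g : Lp ℂ 2 (measure 𝓔 c β s a₀)) fS] with A h2 h3 h4 h5 h6
  rw [← h3]
  by_cases hA : A ∈ Xu P
  · have h7 := h2 hA
    rw [h6, Pi.sub_apply, sub_eq_zero] at h7
    exact h7
  · rw [h5 hA, h3]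
    by_cases hAS : A ∈ S
    · rw [indicator_of_mem hAS, h4 hA]
    · rw [indicator_of_notMem hAS]

theorem map_eq_proj_of_ae_eq {S : Set (Yu P)} (hS : MeasurableSet S)
    {f g : L2Xu (measure 𝓔 c β s a₀)}
    (hfg : (g : Lp ℂ 2 (measure 𝓔 c β s a₀)) =ᵐ[measure 𝓔 c β s a₀]
      S.indicator (f : Lp ℂ 2 (measure 𝓔 c β s a₀))) : Φ g = 𝓔.proj S (Φ f) := by
  obtain ⟨g', hg'⟩ := hs.proj_embedding_mem_range h𝓔 h₀ hΦ hS f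
  have h := hs.ae_eq_indicator_of_map_eq h𝓔 h₀ hΦ hS hg'
  rw [L2Xu.ext_ae (hfg.trans h.symm)]
  exact hg'

/-- The compression to `L²(X_u, μ)` of an operator that commutes with the spectral measure. -/
theorem exists_isLocalOperator {T : H →L[ℂ] H}
    (hT : ∀ f, T (Φ f) ∈ LinearMap.range Φ.toLinearMap)
    (hcomm : ∀ S, MeasurableSet S → Commute T (𝓔.proj S)) :
    ∃ R : L2Xu (measure 𝓔 c β s a₀) →L[ℂ] L2Xu (measure 𝓔 c β s a₀),
      IsLocalOperator R ∧ ∀ f, Φ (R f) = T (Φ f) := by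
  let R : L2Xu (measure 𝓔 c β s a₀) →L[ℂ] L2Xu (measure 𝓔 c β s a₀) :=
    Φ.equivRange.symm.toContinuousLinearEquiv.toContinuousLinearMap ∘L
      (T ∘L Φ.toContinuousLinearMap).codRestrict (LinearMap.range Φ.toLinearMap) hT
  have hR : ∀ f, Φ (R f) = T (Φ f) := fun f => by
    have h := Φ.equivRange.apply_symm_apply ⟨T (Φ f), hT f⟩
    exact congrArg Subtype.val h
  refine ⟨R, fun S hS f g hfg => ?_, hR⟩
  refine hs.ae_eq_indicator_of_map_eq h𝓔 h₀ hΦ hS ?_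
  rw [hR, hR, hs.map_eq_proj_of_ae_eq h𝓔 h₀ hΦ hS hfg]
  exact DFunLike.congr_fun (hcomm S hS).eq _

end IsConformalFamily
end Embedding
end ConformalIsometries

namespace ConformalIsometries
open Set Filter Topology
open scoped InnerProductSpace

/-! ### Invariance of the summand under the flow -/

section Projection

variable {H : Type*} [NormedAddCommGroup H] [InnerProductSpace ℂ H] [CompleteSpace H]

theorem commute_starProjection {K : Submodule ℂ H} [K.HasOrthogonalProjection] {T : H →L[ℂ] H}
    (h : ∀ x ∈ K, T x ∈ K) (h' : ∀ x ∈ K, star T x ∈ K) : Commute K.starProjection T := by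
  refine ContinuousLinearMap.ext fun x => ?_
  refine (Submodule.eq_starProjection_of_mem_of_inner_eq_zero
    (h _ (K.starProjection_apply_mem x)) fun w hw => ?_)
  change ⟪T x - T (K.starProjection x), w⟫_ℂ = 0
  rw [← map_sub, ← ContinuousLinearMap.adjoint_inner_right]
  exact Submodule.starProjection_inner_eq_zero _ _ (h' w hw)

end Projection

section Embedding

variable {G : Type*} [AddCommGroup G] [TopologicalSpace G] {P : AddSubmonoid G}
  [IsTopologicalAddGroup G]
  {H : Type*} [NormedAddCommGroup H] [InnerProductSpace ℂ H] [CompleteSpace H]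
  {V : IsometrySemigroup P H} {𝓔 : SpectralMeasure (Yu P) H} {c : G →+ ℝ} {β : ℝ}
  {U : ℝ → H ≃ₗᵢ[ℂ] H}

/-- In `V_b^* V_a V_a^* V_b` each phase `e^{itc}` meets its inverse, so `U_t` commutes with the
projections that determine `𝓔`. -/
theorem IsCovariant.proj_flow (h𝓔 : IsCovariant V 𝓔)
    (hUV : ∀ (a : P) (t : ℝ) (x : H),
      U t (V a ((U t).symm x)) = Complex.exp (Complex.I * (t * c a : ℝ)) • V a x)
    {S : Set (Yu P)} (hS : MeasurableSet S) (t : ℝ) (x : H) :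
    𝓔.proj S (U t x) = U t (𝓔.proj S x) := by
  have hexp : ∀ r : ℝ, Complex.exp (-(Complex.I * r)) * Complex.exp (Complex.I * r) = 1 :=
    fun r => by rw [← Complex.exp_add, neg_add_cancel, Complex.exp_zero]
  have h : Commute ((U t : H ≃L[ℂ] H) : H →L[ℂ] H) (𝓔.proj S) := by
    refine h𝓔.commute_of_forall _ (fun a b => ContinuousLinearMap.ext fun y => ?_) S hS
    change U t (V.adj b (V a (V.adj a (V b y)))) = V.adj b (V a (V.adj a (V b (U t y))))
    rw [flow_adj hUV, flow_op hUV, flow_adj hUV, flow_op hUV]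
    simp only [map_smul, smul_smul]
    rw [← mul_assoc (Complex.exp (Complex.I * (t * c a : ℝ))),
      mul_comm (Complex.exp (Complex.I * (t * c a : ℝ))), hexp, one_mul, hexp, one_smul]
  exact (DFunLike.congr_fun h.eq x).symm

namespace IsConformalFamily

variable {s : P → H} (hs : IsConformalFamily V c β s) (h𝓔 : IsCovariant V 𝓔)
  {a₀ : P} (h₀ : IsOrderUnit P (a₀ : G))
  {Φ : L2Xu (measure 𝓔 c β s a₀) →ₗᵢ[ℂ] H}
    (hΦ : ∀ (S : Set (Yu P)) (b : P) (hS : MeasurableSet S) (hSX : S ⊆ Xu P)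
      (hμS : measure 𝓔 c β s a₀ S ≠ ∞), S ⊆ window P (b : G) →
      Φ (L2Xu.indicator hS hSX hμS) = 𝓔.proj S (s b))
include hs h𝓔 h₀ hΦ

theorem mem_range_embedding (b : P) : s b ∈ LinearMap.range Φ.toLinearMap := by
  refine ⟨L2Xu.indicator (measurableSet_window (b : G)) (window_subset_Xu _)
    (hs.measure_window_ne_top h𝓔 h₀ b), ?_⟩
  rw [← hs.proj_window_self h𝓔 b]
  exact hΦ _ b _ _ _ subset_rfl

/-- Let `Q` be the projection onto the range `K` of `Φ`. Since `K` is reducing, `Q` and `U_t^* Q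
U_t` are projections in the commutant of `V`, and the latter acts on all `s_b` by one scalar, 0 or
1. For small `t` it is 1, so `U_t s_b ∈ K`; as `U_t` commutes with `𝓔`, all generators `𝓔(S) s_b` of
`K` are carried into `K`. -/
theorem flow_embedding_mem_range (hμ : IsConformalMeasure c β (measure 𝓔 c β s a₀))
    (hs0 : s a₀ ≠ 0)
    (hcomm : ∀ T : H →L[ℂ] H, (∀ a, Commute T (V.adj a)) → (∀ a, Commute T (V.op a)) →
      ∃ k : ℂ, ∀ b, T (s b) = k • s b)
    (hadd : ∀ (s t : ℝ) (x : H), U (s + t) x = U s (U t x))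
    (hcont : ∀ x : H, Continuous fun t : ℝ => U t x)
    (hUV : ∀ (a : P) (t : ℝ) (x : H),
      U t (V a ((U t).symm x)) = Complex.exp (Complex.I * (t * c a : ℝ)) • V a x) (t : ℝ)
    {x : H} (hx : x ∈ LinearMap.range Φ.toLinearMap) :
    U t x ∈ LinearMap.range Φ.toLinearMap := by
  set K := LinearMap.range Φ.toLinearMap with hK
  have hclosed : IsClosed (K : Set H) := Φ.isometry.isClosedEmbedding.isClosed_range
  have : CompleteSpace K := hclosed.completeSpace_coe
  have hVK : ∀ a, ∀ x ∈ K, V.op a x ∈ K := by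
    rintro a _ ⟨f, rfl⟩
    exact ⟨conformalRep hμ a f, hs.embedding_conformalRep h𝓔 h₀ hμ hΦ a f⟩
  have hVK' : ∀ a, ∀ x ∈ K, V.adj a x ∈ K := by
    rintro a _ ⟨f, rfl⟩
    exact hs.adj_embedding_mem_range h𝓔 h₀ hΦ a f
  have hQ : ∀ a, Commute K.starProjection (V.op a) := fun a =>
    commute_starProjection (hVK a) (hVK' a)
  have hQ' : ∀ a, Commute K.starProjection (V.adj a) := fun a =>
    commute_starProjection (hVK' a) (by rw [V.star_adj]; exact hVK a)
  let T : ℝ → H →L[ℂ] H := fun t => ((U t).symm : H ≃L[ℂ] H).toContinuousLinearMap ∘L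
    K.starProjection ∘L (U t : H ≃L[ℂ] H).toContinuousLinearMap
  have hTapp : ∀ t x, T t x = (U t).symm (K.starProjection (U t x)) := fun t x => rfl
  have hTop : ∀ t a, Commute (T t) (V.op a) := fun t a => by
    refine ContinuousLinearMap.ext fun x => ?_
    change (U t).symm (K.starProjection (U t (V a x)))
      = V a ((U t).symm (K.starProjection (U t x)))
    rw [LinearIsometryEquiv.symm_apply_eq, flow_op hUV, flow_op hUV,
      LinearIsometryEquiv.apply_symm_apply, map_smul]
    congr 1
    exact DFunLike.congr_fun (hQ a).eq _
  have hTadj : ∀ t a, Commute (T t) (V.adj a) := fun t a => by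
    refine ContinuousLinearMap.ext fun x => ?_
    change (U t).symm (K.starProjection (U t (V.adj a x)))
      = V.adj a ((U t).symm (K.starProjection (U t x)))
    rw [LinearIsometryEquiv.symm_apply_eq, flow_adj hUV, flow_adj hUV,
      LinearIsometryEquiv.apply_symm_apply, map_smul]
    congr 1
    exact DFunLike.congr_fun (hQ' a).eq _
  have hTT : ∀ t x, T t (T t x) = T t x := fun t x => by
    rw [hTapp, hTapp, LinearIsometryEquiv.apply_symm_apply]
    congr 1
    exact DFunLike.congr_fun (K.isIdempotentElem_starProjection).eq _
  have hlim : Tendsto (fun t => K.starProjection (U t (s a₀))) (𝓝 0) (𝓝 (s a₀)) := by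
    have h1 := (K.starProjection.continuous.comp (hcont (s a₀))).tendsto 0
    have h2 : K.starProjection (s a₀) = s a₀ :=
      Submodule.starProjection_eq_self_iff.2 (hs.mem_range_embedding h𝓔 h₀ hΦ a₀)
    simp only [Function.comp_apply, flow_zero hadd, h2] at h1
    exact h1
  -- As `t → 0`, `Q U_t s_{a₀}` tends to the nonzero vector `s_{a₀}`; this excludes the eigenvalue 0
  -- for `|t| < δ`.
  obtain ⟨δ, hδ, hδ0⟩ := Metric.eventually_nhds_iff.1 (hlim.eventually_ne hs0)
  refine flow_mem_of_forall_small hadd K hδ (fun t ht x hx => ?_) t hx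
  obtain ⟨k, hk⟩ := hcomm (T t) (hTadj t) (hTop t)
  have hk1 : k = 1 := by
    have h1 := hTT t (s a₀)
    rw [hk, map_smul, hk, smul_smul] at h1
    rcases IsIdempotentElem.iff_eq_zero_or_one.1 (smul_left_injective ℂ hs0 h1) with h | h
    · refine absurd ?_ (hδ0 (y := t) (by simpa using ht))
      have h2 := hk a₀
      rw [h, zero_smul, hTapp, LinearIsometryEquiv.symm_apply_eq, map_zero] at h2
      exact h2
    · exact h
  have hmem : ∀ b, U t (s b) ∈ K := fun b => by
    have h1 := hk b
    rw [hk1, one_smul, hTapp, LinearIsometryEquiv.symm_apply_eq] at h1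
    rw [← h1]
    exact K.starProjection_apply_mem _
  obtain ⟨f, rfl⟩ := hx
  refine L2Xu.induction_closed h₀ (hs.measure_window_ne_top h𝓔 h₀)
    (K.comap ((U t : H ≃L[ℂ] H).toContinuousLinearMap ∘L
      Φ.toContinuousLinearMap : _ →L[ℂ] H).toLinearMap)
    (hclosed.preimage ((U t : H ≃L[ℂ] H).toContinuousLinearMap ∘L
      Φ.toContinuousLinearMap).continuous) (fun S b hS hSb => ?_) f
  change U t (Φ _) ∈ K
  rw [hΦ _ b _ _ _ hSb, ← h𝓔.proj_flow hUV hS]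
  obtain ⟨g, hg⟩ := hmem b
  rw [← hg]
  exact hs.proj_embedding_mem_range h𝓔 h₀ hΦ hS g

/-- The resolvent is an integral of operators that preserve the closed range of `Φ` and commute with
`𝓔`, so it does both and compresses to a local operator. -/
theorem exists_resolvent (hμ : IsConformalMeasure c β (measure 𝓔 c β s a₀))
    (hs0 : s a₀ ≠ 0)
    (hcomm : ∀ T : H →L[ℂ] H, (∀ a, Commute T (V.adj a)) → (∀ a, Commute T (V.op a)) →
      ∃ k : ℂ, ∀ b, T (s b) = k • s b)
    (hadd : ∀ (s t : ℝ) (x : H), U (s + t) x = U s (U t x))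
    (hcont : ∀ x : H, Continuous fun t : ℝ => U t x)
    (hUV : ∀ (a : P) (t : ℝ) (x : H),
      U t (V a ((U t).symm x)) = Complex.exp (Complex.I * (t * c a : ℝ)) • V a x)
    {z : ℂ} (hz : 0 < z.re) :
    ∃ R : L2Xu (measure 𝓔 c β s a₀) →L[ℂ] L2Xu (measure 𝓔 c β s a₀),
      IsLocalOperator R ∧ ∀ f, Φ (R f) = flowResolvent U z (Φ f) := by
  obtain ⟨T, hT⟩ := exists_flowResolvent_eq hcont hz
  have hcommT : ∀ B : H →L[ℂ] H, (∀ t x, B (U t x) = U t (B x)) → ∀ x, B (T x) = T (B x) := by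
    intro B hB x
    have h := map_flowResolvent hcont hz B 0 (fun t x => by simp [hB]) x
    rw [hT, hT, h]
    simp
  have hTK : ∀ f, T (Φ f) ∈ LinearMap.range Φ.toLinearMap := by
    intro f
    have hclosed : IsClosed (LinearMap.range Φ.toLinearMap : Set H) :=
      Φ.isometry.isClosedEmbedding.isClosed_range
    have : CompleteSpace (LinearMap.range Φ.toLinearMap) := hclosed.completeSpace_coe
    rw [← Submodule.starProjection_eq_self_iff, hT, flowResolvent,
      ← ContinuousLinearMap.integral_comp_comm _ (integrableOn_exp_smul_flow hcont hz _ 0)]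
    refine integral_congr_ae (ae_of_all _ fun t => ?_)
    simp only
    rw [Submodule.starProjection_eq_self_iff]
    exact Submodule.smul_mem _ _ (hs.flow_embedding_mem_range h𝓔 h₀ hΦ hμ hs0 hcomm hadd hcont
      hUV t ⟨f, rfl⟩)
  obtain ⟨R, hR, hRΦ⟩ := hs.exists_isLocalOperator h𝓔 h₀ hΦ hTK fun S hS =>
    ContinuousLinearMap.ext fun x => (hcommT _ (h𝓔.proj_flow hUV hS) x).symm
  exact ⟨R, hR, fun f => by rw [hRΦ, hT]⟩

end IsConformalFamily
end Embedding
end ConformalIsometries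

namespace ConformalIsometries
open Set Filter Topology
open scoped InnerProductSpace

/-! ### Equivariant functions and invariant measures -/

section Cocycle

variable {G : Type*} [AddCommGroup G] [TopologicalSpace G] {P : AddSubmonoid G}
  [IsTopologicalAddGroup G] {μ : Measure (Yu P)} {c : G →+ ℝ} {β : ℝ}

theorem IsConformalMeasure.ae_translate (hμ : IsConformalMeasure c β μ) (t : G) {p : Yu P → Prop}
    (h : ∀ᵐ A ∂μ, p A) : ∀ᵐ A ∂μ, p (Yu.translate t A) := by
  have h1 := (hμ.quasiMeasurePreserving (-t)).ae h
  rwa [neg_neg] at h1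

theorem translate_mem_Xu {p : G} (hp : p ∈ P) {A : Yu P} (hA : A ∈ Xu P) :
    Yu.translate p A ∈ Xu P :=
  translate_mem_Xu_of_neg hp (by rwa [Yu.translate_neg_translate])

/-- Formally `R_z` is multiplication by `1/(z - ig)`, so `g = -Im(1/h)` for the multiplier `h` of
`R_1`. If `k` is the multiplier at `w = 1 + i c(p)`, the resolvent identity reads `1/k - 1/h = i
c(p)`, and covariance reads `k(A + p) = h(A)`; together they give the equivariance of `g`. A single
resolvent yields one measurable function, so no logarithm of the multipliers of the `U_t` has to be
chosen. -/
theorem exists_equivariant_of_local {a₀ : P} (h₀ : IsOrderUnit P (a₀ : G))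
    (hμ : IsConformalMeasure c β μ) (hwin : ∀ b : P, μ (window P (b : G)) ≠ ∞)
    {R : ℂ → L2Xu μ →L[ℂ] L2Xu μ} (hR : ∀ z : ℂ, 0 < z.re → IsLocalOperator (R z))
    (hsub : ∀ z w : ℂ, 0 < z.re → 0 < w.re → ∀ f, R z f - R w f = (w - z) • R z (R w f))
    (hinj : ∀ f, R 1 f = 0 → f = 0)
    (hcov : ∀ (p : P) f, conformalRep hμ p (R 1 f)
      = R (1 + Complex.I * (c p : ℝ)) (conformalRep hμ p f)) :
    ∃ g : Yu P → ℝ, Measurable g ∧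
      ∀ p : P, ∀ᵐ A ∂μ, A ∈ Xu P → g (Yu.translate (p : G) A) = g A + c p := by
  have h1re : (0 : ℝ) < (1 : ℂ).re := by simp
  let e : ℕ → L2Xu μ := fun n => L2Xu.indicator (measurableSet_slab (a₀ : G) n)
    ((slab_subset_window a₀ n).trans (window_subset_Xu _))
    (measure_ne_top_of_subset (slab_subset_window a₀ n) (hwin _))
  have he : ∀ n : ℕ, ∀ᵐ A ∂μ, A ∈ slab P (a₀ : G) n → (e n : Lp ℂ 2 μ) A = 1 := fun n => by
    filter_upwards [L2Xu.indicator_coeFn (measurableSet_slab (a₀ : G) n)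
      ((slab_subset_window a₀ n).trans (window_subset_Xu _))
      (measure_ne_top_of_subset (slab_subset_window a₀ n) (hwin _))] with A hA hAn
    rw [hA, indicator_of_mem hAn]
  obtain ⟨h, hh, hRh⟩ := (hR 1 h1re).exists_multiplier h₀ hwin
  -- The indicator of the zero set of `h` within a slab is killed by `R 1`, hence is zero by
  -- injectivity.
  have hne : ∀ᵐ A ∂μ, A ∈ Xu P → h A ≠ 0 := by
    have hN : ∀ n : ℕ, ∀ᵐ A ∂μ, A ∉ slab P (a₀ : G) n ∩ h ⁻¹' {0} := by
      intro n
      have hS : MeasurableSet (slab P (a₀ : G) n ∩ h ⁻¹' {0}) :=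
        (measurableSet_slab _ _).inter (hh (measurableSet_singleton 0))
      have hSX := (inter_subset_left.trans (slab_subset_window a₀ n) :
        slab P (a₀ : G) n ∩ h ⁻¹' {0} ⊆ _)
      have hfin := measure_ne_top_of_subset hSX (hwin _)
      have hv := L2Xu.indicator_coeFn hS (hSX.trans (window_subset_Xu _)) hfin
      set v : L2Xu μ := L2Xu.indicator hS (hSX.trans (window_subset_Xu _)) hfin
      have hRv : R 1 v = 0 := by
        refine L2Xu.ext_ae ?_
        filter_upwards [hRh v, (R 1 v).2, hv, Lp.coeFn_zero ℂ 2 μ] with A h1 h2 h3 h4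
        rw [Submodule.coe_zero, h4, Pi.zero_apply]
        by_cases hA : A ∈ Xu P
        · rw [h1 hA, h3]
          by_cases hA' : A ∈ slab P (a₀ : G) n ∩ h ⁻¹' {0}
          · rw [show h A = 0 from hA'.2, zero_mul]
          · rw [indicator_of_notMem hA', mul_zero]
        · exact h2 hA
      have hv0 := hinj v hRv
      rw [hv0] at hv
      filter_upwards [hv, Lp.coeFn_zero ℂ 2 μ] with A h1 h2 hA
      rw [Submodule.coe_zero, h2, indicator_of_mem hA] at h1
      exact zero_ne_one h1
    filter_upwards [ae_all_iff.2 hN] with A hA hAX hA0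
    obtain ⟨n, hn⟩ := h₀.exists_mem_slab hAX
    exact hA n ⟨hn, hA0⟩
  refine ⟨fun A => -((h A)⁻¹).im, (Complex.measurable_im.comp hh.inv).neg, fun p => ?_⟩
  set w : ℂ := 1 + Complex.I * (c p : ℝ) with hw
  have hwre : 0 < w.re := by simp [hw]
  obtain ⟨k, hk, hRk⟩ := (hR w hwre).exists_multiplier h₀ hwin
  have hres : ∀ᵐ A ∂μ, A ∈ Xu P → h A - k A = (w - 1) * (h A * k A) := by
    have hn : ∀ n : ℕ, ∀ᵐ A ∂μ, A ∈ slab P (a₀ : G) n → h A - k A = (w - 1) * (h A * k A) := by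
      intro n
      have hs := congrArg (Subtype.val : L2Xu μ → Lp ℂ 2 μ) (hsub 1 w h1re hwre (e n))
      have h5 : ((R 1 (e n) : Lp ℂ 2 μ) - (R w (e n) : Lp ℂ 2 μ) : Lp ℂ 2 μ)
        =ᵐ[μ] ((w - 1) • (R 1 (R w (e n)) : Lp ℂ 2 μ) : Lp ℂ 2 μ) := by
        rw [← Submodule.coe_sub, ← Submodule.coe_smul, hs]
      filter_upwards [he n, hRh (e n), hRk (e n), hRh (R w (e n)), h5,
        Lp.coeFn_sub (R 1 (e n) : Lp ℂ 2 μ) (R w (e n) : Lp ℂ 2 μ),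
        Lp.coeFn_smul (w - 1) (R 1 (R w (e n)) : Lp ℂ 2 μ)] with A h1 h2 h3 h4 h5 h6 h7 hA
      have hAX : A ∈ Xu P := window_subset_Xu _ (slab_subset_window a₀ n hA)
      rw [h6, h7, Pi.sub_apply, Pi.smul_apply, h4 hAX, h2 hAX, h3 hAX, h1 hA, mul_one, mul_one,
        smul_eq_mul] at h5
      exact h5
    filter_upwards [ae_all_iff.2 hn] with A hA hAX
    obtain ⟨n, hn⟩ := h₀.exists_mem_slab hAX
    exact hA n hn
  have hshift : ∀ᵐ A ∂μ, A ∈ Xu P → k (Yu.translate (p : G) A) = h A := by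
    have hn : ∀ n : ℕ, ∀ᵐ A ∂μ, A ∈ slab P (a₀ : G) n → k (Yu.translate (p : G) A) = h A := by
      intro n
      have h1 : ∀ᵐ A ∂μ, (koopman hμ (p : G) (R 1 (e n) : Lp ℂ 2 μ) : Lp ℂ 2 μ) A
          = (R w (conformalRep hμ p (e n)) : Lp ℂ 2 μ) A := by
        have h2 := congrArg (Subtype.val : L2Xu μ → Lp ℂ 2 μ) (hcov p (e n))
        have h3 : koopman hμ (p : G) (R 1 (e n) : Lp ℂ 2 μ)
          = (R w (conformalRep hμ p (e n)) : Lp ℂ 2 μ) := h2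
        rw [h3]
        exact ae_of_all _ fun _ => rfl
      have h2 : ∀ᵐ A ∂μ, (conformalRep hμ p (e n) : Lp ℂ 2 μ) A
          = koopmanFun c β (p : G) (e n : Lp ℂ 2 μ) A :=
        koopman_coeFn hμ (p : G) (e n : Lp ℂ 2 μ)
      filter_upwards [hμ.ae_translate (p : G) h1, hμ.ae_translate (p : G) h2,
        hμ.ae_translate (p : G) (koopman_coeFn hμ (p : G) (R 1 (e n) : Lp ℂ 2 μ)),
        hμ.ae_translate (p : G) (hRk (conformalRep hμ p (e n))), hRh (e n), he n]
        with A h3 h4 h5 h6 h7 h8 hA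
      have hAX : A ∈ Xu P := window_subset_Xu _ (slab_subset_window a₀ n hA)
      rw [h5, h6 (translate_mem_Xu p.2 hAX), h4, koopmanFun, koopmanFun,
        Yu.translate_neg_translate, h7 hAX, h8 hA, mul_one, mul_one, mul_comm] at h3
      refine (mul_right_cancel₀ ?_ h3).symm
      exact_mod_cast (Real.exp_pos _).ne'
    filter_upwards [ae_all_iff.2 hn] with A hA hAX
    obtain ⟨n, hn⟩ := h₀.exists_mem_slab hAX
    exact hA n hn
  filter_upwards [hne, hμ.ae_translate (p : G) hne, hμ.ae_translate (p : G) hres, hshift]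
    with A h1 h2 h3 h4 hA
  have hA' := translate_mem_Xu p.2 hA
  have h5 := h3 hA'
  rw [h4 hA, hw, add_sub_cancel_left] at h5
  have h6 : (h A)⁻¹ - (h (Yu.translate (p : G) A))⁻¹ = Complex.I * (c p : ℝ) := by
    have h7 := h1 hA
    have h8 := h2 hA'
    field_simp
    linear_combination h5
  have h7 := congrArg Complex.im h6
  rw [Complex.sub_im, Complex.I_mul_im, Complex.ofReal_re] at h7
  linarith

theorem exists_equivariant_extension {a₀ : P} (h₀ : IsOrderUnit P (a₀ : G))
    (hμ : IsConformalMeasure c β μ) {g : Yu P → ℝ} (hg : Measurable g)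
    (hgp : ∀ p : P, ∀ᵐ A ∂μ, A ∈ Xu P → g (Yu.translate (p : G) A) = g A + c p) :
    ∃ f : Yu P → ℝ, Measurable f ∧
      ∀ p : P, ∀ᵐ A ∂μ, f (Yu.translate (p : G) A) = f A + c p := by
  -- On slab `n`, translate back by `n a₀` into `X_u`, evaluate `g`, and add the increment `n c(a₀)`
  -- that equivariance demands.
  obtain ⟨f, hf, hfg⟩ := exists_measurable_piecewise (fun n : ℤ => slab P (a₀ : G) n)
    (fun n => measurableSet_slab _ _)
    (fun n A => g (Yu.translate (-(n • (a₀ : G))) A) + n * c a₀)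
    (fun n => (hg.comp (Yu.measurable_translate _)).add_const _) (fun n m hnm => by
      have h := (disjoint_slab h₀.mem hnm).inter_eq
      change EqOn _ _ (slab P (a₀ : G) n ∩ slab P (a₀ : G) m)
      rw [h]
      exact eqOn_empty _ _)
  refine ⟨f, hf, fun p => ?_⟩
  have h1 : ∀ n : ℤ, ∀ᵐ A ∂μ, Yu.translate (-(n • (a₀ : G))) A ∈ Xu P →
      g (Yu.translate (p : G) (Yu.translate (-(n • (a₀ : G))) A))
        = g (Yu.translate (-(n • (a₀ : G))) A) + c p := fun n => hμ.ae_translate _ (hgp p)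
  have h2 : ∀ (m : ℤ) (j : ℕ), ∀ᵐ A ∂μ, Yu.translate (-(m • (a₀ : G)) + p) A ∈ Xu P →
      g (Yu.translate ((j • a₀ : P) : G) (Yu.translate (-(m • (a₀ : G)) + p) A))
        = g (Yu.translate (-(m • (a₀ : G)) + p) A) + c ((j • a₀ : P) : G) := fun m j =>
    hμ.ae_translate _ (hgp (j • a₀))
  filter_upwards [ae_all_iff.2 h1, ae_all_iff.2 fun m => ae_all_iff.2 (h2 m)] with A h3 h4
  obtain ⟨n, hn⟩ := mem_iUnion.1 ((iUnion_slab h₀).symm ▸ mem_univ A)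
  obtain ⟨m, hm⟩ := mem_iUnion.1 ((iUnion_slab h₀).symm ▸ mem_univ (Yu.translate (p : G) A))
  have hBX : Yu.translate (-(n • (a₀ : G))) A ∈ Xu P := by
    have h := hn.1
    change (0 : G) - -(n • (a₀ : G)) ∈ A.toSet
    rwa [zero_sub, neg_neg]
  have hCX : Yu.translate (-(m • (a₀ : G)) + p) A ∈ Xu P := by
    have h := hm.1
    rw [← Yu.translate_translate]
    change (0 : G) - -(m • (a₀ : G)) ∈ (Yu.translate (p : G) A).toSet
    rwa [zero_sub, neg_neg]
  have hnm : n ≤ m := by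
    by_contra hlt
    refine hm.2 (zsmul_mem_of_le h₀.mem (show m + 1 ≤ n by omega) ?_)
    rw [Yu.mem_translate]
    exact A.sub_mem hn.1 p.2
  -- Translation by `p` can only raise the slab index. Moving `A - n a₀` by `p` and `A + p - (n + j)
  -- a₀` by `j a₀` leads to the same set `A + p - n a₀`; comparing the two values of `g` gives the
  -- claim.
  obtain ⟨j, rfl⟩ := Int.le.dest hnm
  have h5 := h4 (n + j) j hCX
  have h6 := h3 n hBX
  have h7 : ((j • a₀ : P) : G) = j • (a₀ : G) := rfl
  rw [Yu.translate_translate, h7, map_nsmul, nsmul_eq_mul] at h5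
  rw [Yu.translate_translate] at h6
  have h8 : j • (a₀ : G) + (-((n + (j : ℤ)) • (a₀ : G)) + p) = p + -(n • (a₀ : G)) := by
    rw [add_zsmul, natCast_zsmul]
    abel
  rw [h8, h6] at h5
  rw [hfg n hn, hfg _ hm]
  simp only [Yu.translate_translate]
  push_cast
  linarith

/-- A conformal measure with an equivariant function is equivalent to an invariant measure. -/
theorem IsConformalMeasure.exists_isInvariantMeasure [SigmaFinite μ]
    (hgen : ∀ s : G, ∃ a ∈ P, ∃ b ∈ P, s = a - b)
    (hμ : IsConformalMeasure c β μ) {f : Yu P → ℝ} (hf : Measurable f)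
    (hfp : ∀ p : P, ∀ᵐ A ∂μ, f (Yu.translate (p : G) A) = f A + c p) :
    ∃ ν : Measure (Yu P), SigmaFinite ν ∧ IsInvariantMeasure ν ∧ ν ≪ μ ∧ μ ≪ ν := by
  -- The density `e^{βf}` gains `e^{βc(p)}` under translation by `p`, which cancels the conformal
  -- factor `e^{-βc(p)}`. It is positive and finite everywhere, so equivalence and σ-finiteness
  -- persist.
  let F : Yu P → ℝ≥0∞ := fun A => ENNReal.ofReal (Real.exp (β * f A))
  have hF : Measurable F := (Real.measurable_exp.comp (hf.const_mul β)).ennreal_ofReal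
  have hinvP : ∀ (p : P) (E : Set (Yu P)), MeasurableSet E →
      μ.withDensity F (Yu.translate (p : G) '' E) = μ.withDensity F E := by
    intro p E hE
    have hE' : MeasurableSet (Yu.translate (p : G) '' E) := by
      rw [← Yu.preimage_translate_neg]
      exact Yu.measurable_translate _ hE
    rw [withDensity_apply _ hE', withDensity_apply _ hE, ← lintegral_indicator hE,
      ← lintegral_indicator hE']
    have hmp := hμ.measurePreserving (p : G)
    have h1 := hmp.lintegral_comp (f := E.indicator F) (hF.indicator hE)
    rw [lintegral_smul_measure, smul_eq_mul] at h1
    have h2 : ∫⁻ A, (Yu.translate (p : G) '' E).indicator F A ∂μ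
        = ENNReal.ofReal (Real.exp (β * c p)) *
          ∫⁻ A, E.indicator F (Yu.translate (-(p : G)) A) ∂μ := by
      have hm : Measurable fun A => E.indicator F (Yu.translate (-(p : G)) A) :=
        (hF.indicator hE).comp (Yu.measurable_translate _)
      rw [← lintegral_const_mul _ hm]
      refine lintegral_congr_ae ?_
      filter_upwards [hμ.ae_translate (-(p : G)) (hfp p)] with A hA
      rw [Yu.translate_translate_neg] at hA
      rw [← Yu.preimage_translate_neg]
      by_cases hAE : Yu.translate (-(p : G)) A ∈ E
      · rw [indicator_of_mem hAE, indicator_of_mem (mem_preimage.2 hAE)]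
        simp only [F]
        rw [← ENNReal.ofReal_mul (Real.exp_pos _).le, ← Real.exp_add, hA]
        congr 2
        ring
      · rw [indicator_of_notMem hAE, mul_zero, indicator_of_notMem (mt mem_preimage.1 hAE)]
    rw [h2, h1, ← mul_assoc, ← ENNReal.ofReal_mul (Real.exp_pos _).le, ← Real.exp_add]
    simp
  refine ⟨μ.withDensity F, SigmaFinite.withDensity_ofReal _, fun t E hE => ?_,
    withDensity_absolutelyContinuous _ _, withDensity_absolutelyContinuous' hF.aemeasurable
      (ae_of_all _ fun A => (ENNReal.ofReal_pos.2 (Real.exp_pos _)).ne')⟩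
  obtain ⟨p, hp, q, hq, rfl⟩ := hgen t
  have hE' : MeasurableSet (Yu.translate (p - q) '' E) := by
    rw [← Yu.preimage_translate_neg]
    exact Yu.measurable_translate _ hE
  rw [← hinvP ⟨p, hp⟩ E hE, ← hinvP ⟨q, hq⟩ _ hE', image_image]
  simp only [Yu.translate_translate, add_sub_cancel]

end Cocycle
end ConformalIsometries

/-! ### Assembly of the theorem -/

open ConformalIsometries
theorem theorem3 {G : Type*} [AddCommGroup G] [TopologicalSpace G] [IsTopologicalAddGroup G]
    [LocallyCompactSpace G] [SecondCountableTopology G] [T2Space G]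
    (P : AddSubmonoid G) (hP_closed : IsClosed (P : Set G))
    (hP_gen : ∀ s : G, ∃ a ∈ P, ∃ b ∈ P, s = a - b)
    (hP_dense : (P : Set G) ⊆ closure (interior (P : Set G)))
    (hP_unit : ∃ a₀ ∈ interior (P : Set G), ∀ s : G, ∃ n : ℕ, 0 < n ∧
      n • a₀ - s ∈ interior (P : Set G))
    (c : G →+ ℝ) (hc : Continuous c) (β : ℝ) (hβ : β ≠ 0)
    {H : Type*} [NormedAddCommGroup H] [InnerProductSpace ℂ H] [CompleteSpace H]
    [TopologicalSpace.SeparableSpace H]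
    (V : IsometrySemigroup P H) (hV_cont : V.IsStronglyContinuous) (hV_pure : V.IsPure)
    (hV_comm : V.HasCommutingRangeProjections) (hV_conf : V.IsConformal c β)
    (hV_dim : Module.rank ℂ (V.eigenspace c β) = 1)
    (U : ℝ → (H ≃ₗᵢ[ℂ] H)) (hU_add : ∀ (s t : ℝ) (x : H), U (s + t) x = U s (U t x))
    (hU_cont : ∀ x : H, Continuous fun t : ℝ => U t x)
    (hUV : ∀ (a : P) (t : ℝ) (x : H),
      U t (V a ((U t).symm x)) = Complex.exp (Complex.I * (t * c a : ℝ)) • V a x) :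
    ∃ (μ : MeasureTheory.Measure (Yu P)) (hμ : IsConformalMeasure c β μ),
      μ ≠ 0 ∧ μ.Regular ∧ IsErgodicMeasure μ ∧
      (conformalRep hμ).IsDirectSummand V ∧
      ∃ ν : MeasureTheory.Measure (Yu P), MeasureTheory.SigmaFinite ν ∧ IsInvariantMeasure ν ∧
        ν.AbsolutelyContinuous μ ∧ μ.AbsolutelyContinuous ν := by
  obtain ⟨a₀, ha₀, hunit⟩ := hP_unit
  have h₀ : IsOrderUnit P ((⟨a₀, interior_subset ha₀⟩ : P) : G) := ⟨ha₀, hunit⟩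
  obtain ⟨s, hs, hs0, hs_adj, hcomm⟩ :=
    IsometrySemigroup.exists_isConformalFamily h₀ hV_conf hV_dim
  have : Nonempty (Yu P) := IsometrySemigroup.nonempty_Yu hs0 (hs_adj _) hP_closed
  obtain ⟨𝓔, h𝓔⟩ := exists_isCovariant hP_dense hP_gen h₀ hV_cont hV_pure hV_comm
  have hμ := hs.isConformalMeasure h𝓔 h₀ hP_gen
  refine ⟨_, hμ, hs.measure_ne_zero h𝓔 h₀ hs0, hs.regular h𝓔 h₀ hP_gen hP_dense,
    IsConformalFamily.isErgodicMeasure h𝓔 hs0 hcomm, hs.isDirectSummand h𝓔 h₀ hμ, ?_⟩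
  have hσ := hs.sigmaFinite h𝓔 h₀ hP_gen
  obtain ⟨Φ, hΦ⟩ := hs.exists_embedding h𝓔 h₀
  have hres : ∀ z : {z : ℂ // 0 < z.re}, _ := fun z =>
    hs.exists_resolvent h𝓔 h₀ hΦ hμ hs0 hcomm hU_add hU_cont hUV z.2
  choose R hR hRΦ using hres
  -- The value 0 outside the right half-plane is never used.
  let R' : ℂ → _ := fun z => if hz : 0 < z.re then R ⟨z, hz⟩ else 0
  have hR'Φ : ∀ z : ℂ, 0 < z.re → ∀ f, Φ (R' z f) = flowResolvent U z (Φ f) := by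
    intro z hz f
    simp only [R', dif_pos hz]
    exact hRΦ ⟨z, hz⟩ f
  have h1re : (0 : ℝ) < (1 : ℂ).re := by simp
  obtain ⟨g, hg, hgp⟩ := exists_equivariant_of_local h₀ hμ (hs.measure_window_ne_top h𝓔 h₀)
    (R := R') (fun z hz => by
      simp only [R', dif_pos hz]
      exact hR ⟨z, hz⟩)
    (fun z w hz hw f => Φ.injective (by
      rw [map_sub, map_smul, hR'Φ z hz, hR'Φ w hw, hR'Φ z hz, hR'Φ w hw]
      exact flowResolvent_sub hU_add hU_cont hz hw _))
    (fun f hf => Φ.injective (by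
      rw [map_zero]
      refine eq_zero_of_flowResolvent_eq_zero hU_add hU_cont h1re ?_
      rw [← hR'Φ 1 h1re, hf, map_zero]))
    (fun p f => Φ.injective (by
      rw [hs.embedding_conformalRep h𝓔 h₀ hμ hΦ, hR'Φ 1 h1re, hR'Φ _ (by simp),
        hs.embedding_conformalRep h𝓔 h₀ hμ hΦ]
      exact map_flowResolvent hU_cont h1re (V.op p) (c p) (fun t x => op_flow hUV p t x) _))
  obtain ⟨f, hf, hfp⟩ := exists_equivariant_extension h₀ hμ hg hgp
  exact hμ.exists_isInvariantMeasure hP_gen hf hfp
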